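/- Let $\Sigma$ be a finite alphabet and let $s:\mathbb N\to\mathbb N$ be any function with $s(n)=O(\log n)$ (a machine with space bound $s$ may use at most $\max(1,s(n))$ cells on each work tape, in every computation on every input of length $n$). A *private alternating Turing machine* (PATM) has a two-way read-only input tape with end-markers and finitely many work tapes. Its memory (finite control, work tapes, input head) is divided into a public part and a part that is private to the universal player. Its states are existential, universal, deterministic, accepting or rejecting. In an existential state the existential player chooses one of finitely many moves; such moves neither read nor change the private part. In a universal state the universal player chooses one of finitely many moves, and in a deterministic state there is exactly one move; these moves may read and change the entire memory. A *strategy* for the existential player on input $x$ determines each choice of this player from the history of that player's own earlier choices and of all changes of the public part made by the other moves; moves that change only the private part, and their number, are not seen. A string $x$ is accepted if and only if the existential player has a strategy on $x$ such that every play following it reaches an accepting state after finitely many moves. A *blind alternating Turing machine* (BATM) is a PATM in which universal and deterministic moves change only the private part. A machine makes a *constant number of universal moves* if there is an $r$ such that no computation on any input contains more than $r$ moves made from universal states (deterministic moves are not counted). Then the class of languages over $\Sigma$ recognized by $s(n)$-space PATMs that make a constant number of universal moves equals $\mathsf{NL}$, and the class of languages over $\Sigma$ recognized by $s(n)$-space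 BATMs that make a constant number of universal moves also equals $\mathsf{NL}$, where $\mathsf{NL}$ is the class of languages recognized by nondeterministic Turing machines using $O(\log n)$ work space. -/

import Mathlib

namespace PrivAlt

/-- Head movements. -/
inductive Dir
  | left
  | stay
  | right

/-- Symbols on the read-only input tape: the input alphabet and the two end-markers. -/
inductive InSym (α : Type) : Type
  | leftEnd
  | sym (a : α)
  | rightEnd

/-- The input tape for `x` has cells `0, …, |x| + 1`; cell `0` is the left end-marker,
cell `|x| + 1` the right one. -/
def inputSym {α : Type} (x : List α) : ℕ → InSym α
  | 0 => .leftEnd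
  | i + 1 => match x[i]? with
    | some a => .sym a
    | none => .rightEnd

/-- The input head never leaves the cells `0, …, n + 1`. -/
def Dir.moveInput (n : ℕ) : Dir → ℕ → ℕ
  | .left, p => p - 1
  | .stay, p => p
  | .right, p => min (p + 1) (n + 1)

/-- Work tapes are infinite to the right only; a left move on cell `0` has no effect. -/
def Dir.moveWork : Dir → ℕ → ℕ
  | .left, p => p - 1
  | .stay, p => p
  | .right, p => p + 1

structure WorkTape (A : Type) where
  cells : ℕ → A
  head : ℕ

namespace WorkTape

variable {A : Type}

def empty (blank : A) : WorkTape A := ⟨fun _ => blank, 0⟩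

def read (t : WorkTape A) : A := t.cells t.head

/-- Write a symbol on the scanned cell, then move the head. -/
def act (t : WorkTape A) (w : A × Dir) : WorkTape A :=
  ⟨Function.update t.cells t.head w.1, w.2.moveWork t.head⟩

/-- The head is within the first `max 1 s` cells (a head always scans at least one cell, so
a space bound `0` is read as `1`). -/
def Within (t : WorkTape A) (s : ℕ) : Prop := t.head < max 1 s

end WorkTape

/-- Logarithmic growth of a space bound. -/
def IsLogBound (s : ℕ → ℕ) : Prop :=
  (fun n => (s n : ℝ)) =O[Filter.atTop] fun n : ℕ => Real.log n

/-! ### Nondeterministic machines and NL -/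

/-- A nondeterministic Turing machine with a two-way read-only input tape and finitely many
work tapes, indexed by `Tape`. -/
structure NTM (α : Type) where
  State : Type
  Sym : Type
  Tape : Type
  [finState : Finite State]
  [finSym : Finite Sym]
  [finTape : Finite Tape]
  blank : Sym
  start : State
  accept : State
  next : State → InSym α → (Tape → Sym) → Set (State × Dir × (Tape → Sym × Dir))

namespace NTM

variable {α : Type} (M : NTM α)

structure Cfg where
  state : M.State
  inHead : ℕ
  tapes : M.Tape → WorkTape M.Sym

def startCfg : M.Cfg := ⟨M.start, 0, fun _ => WorkTape.empty M.blank⟩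

def Step (x : List α) (c c' : M.Cfg) : Prop :=
  ∃ a ∈ M.next c.state (inputSym x c.inHead) (fun t => (c.tapes t).read),
    c' = ⟨a.1, a.2.1.moveInput x.length c.inHead, fun t => (c.tapes t).act (a.2.2 t)⟩

def Reachable (x : List α) (c : M.Cfg) : Prop :=
  Relation.ReflTransGen (M.Step x) M.startCfg c

def Accepts (x : List α) : Prop := ∃ c, M.Reachable x c ∧ c.state = M.accept

/-- On every input, every computation stays within the space bound on each work tape. -/
def SpaceBounded (s : ℕ → ℕ) : Prop :=
  ∀ x c, M.Reachable x c → ∀ t, (c.tapes t).Within (s x.length)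

end NTM

/-- Nondeterministic space `s`. -/
def NSPACE (α : Type) (s : ℕ → ℕ) : Set (Language α) :=
  {L | ∃ M : NTM α, M.SpaceBounded s ∧ ∀ x, x ∈ L ↔ M.Accepts x}

/-- Nondeterministic logarithmic space. -/
def NL (α : Type) : Set (Language α) :=
  {L | ∃ s, IsLogBound s ∧ L ∈ NSPACE α s}

/-! ### Private alternation -/

/-- The five kinds of control states. Deterministic states have a single successor and belong
to neither player's choices. -/
inductive Kind
  | existential
  | universal
  | deterministic
  | accept
  | reject

/-- A private alternating Turing machine. The memory is split into a public part (control
component `Pub`, work tapes `PubTape`, and the input head if `headPrivate = false`) and a part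
that is private to the universal player (control component `Priv`, work tapes `PrivTape`, and
the input head if `headPrivate = true`).

A move in an existential state is determined by the public part and by the choice of the
existential player in `EChoice`; it acts on the public part only. Moves in universal states
(with a choice in `UChoice`) and in deterministic states read and write everything. -/
structure PATM (α : Type) where
  Pub : Type
  Priv : Type
  Sym : Type
  PubTape : Type
  PrivTape : Type
  EChoice : Type
  UChoice : Type
  [finPub : Finite Pub]
  [finPriv : Finite Priv]
  [finSym : Finite Sym]
  [finPubTape : Finite PubTape]
  [finPrivTape : Finite PrivTape]
  [finEChoice : Finite EChoice]
  [finUChoice : Finite UChoice]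
  [neEChoice : Nonempty EChoice]
  [neUChoice : Nonempty UChoice]
  headPrivate : Bool
  blank : Sym
  startPub : Pub
  startPriv : Priv
  kind : Pub → Priv → Kind
  /-- The input symbol is available (as `some`) only if the input head is public. -/
  nextE : Pub → Option (InSym α) → (PubTape → Sym) → EChoice →
    Pub × Dir × (PubTape → Sym × Dir)
  nextU : Pub → Priv → InSym α → (PubTape → Sym) → (PrivTape → Sym) → UChoice →
    Pub × Priv × Dir × (PubTape → Sym × Dir) × (PrivTape → Sym × Dir)
  nextD : Pub → Priv → InSym α → (PubTape → Sym) → (PrivTape → Sym) →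
    Pub × Priv × Dir × (PubTape → Sym × Dir) × (PrivTape → Sym × Dir)

namespace PATM

variable {α : Type} (M : PATM α)

structure Cfg where
  pub : M.Pub
  priv : M.Priv
  inHead : ℕ
  pubTapes : M.PubTape → WorkTape M.Sym
  privTapes : M.PrivTape → WorkTape M.Sym

/-- What the existential player can see of a configuration. -/
structure View where
  pub : M.Pub
  inHead : Option ℕ
  pubTapes : M.PubTape → WorkTape M.Sym

def startCfg : M.Cfg :=
  ⟨M.startPub, M.startPriv, 0, fun _ => WorkTape.empty M.blank,
    fun _ => WorkTape.empty M.blank⟩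

variable {M}

def Cfg.kind (c : M.Cfg) : Kind := M.kind c.pub c.priv

def Cfg.view (c : M.Cfg) : M.View :=
  ⟨c.pub, if M.headPrivate then none else some c.inHead, c.pubTapes⟩

/-- The effect of the existential choice `e`; a private input head is neither read nor moved. -/
def Cfg.stepE (x : List α) (c : M.Cfg) (e : M.EChoice) : M.Cfg :=
  let a := M.nextE c.pub (if M.headPrivate then none else some (inputSym x c.inHead))
    (fun t => (c.pubTapes t).read) e
  ⟨a.1, c.priv, if M.headPrivate then c.inHead else a.2.1.moveInput x.length c.inHead,
    fun t => (c.pubTapes t).act (a.2.2 t), c.privTapes⟩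

/-- The effect of an action on the whole memory. -/
def Cfg.act (x : List α) (c : M.Cfg)
    (a : M.Pub × M.Priv × Dir × (M.PubTape → M.Sym × Dir) × (M.PrivTape → M.Sym × Dir)) :
    M.Cfg :=
  ⟨a.1, a.2.1, a.2.2.1.moveInput x.length c.inHead,
    fun t => (c.pubTapes t).act (a.2.2.2.1 t), fun t => (c.privTapes t).act (a.2.2.2.2 t)⟩

def Cfg.stepU (x : List α) (c : M.Cfg) (u : M.UChoice) : M.Cfg :=
  c.act x (M.nextU c.pub c.priv (inputSym x c.inHead) (fun t => (c.pubTapes t).read)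
    (fun t => (c.privTapes t).read) u)

def Cfg.stepD (x : List α) (c : M.Cfg) : M.Cfg :=
  c.act x (M.nextD c.pub c.priv (inputSym x c.inHead) (fun t => (c.pubTapes t).read)
    (fun t => (c.privTapes t).read))

variable (M)

/-- `M.ReachesWith x k c`: some computation on `x`, with arbitrary choices of both players, leads
to the configuration `c` after exactly `k` universal moves. -/
inductive ReachesWith (x : List α) : ℕ → M.Cfg → Prop
  | start : ReachesWith x 0 M.startCfg
  | existential {k : ℕ} {c : M.Cfg} (e : M.EChoice) :
      ReachesWith x k c → c.kind = .existential → ReachesWith x k (c.stepE x e)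
  | universal {k : ℕ} {c : M.Cfg} (u : M.UChoice) :
      ReachesWith x k c → c.kind = .universal → ReachesWith x (k + 1) (c.stepU x u)
  | deterministic {k : ℕ} {c : M.Cfg} :
      ReachesWith x k c → c.kind = .deterministic → ReachesWith x k (c.stepD x)

/-- An event noticed by the existential player: a choice made by that player, or a change of the
public part by another move (with the new public part). Moves that change only the private part
go unnoticed, and so does their number. -/
abbrev Event : Type := M.EChoice ⊕ M.View

/-- A strategy of the existential player: the choice to be made after a history of events. -/
abbrev Strategy : Type := List M.Event → M.EChoice

variable {M}

open Classical in
/-- The history after a universal or deterministic move from `c` to `c'`. -/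
noncomputable def observe (h : List M.Event) (c c' : M.Cfg) : List M.Event :=
  if c'.view = c.view then h else h ++ [Sum.inr c'.view]

/-- `Wins x σ h c`: from the configuration `c` with history `h`, every play in which the
existential player follows `σ` reaches an accepting state after finitely many moves. -/
inductive Wins (x : List α) (σ : M.Strategy) : List M.Event → M.Cfg → Prop
  | accept {h : List M.Event} {c : M.Cfg} : c.kind = .accept → Wins x σ h c
  | existential {h : List M.Event} {c : M.Cfg} : c.kind = .existential →
      Wins x σ (h ++ [Sum.inl (σ h)]) (c.stepE x (σ h)) → Wins x σ h c
  | universal {h : List M.Event} {c : M.Cfg} : c.kind = .universal →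
      (∀ u, Wins x σ (observe h c (c.stepU x u)) (c.stepU x u)) → Wins x σ h c
  | deterministic {h : List M.Event} {c : M.Cfg} : c.kind = .deterministic →
      Wins x σ (observe h c (c.stepD x)) (c.stepD x) → Wins x σ h c

variable (M)

/-- The existential player has a winning strategy in the game on input `x`. -/
def Accepts (x : List α) : Prop := ∃ σ : M.Strategy, Wins x σ [] M.startCfg

/-- On every input, every computation stays within the space bound on each work tape. -/
def SpaceBounded (s : ℕ → ℕ) : Prop :=
  ∀ x k c, M.ReachesWith x k c →
    (∀ t, (c.pubTapes t).Within (s x.length)) ∧ ∀ t, (c.privTapes t).Within (s x.length)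

/-- No computation, on any input, contains more than `r` universal moves. -/
def UniversalMovesAtMost (r : ℕ) : Prop := ∀ x k c, M.ReachesWith x k c → k ≤ r

/-- Blind machines: only existential moves change the public part. -/
def IsBlind : Prop :=
  ∀ (x : List α) (c : M.Cfg),
    (c.kind = .universal → ∀ u, (c.stepU x u).view = c.view) ∧
    (c.kind = .deterministic → (c.stepD x).view = c.view)

def Recognizes (L : Language α) : Prop := ∀ x, x ∈ L ↔ M.Accepts x

end PATM

/-- Languages of `s`-space private alternating machines with constantly many universal moves. -/
def PASPACEConst (α : Type) (s : ℕ → ℕ) : Set (Language α) :=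
  {L | ∃ M : PATM α, M.SpaceBounded s ∧ (∃ r, M.UniversalMovesAtMost r) ∧ M.Recognizes L}

/-- Languages of `s`-space blind alternating machines with constantly many universal moves. -/
def BASPACEConst (α : Type) (s : ℕ → ℕ) : Set (Language α) :=
  {L | ∃ M : PATM α, M.IsBlind ∧ M.SpaceBounded s ∧ (∃ r, M.UniversalMovesAtMost r) ∧
    M.Recognizes L}

end PrivAlt

open Relation

namespace PrivAlt

/-! ### Relations defined by finite graphs of primitive operations -/

section Definable

variable {X P : Type} {T : Type}

/-- Optional primitive operations; `none` is the idle operation. -/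
def optSem (sem : P → X → T → T → Prop) : Option P → X → T → T → Prop
  | none, _, t, t' => t' = t
  | some p, x, t, t' => sem p x t t'

/-- A step in a graph whose edges are labelled by relations on stores. -/
def GraphStep {Q I : Type} (E : Set (Q × I × Q)) (R : I → T → T → Prop) (c c' : Q × T) : Prop :=
  ∃ i, (c.1, i, c'.1) ∈ E ∧ R i c.2 c'.2

/-- A family of relations on stores is definable if it is the path relation between two nodes of
a finite graph whose edges are labelled by primitive operations. -/
def Definable (sem : P → X → T → T → Prop) (R : X → T → T → Prop) : Prop :=
  ∃ (Q : Type) (_ : Finite Q) (st fi : Q) (E : Set (Q × Option P × Q)), ∀ x t t',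
    R x t t' ↔ ReflTransGen (GraphStep E fun p => optSem sem p x) (st, t) (fi, t')

variable {sem : P → X → T → T → Prop}

theorem Definable.congr {R R' : X → T → T → Prop} (h : Definable sem R)
    (hR : ∀ x t t', R' x t t' ↔ R x t t') : Definable sem R' := by
  obtain ⟨Q, hQ, st, fi, E, hE⟩ := h
  exact ⟨Q, hQ, st, fi, E, fun x t t' => (hR x t t').trans (hE x t t')⟩

/-- Substitution: the path relation of a finite graph labelled by definable relations is
definable. -/
theorem Definable.graph {Q I : Type} [Finite Q] [Finite I] (E : Set (Q × I × Q))
    (R : I → X → T → T → Prop) (hR : ∀ i, Definable sem (R i)) (st fi : Q) :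
    Definable sem fun x t t' =>
      ReflTransGen (GraphStep E fun i => R i x) (st, t) (fi, t') := by
  choose Q' hQ' st' fi' E' hE' using hR
  let N := Q ⊕ (Σ _ : (Q × I × Q), Σ i : I, Q' i)
  let F : Set (N × Option P × N) := {a |
    (∃ q i q', (q, i, q') ∈ E ∧ a = (.inl q, none, .inr ⟨(q, i, q'), i, st' i⟩)) ∨
    (∃ q i q' g p g', (q, i, q') ∈ E ∧ (g, p, g') ∈ E' i ∧
      a = (.inr ⟨(q, i, q'), i, g⟩, p, .inr ⟨(q, i, q'), i, g'⟩)) ∨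
    (∃ q i q', (q, i, q') ∈ E ∧ a = (.inr ⟨(q, i, q'), i, fi' i⟩, none, .inl q'))}
  refine ⟨N, inferInstance, .inl st, .inl fi, F, fun x t t' => ⟨fun h => ?_, fun h => ?_⟩⟩
  · refine ReflTransGen.lift' (fun c : Q × T => ((.inl c.1, c.2) : N × T)) ?_ _ _ h
    rintro ⟨q, t⟩ ⟨q', t'⟩ ⟨i, hi, ht⟩
    have h2 := (hE' i x t t').1 ht
    refine ReflTransGen.head (b := (.inr ⟨(q, i, q'), i, st' i⟩, t)) ?_ ?_
    · exact ⟨none, Or.inl ⟨q, i, q', hi, rfl⟩, rfl⟩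
    · refine ReflTransGen.tail (b := (.inr ⟨(q, i, q'), i, fi' i⟩, t')) ?_ ?_
      · refine ReflTransGen.lift
          (fun c : Q' i × T => ((.inr ⟨(q, i, q'), i, c.1⟩, c.2) : N × T)) ?_ _ _ h2
        rintro ⟨g, u⟩ ⟨g', u'⟩ ⟨p, hp, hu⟩
        exact ⟨p, Or.inr (Or.inl ⟨q, i, q', g, p, g', hi, hp, rfl⟩), hu⟩
      · exact ⟨none, Or.inr (Or.inr ⟨q, i, q', hi, rfl⟩), rfl⟩
  · let G := ReflTransGen (GraphStep E fun i => R i x) (st, t)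
    let K : N × T → Prop := fun c => match c.1 with
      | .inl q => G (q, c.2)
      | .inr ⟨(q, _, q'), ⟨i, g⟩⟩ => (q, i, q') ∈ E ∧ ∃ u, G (q, u) ∧
          ReflTransGen (GraphStep (E' i) fun p => optSem sem p x) (st' i, u) (g, c.2)
    have key : ∀ c, ReflTransGen (GraphStep F fun p => optSem sem p x) (.inl st, t) c → K c := by
      intro c hc
      induction hc with
      | refl => exact ReflTransGen.refl
      | @tail b c _ hs ih =>
        obtain ⟨n, u⟩ := b
        obtain ⟨n', u'⟩ := c
        obtain ⟨p, hp, hu⟩ := hs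
        rcases hp with ⟨q, i, q', hi, he⟩ | ⟨q, i, q', g, p, g', hi, hg, he⟩ |
          ⟨q, i, q', hi, he⟩
        · simp only [Prod.mk.injEq] at he
          obtain ⟨rfl, rfl, rfl⟩ := he
          have hu : u' = u := hu
          subst hu
          exact ⟨hi, u', ih, ReflTransGen.refl⟩
        · simp only [Prod.mk.injEq] at he
          obtain ⟨rfl, rfl, rfl⟩ := he
          obtain ⟨_, v, hv, hp⟩ := ih
          exact ⟨hi, v, hv, hp.tail ⟨_, hg, hu⟩⟩
        · simp only [Prod.mk.injEq] at he
          obtain ⟨rfl, rfl, rfl⟩ := he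
          have hu : u' = u := hu
          subst hu
          obtain ⟨_, v, hv, hp⟩ := ih
          exact hv.tail ⟨i, hi, (hE' i x v u').2 hp⟩
    exact key _ h

theorem Definable.prim (p : P) : Definable sem (sem p) := by
  refine ⟨Bool, inferInstance, false, true, {(false, some p, true)}, fun x t t' => ⟨fun h => ?_, fun h => ?_⟩⟩
  · exact ReflTransGen.single ⟨some p, rfl, h⟩
  · have key : ∀ c, ReflTransGen (GraphStep {(false, some p, true)}
        fun p => optSem sem p x) (false, t) c → if c.1 then sem p x t c.2 else c.2 = t := by
      intro c hc
      induction hc with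
      | refl => simp
      | tail _ hs ih =>
        obtain ⟨i, hi, hs⟩ := hs
        simp only [Set.mem_singleton_iff, Prod.mk.injEq] at hi
        obtain ⟨h1, rfl, h2⟩ := hi
        simp_all [optSem]
    exact key _ h

theorem Definable.id : Definable sem fun _ t t' => t' = t := by
  refine ⟨Unit, inferInstance, (), (), ∅, fun x t t' => ⟨fun h => ?_, fun h => ?_⟩⟩
  · subst h; exact ReflTransGen.refl
  · rcases ReflTransGen.cases_head h with h | ⟨c, ⟨i, hi, _⟩, _⟩
    · simpa using (congrArg Prod.snd h).symm
    · exact hi.elim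

theorem Definable.empty : Definable sem fun _ _ _ => False := by
  refine ⟨Bool, inferInstance, false, true, ∅, fun x t t' => ⟨fun h => h.elim, fun h => ?_⟩⟩
  rcases ReflTransGen.cases_head h with h | ⟨c, ⟨i, hi, _⟩, _⟩
  · simp at h
  · exact hi.elim

theorem Definable.iUnion {I : Type} [Finite I] {R : I → X → T → T → Prop}
    (h : ∀ i, Definable sem (R i)) : Definable sem fun x t t' => ∃ i, R i x t t' := by
  refine (Definable.graph {a : Bool × I × Bool | a.1 = false ∧ a.2.2 = true} R h
    false true).congr fun x t t' => ⟨fun ⟨i, hi⟩ => ?_, fun h => ?_⟩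
  · exact ReflTransGen.single ⟨i, ⟨rfl, rfl⟩, hi⟩
  · rcases ReflTransGen.cases_head h with h | ⟨c, ⟨i, hi, hr⟩, h'⟩
    · simp at h
    · rcases ReflTransGen.cases_head h' with h | ⟨c', ⟨j, hj, _⟩, _⟩
      · subst h; exact ⟨i, hr⟩
      · simp only [Set.mem_ofPred_eq] at hi hj
        simp [hi.2] at hj

theorem Definable.union {R R' : X → T → T → Prop} (h : Definable sem R)
    (h' : Definable sem R') : Definable sem fun x t t' => R x t t' ∨ R' x t t' := by
  refine (Definable.iUnion (I := Bool) (R := fun b => if b then R else R') ?_).congr ?_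
  · rintro (_ | _)
    · simpa using h'
    · simpa using h
  · simp [or_comm]

theorem Definable.comp {R R' : X → T → T → Prop} (h : Definable sem R)
    (h' : Definable sem R') : Definable sem fun x t t' => ∃ u, R x t u ∧ R' x u t' := by
  refine (Definable.graph {((0 : Fin 3), true, (1 : Fin 3)), (1, false, 2)}
    (fun b => if b then R else R') ?_ 0 2).congr fun x t t' => ⟨?_, fun h => ?_⟩
  · rintro (_ | _)
    · simpa using h'
    · simpa using h
  · rintro ⟨u, h1, h2⟩
    refine ReflTransGen.head (b := (1, u)) ⟨true, by simp, by simpa using h1⟩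
      (ReflTransGen.single ⟨false, by simp, by simpa using h2⟩)
  · have key : ∀ c, ReflTransGen (GraphStep {((0 : Fin 3), true, (1 : Fin 3)), (1, false, 2)}
        fun (b : Bool) => (if b then R else R') x) (0, t) c →
        (c.1 = 0 → c.2 = t) ∧ (c.1 = 1 → R x t c.2) ∧
          (c.1 = 2 → ∃ u, R x t u ∧ R' x u c.2) := by
      intro c hc
      induction hc with
      | refl => simp
      | @tail b c _ hs ih =>
        obtain ⟨n, u⟩ := b
        obtain ⟨n', u'⟩ := c
        obtain ⟨i, hi, hs⟩ := hs
        simp only [Set.mem_insert_iff, Set.mem_singleton_iff, Prod.mk.injEq] at hi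
        rcases hi with ⟨rfl, rfl, rfl⟩ | ⟨rfl, rfl, rfl⟩
        · simp_all
        · simp only [Bool.false_eq_true, if_false] at hs
          simp at ih
          simpa using ⟨u, ih, hs⟩
    exact (key _ h).2.2 rfl

theorem Definable.star {R : X → T → T → Prop} (h : Definable sem R) :
    Definable sem fun x => ReflTransGen (R x) := by
  refine (Definable.graph (Set.univ : Set (Unit × Unit × Unit)) (fun _ => R) (fun _ => h)
    () ()).congr fun x t t' => ⟨fun h => ?_, fun h => ?_⟩
  · exact ReflTransGen.lift (fun t => ((), t)) (fun a b hab => ⟨(), trivial, hab⟩) _ _ h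
  · exact ReflTransGen.lift (fun c : Unit × T => c.2) (fun a b ⟨_, _, hab⟩ => hab) _ _ h

theorem Definable.converse (inv : P → P)
    (hinv : ∀ p x t t', sem (inv p) x t t' ↔ sem p x t' t) {R : X → T → T → Prop}
    (h : Definable sem R) : Definable sem fun x t t' => R x t' t := by
  obtain ⟨Q, hQ, st, fi, E, hE⟩ := h
  refine ⟨Q, hQ, fi, st, {a | ∃ q p q', (q, p, q') ∈ E ∧ a = (q', p.map inv, q)},
    fun x t t' => (hE x t' t).trans ?_⟩
  rw [← reflTransGen_swap]
  have : (Function.swap (GraphStep E fun p => optSem sem p x)) = GraphStep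
      {a | ∃ q p q', (q, p, q') ∈ E ∧ a = (q', p.map inv, q)} fun p => optSem sem p x := by
    ext ⟨q, t⟩ ⟨q', t'⟩
    constructor
    · rintro ⟨p, hp, h⟩
      refine ⟨p.map inv, ⟨_, p, _, hp, rfl⟩, ?_⟩
      cases p with
      | none => exact Eq.symm h
      | some p => exact (hinv p x t t').2 h
    · rintro ⟨p', ⟨q1, p, q2, hp, he⟩, h⟩
      simp only [Prod.mk.injEq] at he
      obtain ⟨rfl, rfl, rfl⟩ := he
      refine ⟨p, hp, ?_⟩
      cases p with
      | none => exact Eq.symm h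
      | some p => exact (hinv p x t t').1 h
  rw [this]

/-- Relation composition along a list. -/
def seqRel {I : Type} (R : I → T → T → Prop) : List I → T → T → Prop
  | [], t, t' => t' = t
  | i :: l, t, t' => ∃ u, R i t u ∧ seqRel R l u t'

theorem Definable.seq {I : Type} {R : I → X → T → T → Prop} (h : ∀ i, Definable sem (R i))
    (l : List I) : Definable sem fun x => seqRel (fun i => R i x) l := by
  induction l with
  | nil => exact Definable.id
  | cons i l ih => exact (h i).comp ih

/-- Two relations simulate each other along `E`. -/
def Simulates {S T : Type} (E : S → T → Prop) (R : S → S → Prop) (R' : T → T → Prop) : Prop :=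
  ∀ s t, E s t → (∀ s', R s s' → ∃ t', R' t t' ∧ E s' t') ∧
    ∀ t', R' t t' → ∃ s', R s s' ∧ E s' t'

theorem Definable.transport {S P' : Type} {semS : P' → X → S → S → Prop}
    (E : X → S → T → Prop) {R : X → S → S → Prop} (h : Definable semS R) [Finite P']
    (hp : ∀ p, ∃ R', Definable sem R' ∧ ∀ x, Simulates (E x) (semS p x) (R' x)) :
    ∃ R', Definable sem R' ∧ ∀ x, Simulates (E x) (R x) (R' x) := by
  choose R' hR' hsim using hp
  obtain ⟨Q, hQ, st, fi, F, hF⟩ := h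
  let R'' : Option P' → X → T → T → Prop := fun p => p.elim (fun _ t t' => t' = t) R'
  have hsim' : ∀ p x, Simulates (E x) (optSem semS p x) (R'' p x) := by
    rintro (_ | p) x s t h
    · exact ⟨fun s' hs => ⟨t, rfl, by cases hs; exact h⟩, fun t' ht => ⟨s, rfl, by cases ht; exact h⟩⟩
    · exact hsim p x s t h
  refine ⟨_, Definable.graph F R'' ?_ st fi, fun x s t hst => ⟨fun s' h => ?_, fun t' h => ?_⟩⟩
  · rintro (_ | p)
    · exact Definable.id
    · exact hR' p
  · rw [hF] at h
    have key : ∀ c, ReflTransGen (GraphStep F fun p => optSem semS p x) (st, s) c →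
        ∃ t', ReflTransGen (GraphStep F fun i => R'' i x) (st, t) (c.1, t') ∧ E x c.2 t' := by
      intro c hc
      induction hc with
      | refl => exact ⟨t, ReflTransGen.refl, hst⟩
      | tail _ hs ih =>
        obtain ⟨u, hu, he⟩ := ih
        obtain ⟨p, hp, hs⟩ := hs
        obtain ⟨u', hu', he'⟩ := (hsim' p x _ _ he).1 _ hs
        exact ⟨u', hu.tail ⟨p, hp, hu'⟩, he'⟩
    exact key _ h
  · simp only [hF]
    have key : ∀ c, ReflTransGen (GraphStep F fun i => R'' i x) (st, t) c →
        ∃ s', ReflTransGen (GraphStep F fun p => optSem semS p x) (st, s) (c.1, s') ∧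
          E x s' c.2 := by
      intro c hc
      induction hc with
      | refl => exact ⟨s, ReflTransGen.refl, hst⟩
      | tail _ hs ih =>
        obtain ⟨u, hu, he⟩ := ih
        obtain ⟨p, hp, hs⟩ := hs
        obtain ⟨u', hu', he'⟩ := (hsim' p x _ _ he).2 _ hs
        exact ⟨u', hu.tail ⟨p, hp, hu'⟩, he'⟩
    exact key _ h

end Definable

end PrivAlt

namespace PrivAlt

/-! ### Programs on bounded counters -/

instance InSym.finite (α : Type) [Finite α] : Finite (InSym α) :=
  Finite.of_injective (β := Option (Option α))
    (fun | .leftEnd => none | .rightEnd => some none | .sym a => some (some a))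
    (by rintro (_ | _ | _) (_ | _ | _) <;> simp)

theorem inputSym_eq_leftEnd {α : Type} {x : List α} {p : ℕ} :
    inputSym x p = .leftEnd ↔ p = 0 := by
  cases p with
  | zero => simp [inputSym]
  | succ i => cases h : x[i]? <;> simp [inputSym, h]

theorem inputSym_eq_rightEnd {α : Type} {x : List α} {p : ℕ} :
    inputSym x p = .rightEnd ↔ x.length + 1 ≤ p := by
  cases p with
  | zero => simp [inputSym]
  | succ i =>
    by_cases hi : i < x.length
    · simp [inputSym, hi]
    · simp [inputSym, hi]; omega

/-- Assignment to a variable. -/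
noncomputable def upd {V : Type} (s : V → ℕ) (v : V) (m : ℕ) : V → ℕ :=
  open Classical in Function.update s v m

section Upd

variable {V : Type} (s : V → ℕ) (v : V) (m m' : ℕ)

@[simp] theorem upd_self : upd s v m v = m := by simp [upd]

variable {v} in
@[simp] theorem upd_of_ne {w : V} (h : w ≠ v) : upd s v m w = s w := by simp [upd, h]

@[simp] theorem upd_idem : upd (upd s v m) v m' = upd s v m' := by simp [upd]

@[simp] theorem upd_eq_self : upd s v (s v) = s := by simp [upd]

end Upd

/-- Operations on variables: increment, decrement, and a test of the input symbol at the position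
given by a variable. -/
inductive Op (α V : Type) : Type
  | inc (v : V)
  | dec (v : V)
  | test (v : V) (A : Set (InSym α))

namespace Op

variable {α V : Type}

instance [Finite α] [Finite V] : Finite (Op α V) :=
  Finite.of_injective (β := V ⊕ V ⊕ V × Set (InSym α))
    (fun | .inc v => .inl v | .dec v => .inr (.inl v) | .test v A => .inr (.inr (v, A)))
    (by rintro (_ | _ | _) (_ | _ | _) <;> simp)

/-- The variable `v` takes values below `b n v` on inputs of length `n`. Variables outside `H` may
only be tested for zero. -/
def sem (b : ℕ → V → ℕ) (H : Set V) : Op α V → List α → (V → ℕ) → (V → ℕ) → Prop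
  | inc v, x, s, s' => s v + 1 < b x.length v ∧ s' = upd s v (s v + 1)
  | dec v, x, s, s' => s' v + 1 < b x.length v ∧ s = upd s' v (s' v + 1)
  | test v A, x, s, s' => (v ∈ H ∨ A = {.leftEnd}) ∧ inputSym x (s v) ∈ A ∧ s' = s

def inverse : Op α V → Op α V
  | inc v => dec v
  | dec v => inc v
  | test v A => test v A

theorem sem_inverse (b : ℕ → V → ℕ) (H : Set V) (p : Op α V) (x : List α) (s s' : V → ℕ) :
    sem b H p.inverse x s s' ↔ sem b H p x s' s := by
  cases p with
  | inc v => rfl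
  | dec v => rfl
  | test v A =>
    constructor
    · rintro ⟨h, h', rfl⟩; exact ⟨h, h', rfl⟩
    · rintro ⟨h, h', rfl⟩; exact ⟨h, h', rfl⟩

end Op

section Programs

variable {α V : Type} {b : ℕ → V → ℕ} {H : Set V}

/-- Definability by counter operations. -/
abbrev CDef (b : ℕ → V → ℕ) (H : Set V) (R : List α → (V → ℕ) → (V → ℕ) → Prop) : Prop :=
  Definable (Op.sem (α := α) b H) R

theorem CDef.converse {R : List α → (V → ℕ) → (V → ℕ) → Prop} (h : CDef b H R) :
    CDef b H fun x s s' => R x s' s :=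
  Definable.converse Op.inverse (Op.sem_inverse b H) h

theorem cdef_zero (v : V) :
    CDef (α := α) b H fun _ s s' => s v = 0 ∧ s' = s :=
  (Definable.prim (Op.test v {.leftEnd})).congr fun x s s' => by
    simp [Op.sem, inputSym_eq_leftEnd]

theorem cdef_add (v : V) (m : ℕ) : CDef (α := α) b H fun x s s' =>
    (m = 0 ∨ s v + m < b x.length v) ∧ s' = upd s v (s v + m) := by
  induction m with
  | zero => exact Definable.id.congr fun x s s' => by simp
  | succ m ih =>
    refine (ih.comp (Definable.prim (Op.inc v))).congr fun x s s' => ?_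
    constructor
    · rintro ⟨h, rfl⟩
      refine ⟨_, ⟨Or.inr (by omega), rfl⟩, ?_, ?_⟩
      · simp; omega
      · simp [add_assoc]
    · rintro ⟨u, ⟨_, rfl⟩, h2, rfl⟩
      simp only [upd_self] at h2
      refine ⟨Or.inr (by omega), ?_⟩
      simp [add_assoc]

/-- Adding a multiple of `v` to `u` while emptying `v`. -/
theorem cdef_drain {u v : V} (huv : u ≠ v) {c : ℕ} (hc : 1 ≤ c) : CDef (α := α) b H fun x s s' =>
    (s v = 0 ∨ (s v < b x.length v ∧ s u + c * s v < b x.length u)) ∧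
      s' = upd (upd s v 0) u (s u + c * s v) := by
  refine ((((Definable.prim (Op.dec v)).comp (cdef_add u c)).star).comp (cdef_zero v)).congr
    fun x s s' => ?_
  constructor
  · rintro ⟨hb, rfl⟩
    refine ⟨_, ?_, ?_, rfl⟩
    · generalize hk : s v = k at hb
      induction k generalizing s with
      | zero =>
        have : upd (upd s v 0) u (s u + c * 0) = s := by
          rw [mul_zero, add_zero, ← hk]; simp
        rw [this]
      | succ k ih =>
        have hb' := hb.resolve_left (by omega)
        have hm : c * (k + 1) = c * k + c := by ring
        rw [hm] at hb' ⊢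
        let s1 := upd (upd s v k) u (s u + c)
        have h1 : s1 v = k := by simp [s1, huv.symm]
        have h2 : s1 u = s u + c := by simp [s1]
        refine ReflTransGen.head (b := s1) ⟨upd s v k, ⟨?_, ?_⟩, ?_, ?_⟩ ?_
        · simp; omega
        · simp [← hk]
        · right; simp [huv]; nlinarith
        · simp [s1, huv]
        · have := ih s1 h1 (Or.inr ⟨by omega, by rw [h2]; omega⟩)
          convert this using 1
          rw [h2]
          simp only [s1]
          ext w
          by_cases hw : w = u
          · subst hw; simp; ring
          · by_cases hw' : w = v
            · subst hw'; simp [hw]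
            · simp [hw, hw']
    · simp [huv.symm]
  · rintro ⟨s1, hs, hz, rfl⟩
    induction hs using ReflTransGen.head_induction_on with
    | refl =>
      refine ⟨Or.inl hz, ?_⟩
      rw [hz, mul_zero, add_zero, ← hz]; simp
    | head hs _ ih =>
      rename_i s s2
      obtain ⟨m, ⟨hm, rfl⟩, hb, rfl⟩ := hs
      obtain ⟨hb', he⟩ := ih
      simp only [upd_self, upd_of_ne _ _ huv, upd_of_ne _ _ huv.symm]
        at hb' he ⊢
      refine ⟨Or.inr ⟨by omega, ?_⟩, ?_⟩
      · rcases hb' with hb' | hb'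
        · rw [hb']
          have := hb.resolve_left (by omega)
          simpa using this
        · nlinarith
      · rw [he]
        ext w
        by_cases hw : w = u
        · subst hw; simp; ring
        · by_cases hw' : w = v
          · subst hw'; simp [hw]
          · simp [hw, hw']

/-- Pushing a digit in base `G`, with the help of an auxiliary variable. -/
def pushRel (b : ℕ → V → ℕ) (u : V) (G : ℕ) (v : V) (d : ℕ) (x : List α) (s s' : V → ℕ) : Prop :=
  s u = 0 ∧ G * s v + d < b x.length v ∧ s' = upd s v (G * s v + d)

theorem cdef_push {u v : V} (huv : u ≠ v) {G : ℕ} (hG : 1 ≤ G) (d : ℕ)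
    (hb : ∀ n, b n u = b n v) (hpos : ∀ n, 0 < b n v) :
    CDef (α := α) b H (pushRel b u G v d) := by
  refine ((cdef_zero u).comp ((cdef_drain huv le_rfl).comp
    ((cdef_drain huv.symm hG).comp (cdef_add v d)))).congr fun x s s' => ?_
  have hb := hb x.length
  have hpos := hpos x.length
  constructor
  · rintro ⟨hu, hlt, rfl⟩
    refine ⟨s, ⟨hu, rfl⟩, _, ⟨?_, rfl⟩, _, ⟨?_, rfl⟩, ?_, ?_⟩
    · right; rw [hu, hb]; constructor <;> nlinarith
    · simp only [upd_self, upd_of_ne _ _ huv.symm, hu]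
      right; rw [hb]; constructor
      · nlinarith
      · simp; omega
    · simp [huv.symm, hu]; omega
    · ext w
      by_cases hw : w = u
      · subst hw; simp [hu, huv]
      · by_cases hw' : w = v
        · subst hw'; simp [hu, hw]
        · simp [hw, hw']
  · rintro ⟨s0, ⟨hu, hs0⟩, s1, ⟨h1, rfl⟩, s2, ⟨h2, rfl⟩, h3, rfl⟩
    subst hs0
    simp only [upd_self, upd_of_ne _ _ huv.symm, hu]
      at h1 h2 h3 ⊢
    simp only [zero_add, one_mul] at *
    refine ⟨hu, ?_, ?_⟩
    · rcases h3 with rfl | h3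
      · rcases h2 with h2 | h2
        · simp [h2, hpos]
        · simpa using h2.2
      · exact h3
    · ext w
      by_cases hw : w = u
      · subst hw; simp [hu, huv]
      · by_cases hw' : w = v
        · subst hw'; simp
        · simp [hw, hw']

end Programs

/-! ### Counters of polynomial size as tuples of digits -/

section Digits

variable {α V : Type}

/-- The number with the digits stored in the listed variables, least significant first. -/
def digitVal (B : ℕ) : List V → (V → ℕ) → ℕ
  | [], _ => 0
  | v :: l, t => t v + B * digitVal B l t

theorem digitVal_congr {B : ℕ} {l : List V} {t t' : V → ℕ} (h : ∀ v ∈ l, t v = t' v) :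
    digitVal B l t = digitVal B l t' := by
  induction l with
  | nil => rfl
  | cons v l ih =>
    simp only [digitVal]
    rw [h v (by simp), ih fun w hw => h w (by simp [hw])]

theorem digitVal_lt {B : ℕ} {l : List V} {t : V → ℕ} (h : ∀ v ∈ l, t v < B) :
    digitVal B l t < B ^ l.length := by
  induction l with
  | nil => simp [digitVal]
  | cons v l ih =>
    have h1 := h v (by simp)
    have h2 := ih fun w hw => h w (by simp [hw])
    simp only [digitVal, List.length_cons, pow_succ]
    nlinarith

theorem digitVal_eq_zero {B : ℕ} (hB : 0 < B) {l : List V} {t : V → ℕ} :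
    digitVal B l t = 0 ↔ ∀ v ∈ l, t v = 0 := by
  induction l with
  | nil => simp [digitVal]
  | cons v l ih =>
    simp only [digitVal, Nat.add_eq_zero_iff, mul_eq_zero, ih, List.mem_cons, forall_eq_or_imp]
    simp [hB.ne']

/-- Increment with carry; `B - 1` is the largest digit. -/
def incDigits (B : ℕ) : List V → (V → ℕ) → (V → ℕ) → Prop
  | [], _, _ => False
  | v :: l, t, t' => (t v + 1 < B ∧ t' = upd t v (t v + 1)) ∨
      (t v + 1 = B ∧ incDigits B l (upd t v 0) t')

theorem cdef_reset (v : V) : CDef (α := α) (fun n (_ : V) => n + 2) Set.univ fun x t t' =>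
    t v + 1 = x.length + 2 ∧ t' = upd t v 0 := by
  refine ((Definable.prim (Op.test v {.rightEnd})).comp
    (((Definable.prim (Op.dec v)).star).comp (cdef_zero v))).congr fun x t t' => ?_
  constructor
  · rintro ⟨h, rfl⟩
    refine ⟨t, ⟨by simp, by simp [inputSym_eq_rightEnd]; omega, rfl⟩, _, ?_, by simp, rfl⟩
    have hlt : t v < x.length + 2 := by omega
    clear h
    generalize hk : t v = k at hlt
    induction k generalizing t with
    | zero => rw [← hk, upd_eq_self]
    | succ k ih =>
      refine ReflTransGen.head (b := upd t v k) ⟨by simpa using hlt, by simp [← hk]⟩ ?_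
      simpa using ih (upd t v k) (by simp) (by omega)
  · rintro ⟨t0, ⟨_, h, ht0⟩, u, hs, hz, hu⟩
    subst ht0 hu
    simp only [Set.mem_singleton_iff, inputSym_eq_rightEnd] at h
    have key : (t0 v = 0 ∨ t0 v < x.length + 2) ∧ t' = upd t0 v 0 := by
      clear h
      induction hs using ReflTransGen.head_induction_on with
      | refl => exact ⟨Or.inl hz, by rw [← hz, upd_eq_self]⟩
      | head hs _ ih =>
        obtain ⟨h1, rfl⟩ := hs
        simpa [h1] using ih.2
    exact ⟨by omega, key.2⟩

theorem cdef_incDigits (l : List V) : CDef (α := α) (fun n (_ : V) => n + 2) Set.univ fun x =>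
    incDigits (x.length + 2) l := by
  induction l with
  | nil => exact Definable.empty
  | cons v l ih =>
    refine ((Definable.prim (Op.inc v)).union ((cdef_reset v).comp ih)).congr fun x t t' => ?_
    simp only [incDigits, Op.sem]
    refine or_congr Iff.rfl ⟨?_, ?_⟩
    · rintro ⟨h, h'⟩; exact ⟨_, ⟨h, rfl⟩, h'⟩
    · rintro ⟨_, ⟨h, rfl⟩, h'⟩; exact ⟨h, h'⟩

theorem incDigits_sound {B : ℕ} {l : List V} (hl : l.Nodup) {t t' : V → ℕ}
    (h : incDigits B l t t') : digitVal B l t' = digitVal B l t + 1 ∧ (∀ v ∉ l, t' v = t v) ∧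
      ((∀ v, t v < B) ↔ ∀ v, t' v < B) := by
  induction l generalizing t with
  | nil => exact h.elim
  | cons v l ih =>
    rw [List.nodup_cons] at hl
    rcases h with ⟨h, rfl⟩ | ⟨h, h'⟩
    · refine ⟨?_, ?_, ?_⟩
      · have : digitVal B l (upd t v (t v + 1)) = digitVal B l t :=
          digitVal_congr fun w hw => by
            rw [upd_of_ne]; rintro rfl; exact hl.1 hw
        simp [digitVal, this]; ring
      · intro w hw
        simp only [List.mem_cons, not_or] at hw
        simp [hw.1]
      · constructor <;> intro H w <;> have := H w <;> by_cases hw : w = v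
        · subst hw; simpa using h
        · simpa [hw] using this
        · subst hw; omega
        · simpa [hw] using this
    · obtain ⟨h1, h2, h3⟩ := ih hl.2 h'
      have hv : t' v = 0 := by simp [h2 v hl.1]
      refine ⟨?_, ?_, ?_⟩
      · have : digitVal B l (upd t v 0) = digitVal B l t :=
          digitVal_congr fun w hw => by
            rw [upd_of_ne]; rintro rfl; exact hl.1 hw
        rw [this] at h1
        simp only [digitVal, h1, hv]
        rw [← h]; ring_nf
      · intro w hw
        simp only [List.mem_cons, not_or] at hw
        simp [h2 w hw.2, hw.1]
      · rw [← h3]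
        constructor <;> intro H w <;> have := H w <;> by_cases hw : w = v
        · subst hw; simp; omega
        · simpa [hw] using this
        · subst hw; omega
        · simpa [hw] using this

theorem exists_incDigits {B : ℕ} {l : List V} (hl : l.Nodup) {t : V → ℕ} (ht : ∀ v, t v < B)
    (h : digitVal B l t + 1 < B ^ l.length) : ∃ t', incDigits B l t t' := by
  induction l generalizing t with
  | nil => simp [digitVal] at h
  | cons v l ih =>
    rw [List.nodup_cons] at hl
    by_cases hv : t v + 1 < B
    · exact ⟨_, Or.inl ⟨hv, rfl⟩⟩
    · have hv' : t v + 1 = B := by have := ht v; omega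
      have hval : digitVal B l (upd t v 0) = digitVal B l t :=
          digitVal_congr fun w hw => by
            rw [upd_of_ne]; rintro rfl; exact hl.1 hw
      obtain ⟨t', ht'⟩ := ih (t := upd t v 0) hl.2
        (fun w => by by_cases hw : w = v
                     · subst hw; simp; omega
                     · simpa [hw] using ht w)
        (by rw [hval]
            simp only [digitVal, List.length_cons, pow_succ] at h
            by_contra hc
            have : B ^ l.length * B ≤ (digitVal B l t + 1) * B := by
              apply Nat.mul_le_mul_right; omega
            nlinarith)
      exact ⟨t', Or.inr ⟨hv', ht'⟩⟩

theorem exists_incDigits_eq {B : ℕ} {l : List V} (hl : l.Nodup) {t : V → ℕ} (ht : ∀ v, t v < B)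
    (h : 0 < digitVal B l t) : ∃ t', incDigits B l t' t := by
  induction l generalizing t with
  | nil => simp [digitVal] at h
  | cons v l ih =>
    rw [List.nodup_cons] at hl
    by_cases hv : t v = 0
    · have h' : 0 < digitVal B l t := by
        simp only [digitVal, hv, zero_add] at h
        exact Nat.pos_of_mul_pos_left h
      obtain ⟨t', ht'⟩ := ih hl.2 ht h'
      have hs := incDigits_sound hl.2 ht'
      have hB := ht v
      refine ⟨upd t' v (B - 1), Or.inr ⟨by simp; omega, ?_⟩⟩
      have : upd (upd t' v (B - 1)) v 0 = t' := by
        rw [upd_idem, ← hv, hs.2.1 v hl.1, upd_eq_self]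
      rwa [this]
    · refine ⟨upd t v (t v - 1), Or.inl ⟨?_, ?_⟩⟩
      · have := ht v; simp; omega
      · simp [Nat.sub_add_cancel (Nat.one_le_iff_ne_zero.2 hv)]

end Digits

end PrivAlt

namespace PrivAlt

instance : Finite Dir :=
  Finite.of_injective (β := Fin 3) (fun | .left => 0 | .stay => 1 | .right => 2)
    (by rintro (_ | _ | _) (_ | _ | _) <;> simp)

/-- Languages decided by counter programs whose variables range over the positions of the input
tape. -/
def CounterNL (α : Type) : Set (Language α) :=
  {L | ∃ (V : Type) (_ : Finite V) (R : List α → (V → ℕ) → (V → ℕ) → Prop),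
    CDef (fun n _ => n + 2) Set.univ R ∧ ∀ x, x ∈ L ↔ ∃ t, R x (fun _ => 0) t}

/-! ### Reduction of polynomially bounded counters to linearly bounded ones -/

section Poly

variable {α H C : Type} {k : ℕ}

/-- Heads are bounded by the length of the input tape, counters by a power of it. -/
def polyBound (H C : Type) (k : ℕ) (n : ℕ) : H ⊕ C → ℕ
  | .inl _ => n + 2
  | .inr _ => (n + 2) ^ k

/-- The variables holding the digits of a counter. -/
def digitVars (H : Type) {C : Type} (k : ℕ) (c : C) : List (H ⊕ C × Fin k) :=
  (List.finRange k).map fun j => .inr (c, j)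

theorem nodup_digitVars (c : C) : (digitVars H k c).Nodup :=
  (List.nodup_finRange k).map fun i j h => by simpa using h

theorem length_digitVars (c : C) : (digitVars H k c).length = k := by simp [digitVars]

theorem inl_notMem_digitVars (c : C) (h : H) : (.inl h) ∉ digitVars H k c := by simp [digitVars]

theorem notMem_digitVars_of_ne {c c' : C} (h : c' ≠ c) {v : H ⊕ C × Fin k}
    (hv : v ∈ digitVars H k c') : v ∉ digitVars H k c := by
  simp only [digitVars, List.mem_map, List.mem_finRange, true_and] at hv ⊢
  rintro ⟨j, rfl⟩
  obtain ⟨i, hi⟩ := hv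
  simp only [Sum.inr.injEq, Prod.mk.injEq] at hi
  exact h hi.1

/-- Representation of a store by the digits of its counters. -/
def DigitEnc (k : ℕ) (x : List α) (s : H ⊕ C → ℕ) (t : H ⊕ C × Fin k → ℕ) : Prop :=
  (∀ v, t v < x.length + 2) ∧ (∀ h, s (.inl h) = t (.inl h)) ∧
    ∀ c, s (.inr c) = digitVal (x.length + 2) (digitVars H k c) t

theorem DigitEnc.incDigits {x : List α} {s : H ⊕ C → ℕ} {t t' : H ⊕ C × Fin k → ℕ}
    (h : DigitEnc k x s t) {c : C}
    (hi : incDigits (x.length + 2) (digitVars H k c) t t') :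
    s (.inr c) + 1 < (x.length + 2) ^ k ∧
      DigitEnc k x (upd s (.inr c) (s (.inr c) + 1)) t' := by
  obtain ⟨h1, h2, h3⟩ := incDigits_sound (nodup_digitVars c) hi
  have hb := h3.1 h.1
  refine ⟨?_, hb, fun i => ?_, fun c' => ?_⟩
  · rw [h.2.2 c, ← h1]
    simpa [length_digitVars] using digitVal_lt (l := digitVars H k c) fun v _ => hb v
  · simp [h2 _ (inl_notMem_digitVars c i), h.2.1]
  · by_cases hc : c' = c
    · subst hc; simp [h1, h.2.2]
    · rw [upd_of_ne _ _ (by simpa using hc), h.2.2 c']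
      exact digitVal_congr fun v hv => (h2 v (notMem_digitVars_of_ne hc hv)).symm

theorem DigitEnc.incDigits_symm {x : List α} {s : H ⊕ C → ℕ} {t t' : H ⊕ C × Fin k → ℕ}
    (h : DigitEnc k x s t) {c : C}
    (hi : PrivAlt.incDigits (x.length + 2) (digitVars H k c) t' t) :
    0 < s (.inr c) ∧ s (.inr c) < (x.length + 2) ^ k ∧
      DigitEnc k x (upd s (.inr c) (s (.inr c) - 1)) t' := by
  obtain ⟨h1, h2, h3⟩ := incDigits_sound (nodup_digitVars c) hi
  have hb := h3.2 h.1
  have hc := h.2.2 c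
  refine ⟨by omega, ?_, hb, fun i => ?_, fun c' => ?_⟩
  · rw [hc]
    simpa [length_digitVars] using digitVal_lt (l := digitVars H k c) fun v _ => h.1 v
  · simp [← h2 _ (inl_notMem_digitVars c i), h.2.1]
  · by_cases hc : c' = c
    · subst hc; simp [h1, h.2.2]
    · rw [upd_of_ne _ _ (by simpa using hc), h.2.2 c']
      exact digitVal_congr fun v hv => (h2 v (notMem_digitVars_of_ne hc hv))

theorem DigitEnc.update_inl {x : List α} {s : H ⊕ C → ℕ} {t : H ⊕ C × Fin k → ℕ}
    (h : DigitEnc k x s t) (i : H) {m : ℕ}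
    (hm : m < x.length + 2) :
    DigitEnc k x (upd s (.inl i) m) (upd t (.inl i) m) := by
  refine ⟨fun v => ?_, fun j => ?_, fun c => ?_⟩
  · by_cases hv : v = .inl i
    · subst hv; simpa using hm
    · simpa [hv] using h.1 v
  · by_cases hj : j = i
    · subst hj; simp
    · simp [hj, h.2.1]
  · rw [upd_of_ne _ _ (by simp), h.2.2]
    refine digitVal_congr fun v hv => ?_
    rw [upd_of_ne]
    rintro rfl
    exact inl_notMem_digitVars c i hv

theorem cdef_all_zero {V : Type} {b : ℕ → V → ℕ} {T : Set V} (l : List V) :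
    CDef (α := α) b T fun _ t t' => (∀ v ∈ l, t v = 0) ∧ t' = t := by
  refine (Definable.seq (fun v => cdef_zero (b := b) v) l).congr fun x t t' => ?_
  induction l with
  | nil => simp [seqRel]
  | cons v l ih =>
    simp only [seqRel]
    constructor
    · rintro ⟨h, rfl⟩
      exact ⟨t', ⟨h v (by simp), rfl⟩, ih.1 ⟨fun w hw => h w (by simp [hw]), rfl⟩⟩
    · rintro ⟨u, ⟨h, rfl⟩, h'⟩
      obtain ⟨h', rfl⟩ := ih.2 h'
      exact ⟨by simpa [h] using h', rfl⟩

theorem exists_digit_simulation (p : Op α (H ⊕ C)) :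
    ∃ R', CDef (fun n (_ : H ⊕ C × Fin k) => n + 2) Set.univ R' ∧
      ∀ x, Simulates (DigitEnc k x) (Op.sem (polyBound H C k) (Set.range Sum.inl) p x)
        (R' x) := by
  rcases p with (i | c) | (i | c) | ⟨i | c, A⟩
  · refine ⟨_, Definable.prim (Op.inc (.inl i)), fun x s t h => ⟨?_, ?_⟩⟩
    · rintro s' ⟨hb, rfl⟩
      have := h.2.1 i
      exact ⟨_, ⟨by simpa [polyBound, this] using hb, rfl⟩, by
        simpa [this] using h.update_inl i (m := s (.inl i) + 1) hb⟩
    · rintro t' ⟨hb, rfl⟩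
      have := h.2.1 i
      exact ⟨_, ⟨by simpa [polyBound, this] using hb, rfl⟩, by
        simpa [this] using h.update_inl i hb⟩
  · refine ⟨_, cdef_incDigits (digitVars H k c), fun x s t h => ⟨?_, ?_⟩⟩
    · rintro s' ⟨hb, rfl⟩
      obtain ⟨t', ht'⟩ := exists_incDigits (nodup_digitVars c) h.1 (by
        rw [← h.2.2, length_digitVars]; exact hb)
      exact ⟨t', ht', (h.incDigits ht').2⟩
    · intro t' ht'
      exact ⟨_, ⟨(h.incDigits ht').1, rfl⟩, (h.incDigits ht').2⟩
  · refine ⟨_, Definable.prim (Op.dec (.inl i)), fun x s t h => ⟨?_, ?_⟩⟩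
    · rintro s' ⟨hb, rfl⟩
      have := h.2.1 i
      simp only [upd_self] at this
      refine ⟨upd t (.inl i) (s' (.inl i)), ⟨by simpa [polyBound] using hb,
        by simp [this]⟩, ?_⟩
      have hb : s' (.inl i) + 1 < x.length + 2 := hb
      simpa using h.update_inl i (m := s' (.inl i)) (by omega)
    · rintro t' ⟨hb, rfl⟩
      have := h.2.1 i
      simp only [upd_self] at this
      refine ⟨upd s (.inl i) (t' (.inl i)), ⟨by simpa [polyBound] using hb,
        by simp [← this]⟩, ?_⟩
      simpa using h.update_inl i (m := t' (.inl i)) (by simp only at hb; omega)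
  · refine ⟨_, (cdef_incDigits (digitVars H k c)).converse, fun x s t h => ⟨?_, ?_⟩⟩
    · rintro s' ⟨hb, rfl⟩
      obtain ⟨t', ht'⟩ := exists_incDigits_eq (nodup_digitVars c) h.1 (by
        rw [← h.2.2]; simp)
      refine ⟨t', ht', ?_⟩
      have := (h.incDigits_symm ht').2.2
      simpa using this
    · intro t' ht'
      obtain ⟨h1, h2, h3⟩ := h.incDigits_symm ht'
      refine ⟨_, ⟨?_, ?_⟩, h3⟩
      · simp [polyBound]; omega
      · simp [Nat.sub_add_cancel h1]
  · refine ⟨_, Definable.prim (Op.test (.inl i) A), fun x s t h => ⟨?_, ?_⟩⟩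
    · rintro s' ⟨-, hb, rfl⟩
      exact ⟨t, ⟨by simp, by rwa [← h.2.1], rfl⟩, h⟩
    · rintro t' ⟨-, hb, rfl⟩
      exact ⟨s, ⟨by simp, by rwa [h.2.1], rfl⟩, h⟩
  · by_cases hA : A = {.leftEnd}
    · subst hA
      refine ⟨_, cdef_all_zero (digitVars H k c), fun x s t h => ⟨?_, ?_⟩⟩
      · rintro s' ⟨-, hb, rfl⟩
        refine ⟨t, ⟨?_, rfl⟩, h⟩
        rwa [← digitVal_eq_zero (B := x.length + 2) (by simp), ← h.2.2, ← inputSym_eq_leftEnd (x := x)]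
      · rintro t' ⟨hz, rfl⟩
        refine ⟨s, ⟨Or.inr rfl, ?_, rfl⟩, h⟩
        rwa [← digitVal_eq_zero (B := x.length + 2) (by simp), ← h.2.2, ← inputSym_eq_leftEnd (x := x)] at hz
    · refine ⟨_, Definable.empty, fun x s t h => ⟨?_, fun _ => False.elim⟩⟩
      rintro s' ⟨h1, -⟩
      simp [hA] at h1

theorem counterNL_of_poly [Finite α] [Finite H] [Finite C] {L : Language α}
    {R : List α → (H ⊕ C → ℕ) → (H ⊕ C → ℕ) → Prop}
    (hR : CDef (polyBound H C k) (Set.range Sum.inl) R)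
    (hL : ∀ x, x ∈ L ↔ ∃ s, R x (fun _ => 0) s) : L ∈ CounterNL α := by
  obtain ⟨R', hR', hsim⟩ := Definable.transport (DigitEnc (H := H) (C := C) k) hR
    (exists_digit_simulation (k := k))
  refine ⟨_, inferInstance, R', hR', fun x => (hL x).trans ?_⟩
  have h0 : DigitEnc (H := H) (C := C) k x (fun _ => 0) (fun _ => 0) := by
    refine ⟨by simp, by simp, fun c => ?_⟩
    rw [eq_comm, digitVal_eq_zero (by simp)]
    simp
  constructor
  · rintro ⟨s, hs⟩
    obtain ⟨t, ht, -⟩ := (hsim x _ _ h0).1 s hs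
    exact ⟨t, ht⟩
  · rintro ⟨t, ht⟩
    obtain ⟨s, hs, -⟩ := (hsim x _ _ h0).2 t ht
    exact ⟨s, hs⟩

end Poly

end PrivAlt

namespace PrivAlt

/-! ### Machines with several input heads -/

/-- A nondeterministic machine with several two-way input heads and several work tapes. It can
detect whether a work tape head scans cell `0`. -/
structure MTM (α : Type) where
  State : Type
  Sym : Type
  Head : Type
  Tape : Type
  [finState : Finite State]
  [finSym : Finite Sym]
  [finHead : Finite Head]
  [finTape : Finite Tape]
  blank : Sym
  start : State
  accept : State
  next : State → (Head → InSym α) → (Tape → Sym × Bool) →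
    Set (State × (Head → Dir) × (Tape → Sym × Dir))

namespace MTM

attribute [instance] finState finSym finHead finTape

variable {α : Type} (M : MTM α)

structure Cfg where
  state : M.State
  heads : M.Head → ℕ
  tapes : M.Tape → WorkTape M.Sym

def startCfg : M.Cfg := ⟨M.start, fun _ => 0, fun _ => WorkTape.empty M.blank⟩

def Step (x : List α) (c c' : M.Cfg) : Prop :=
  ∃ a ∈ M.next c.state (fun h => inputSym x (c.heads h))
      (fun t => ((c.tapes t).read, decide ((c.tapes t).head = 0))),
    c' = ⟨a.1, fun h => (a.2.1 h).moveInput x.length (c.heads h),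
      fun t => (c.tapes t).act (a.2.2 t)⟩

def Reachable (x : List α) (c : M.Cfg) : Prop := ReflTransGen (M.Step x) M.startCfg c

def Accepts (x : List α) : Prop := ∃ c, M.Reachable x c ∧ c.state = M.accept

def SpaceBounded (s : ℕ → ℕ) : Prop :=
  ∀ x c, M.Reachable x c → ∀ t, (c.tapes t).Within (s x.length)

end MTM

/-- Languages of machines with several input heads and logarithmic space. -/
def MNL (α : Type) : Set (Language α) :=
  {L | ∃ s, IsLogBound s ∧ ∃ M : MTM α, M.SpaceBounded s ∧ ∀ x, x ∈ L ↔ M.Accepts x}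

/-! ### Work tapes as pairs of numbers -/

section TapeCode

variable {A : Type} (G : ℕ) (code : A → ℕ)

/-- The cells to the left of position `h` as a number; all digits are positive. -/
def leftCode (cells : ℕ → A) : ℕ → ℕ
  | 0 => 0
  | h + 1 => G * leftCode cells h + (code (cells h) + 1)

/-- The number `r` codes the cells from position `h` on. -/
def RightCode (cells : ℕ → A) (h r : ℕ) : Prop := ∀ i, r / G ^ i % G = code (cells (h + i))

variable {G code}

theorem leftCode_congr {c c' : ℕ → A} {h : ℕ} (H : ∀ i < h, c i = c' i) :
    leftCode G code c h = leftCode G code c' h := by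
  induction h with
  | zero => rfl
  | succ h ih => simp only [leftCode]; rw [ih fun i hi => H i (by omega), H h (by omega)]

theorem leftCode_lt (hG : ∀ a, code a + 1 < G) (c : ℕ → A) (h : ℕ) :
    leftCode G code c h < G ^ h := by
  induction h with
  | zero => simp [leftCode]
  | succ h ih =>
    have := hG (c h)
    simp only [leftCode, pow_succ]
    nlinarith

theorem RightCode.congr {c c' : ℕ → A} {h r : ℕ} (hr : RightCode G code c h r)
    (H : ∀ i, h ≤ i → c i = c' i) : RightCode G code c' h r := fun i => by
  rw [hr i, H _ (by omega)]

theorem rightCode_iff (hG : ∀ a, code a + 1 < G) {c : ℕ → A} {h r : ℕ} :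
    RightCode G code c h r ↔ ∃ r', r = G * r' + code (c h) ∧ RightCode G code c (h + 1) r' := by
  have h0 := hG (c h)
  constructor
  · intro H
    refine ⟨r / G, ?_, fun i => ?_⟩
    · have := H 0
      simp only [pow_zero, Nat.div_one, add_zero] at this
      rw [← this, Nat.div_add_mod]
    · have := H (i + 1)
      rw [pow_succ', ← Nat.div_div_eq_div_mul] at this
      rw [this, show h + (i + 1) = h + 1 + i by omega]
  · rintro ⟨r', rfl, H⟩ i
    cases i with
    | zero => simp [Nat.mod_eq_of_lt (show code (c h) < G by omega)]
    | succ i =>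
      rw [pow_succ', ← Nat.div_div_eq_div_mul, Nat.mul_add_div (by omega),
        Nat.div_eq_of_lt (show code (c h) < G by omega), add_zero, H i,
        show h + (i + 1) = h + 1 + i by omega]

theorem RightCode.lt (hG : ∀ a, code a + 1 < G) {c : ℕ → A} {h r m : ℕ}
    (hr : RightCode G code c h r) (H : ∀ i, m ≤ i → code (c i) = 0) : r < G ^ m := by
  have hG1 : 1 < G := by have := hG (c 0); omega
  by_contra hlt
  push Not at hlt
  have hr0 : r ≠ 0 := by
    rintro rfl
    have := Nat.pow_pos (n := m) (show 0 < G by omega)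
    omega
  have h1 : m ≤ Nat.log G r := Nat.le_log_of_pow_le hG1 hlt
  have h2 := hr (Nat.log G r)
  rw [H _ (by omega)] at h2
  have h3 : r / G ^ Nat.log G r < G := by
    rw [Nat.div_lt_iff_lt_mul (Nat.pow_pos (by omega)), ← pow_succ']
    exact Nat.lt_pow_succ_log_self hG1 r
  rw [Nat.mod_eq_of_lt h3] at h2
  have h4 : 0 < r / G ^ Nat.log G r :=
    Nat.div_pos (Nat.pow_log_le_self G hr0) (Nat.pow_pos (by omega))
  omega

theorem leftCode_eq_zero {c : ℕ → A} {h : ℕ} : leftCode G code c h = 0 ↔ h = 0 := by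
  cases h <;> simp [leftCode]

end TapeCode

/-! ### Programs for tape operations -/

section TapeProgram

variable {α V A : Type} {b : ℕ → V → ℕ} {H : Set V}

theorem cdef_pos (v : V) : CDef (α := α) b H fun x s s' =>
    (0 < s v ∧ s v < b x.length v) ∧ s' = s := by
  refine ((Definable.prim (Op.dec v)).comp (Definable.prim (Op.inc v))).congr fun x s s' => ?_
  constructor
  · rintro ⟨⟨h1, h2⟩, rfl⟩
    refine ⟨upd s' v (s' v - 1), ⟨?_, ?_⟩, ?_, ?_⟩
    · simp; omega
    · simp [Nat.sub_add_cancel h1]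
    · simp; omega
    · simp [Nat.sub_add_cancel h1]
  · rintro ⟨m, ⟨h1, rfl⟩, h2, rfl⟩
    exact ⟨⟨by simp, by simpa using h1⟩, rfl⟩

/-- Writing and moving on a tape coded by `l` and `r` after the scanned symbol has been removed. -/
def tapeMove (b : ℕ → V → ℕ) (u l r : V) (G : ℕ) (code : A → ℕ) (a : A) (x : List α)
    (s s' : V → ℕ) : Dir → Bool → Prop
  | .right, _ => pushRel b u G l (code a + 1) x s s'
  | .stay, _ => pushRel b u G r (code a) x s s'
  | .left, true => pushRel b u G r (code a) x s s'
  | .left, false => ∃ s₂, pushRel b u G r (code a) x s s₂ ∧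
      ∃ a' : A, ∃ s₃, pushRel b u G l (code a' + 1) x s₃ s₂ ∧ pushRel b u G r (code a') x s₃ s'

/-- One step on a tape coded by the variables `l` (left of the head) and `r` (from the head on):
the symbol `a` is read, `z` tells whether the head is at cell `0`, and the action is `w`. -/
def tapeRel (b : ℕ → V → ℕ) (u l r : V) (G : ℕ) (code : A → ℕ) (a : A) (z : Bool) (w : A × Dir)
    (x : List α) (s s' : V → ℕ) : Prop :=
  (if z then s l = 0 else 0 < s l ∧ s l < b x.length l) ∧
  ∃ s₁, pushRel b u G r (code a) x s₁ s ∧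
    tapeMove b u l r G code w.1 x s₁ s' w.2 z

theorem cdef_tapeRel [Finite A] {u l r : V} (hul : u ≠ l) (hur : u ≠ r) {G : ℕ} (hG : 1 ≤ G)
    {code : A → ℕ} (hl : ∀ n, b n u = b n l) (hr : ∀ n, b n u = b n r) (hpos : ∀ n, 0 < b n u)
    (a : A) (z : Bool) (w : A × Dir) :
    CDef (α := α) b H (tapeRel b u l r G code a z w) := by
  have pl := fun d => cdef_push (α := α) (H := H) hul hG d hl fun n => hl n ▸ hpos n
  have pr := fun d => cdef_push (α := α) (H := H) hur hG d hr fun n => hr n ▸ hpos n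
  have hz : CDef (α := α) b H fun x s s' =>
      (if z then s l = 0 else 0 < s l ∧ s l < b x.length l) ∧ s' = s := by
    cases z
    · simpa using cdef_pos l
    · simpa using cdef_zero l
  have main : CDef (α := α) b H fun x s₁ s' =>
      tapeMove b u l r G code w.1 x s₁ s' w.2 z := by
    obtain ⟨w1, d⟩ := w
    cases d
    · cases z
      · exact (pr _).comp (Definable.iUnion fun a' => (CDef.converse (pl _)).comp (pr _))
      · exact pr _
    · cases z <;> exact pr _
    · cases z <;> exact pl _
  refine (hz.comp ((CDef.converse (pr (code a))).comp main)).congr fun x s s' => ?_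
  constructor
  · rintro ⟨h1, h2⟩
    exact ⟨s, ⟨h1, rfl⟩, h2⟩
  · rintro ⟨s0, ⟨h1, h0⟩, h2⟩
    subst h0
    exact ⟨h1, h2⟩

/-- A tape is coded by two numbers. -/
def TapeEnc (G : ℕ) (code : A → ℕ) (T : WorkTape A) (l r : ℕ) : Prop :=
  l = leftCode G code T.cells T.head ∧ RightCode G code T.cells T.head r

variable {G : ℕ} {code : A → ℕ} {u l r : V} {x : List α} {s s' : V → ℕ} {T : WorkTape A}
  {a : A} {z : Bool} {w : A × Dir}

theorem tapeRel_frame (h : tapeRel b u l r G code a z w x s s') :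
    ∀ v, v ≠ l → v ≠ r → s' v = s v := by
  obtain ⟨-, s₁, ⟨-, -, rfl⟩, h⟩ := h
  intro v hl hr
  obtain ⟨w1, d⟩ := w
  cases d
  · cases z
    · obtain ⟨s₂, ⟨-, -, h2⟩, a', s₃, ⟨-, -, h3⟩, -, -, rfl⟩ := h
      have := congrFun h2 v
      rw [h3] at this
      simpa [hl, hr] using this
    · obtain ⟨-, -, rfl⟩ := h; simp [hr]
  · obtain ⟨-, -, rfl⟩ : pushRel b u G r _ x s₁ s' := by cases z <;> exact h
    simp [hr]
  · obtain ⟨-, -, rfl⟩ : pushRel b u G l _ x s₁ s' := by cases z <;> exact h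
    simp [hl, hr]

theorem mod_code (hG : ∀ a, code a + 1 < G) {m m' : ℕ} {a a' : A}
    (h : G * m + code a = G * m' + code a') : m = m' ∧ code a = code a' := by
  have h1 := hG a
  have h2 := hG a'
  have h3 : code a = code a' := by
    have := congrArg (· % G) h
    simpa [Nat.mul_add_mod, Nat.mod_eq_of_lt (show code a < G by omega),
      Nat.mod_eq_of_lt (show code a' < G by omega)] using this
  refine ⟨?_, h3⟩
  rw [h3] at h
  exact Nat.eq_of_mul_eq_mul_left (show 0 < G by omega) (by omega)

theorem mod_code_succ (hG : ∀ a, code a + 1 < G) {m m' : ℕ} {a a' : A}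
    (h : G * m + (code a + 1) = G * m' + (code a' + 1)) : m = m' ∧ code a = code a' :=
  mod_code hG (by omega)

theorem tapeRel_sound (hG : ∀ a, code a + 1 < G) (hcode : Function.Injective code) (hlr : l ≠ r)
    (hT : TapeEnc G code T (s l) (s r)) (h : tapeRel b u l r G code a z w x s s') :
    T.read = a ∧ decide (T.head = 0) = z ∧ TapeEnc G code (T.act w) (s' l) (s' r) := by
  obtain ⟨hz, s₁, ⟨-, -, rfl⟩, h⟩ := h
  obtain ⟨hl, hr⟩ := hT
  rw [upd_of_ne _ _ hlr] at hl hz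
  rw [upd_self] at hr
  obtain ⟨r₁, e1, hr1⟩ := (rightCode_iff hG).1 hr
  obtain ⟨e2, e3⟩ := mod_code hG e1
  have ha := hcode e3
  have hz' : decide (T.head = 0) = z := by
    cases z
    · simp only [Bool.false_eq_true, if_false] at hz
      rw [hl, Nat.pos_iff_ne_zero, Ne, leftCode_eq_zero] at hz
      simpa using hz.1
    · simp only [if_true] at hz
      rw [hl, leftCode_eq_zero] at hz
      simpa using hz
  refine ⟨ha.symm, hz', ?_⟩
  obtain ⟨w1, d⟩ := w
  have hl' : s₁ l = leftCode G code (Function.update T.cells T.head w1) T.head := by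
    rw [hl]; exact leftCode_congr fun i hi => by rw [Function.update_of_ne (by omega)]
  have hr' : RightCode G code (Function.update T.cells T.head w1) (T.head + 1) (s₁ r) := by
    rw [e2]; exact hr1.congr fun i hi => by rw [Function.update_of_ne (by omega)]
  have hr'' : RightCode G code (Function.update T.cells T.head w1) T.head
      (G * s₁ r + code w1) :=
    (rightCode_iff hG).2 ⟨s₁ r, by simp, hr'⟩
  cases d
  · cases z
    · obtain ⟨s₂, ⟨-, -, h2⟩, a', s₃, ⟨-, -, h3⟩, -, -, rfl⟩ := h
      have hne : T.head ≠ 0 := by simpa using hz'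
      obtain ⟨m, hm⟩ := Nat.exists_eq_succ_of_ne_zero hne
      have e4 : G * s₃ l + (code a' + 1) = s₁ l := by
        have := congrFun h2 l
        rw [h3] at this
        simpa [hlr] using this
      have e5 : s₃ r = G * s₁ r + code w1 := by
        have := congrFun h2 r
        rw [h3] at this
        simpa [hlr.symm] using this
      rw [hl', hm] at e4
      obtain ⟨e6, e7⟩ := mod_code_succ hG e4
      refine ⟨?_, ?_⟩
      · rw [upd_of_ne _ _ hlr]
        simpa [WorkTape.act, Dir.moveWork, hm] using e6
      · rw [upd_self, e5]
        refine (rightCode_iff hG).2 ⟨G * s₁ r + code w1, ?_, ?_⟩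
        · simp [WorkTape.act, Dir.moveWork, hm, e7]
        · simpa [WorkTape.act, Dir.moveWork, hm] using hr''
    · obtain ⟨-, -, rfl⟩ := h
      have hz : T.head = 0 := by simpa using hz'
      refine ⟨?_, ?_⟩
      · rw [upd_of_ne _ _ hlr]
        simpa [WorkTape.act, Dir.moveWork, hz] using hl'
      · rw [upd_self]
        simpa [WorkTape.act, Dir.moveWork, hz] using hr''
  · obtain ⟨-, -, rfl⟩ : pushRel b u G r _ x s₁ s' := by cases z <;> exact h
    exact ⟨by rw [upd_of_ne _ _ hlr]; exact hl', by rw [upd_self]; exact hr''⟩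
  · obtain ⟨-, -, rfl⟩ : pushRel b u G l _ x s₁ s' := by cases z <;> exact h
    refine ⟨?_, by rw [upd_of_ne _ _ hlr.symm]; exact hr'⟩
    rw [upd_self]
    simp [WorkTape.act, Dir.moveWork, leftCode, hl']

theorem tapeRel_complete (hG : ∀ a, code a + 1 < G) (hlr : l ≠ r) (hul : u ≠ l) (hur : u ≠ r)
    {m : ℕ} (hbl : G ^ m ≤ b x.length l) (hbr : G ^ m ≤ b x.length r)
    (hT : TapeEnc G code T (s l) (s r)) (hu : s u = 0)
    (hblank : ∀ i, m ≤ i → code (T.cells i) = 0) (hm : T.head < m) (hm' : (T.act w).head < m) :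
    ∃ s', tapeRel b u l r G code T.read (decide (T.head = 0)) w x s s' := by
  obtain ⟨hl, hr⟩ := hT
  obtain ⟨r₁, e1, hr1⟩ := (rightCode_iff hG).1 hr
  have hG0 : 0 < G := by have := hG T.read; omega
  have hl' : s l = leftCode G code (Function.update T.cells T.head w.1) T.head := by
    rw [hl]; exact leftCode_congr fun i hi => by rw [Function.update_of_ne (by omega)]
  have hr' : RightCode G code (Function.update T.cells T.head w.1) (T.head + 1) r₁ :=
    hr1.congr fun i hi => by rw [Function.update_of_ne (by omega)]
  have hr'' : RightCode G code (Function.update T.cells T.head w.1) T.head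
      (G * r₁ + code w.1) := (rightCode_iff hG).2 ⟨r₁, by simp, hr'⟩
  have hblank' : ∀ i, m ≤ i → code (Function.update T.cells T.head w.1 i) = 0 := fun i hi => by
    rw [Function.update_of_ne (by omega)]; exact hblank i hi
  have hlb : ∀ (c : ℕ → A) h, h < m → leftCode G code c h < b x.length l := fun c h hh =>
    ((leftCode_lt hG c h).trans_le (Nat.pow_le_pow_right hG0 hh.le)).trans_le hbl
  have hrb : G * r₁ + code w.1 < b x.length r := (hr''.lt hG hblank').trans_le hbr
  have p1 : pushRel b u G r (code T.read) x (upd s r r₁) s := by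
    refine ⟨by simp [hur, hu], ?_, ?_⟩
    · simp only [upd_self]
      have : s r < b x.length r := (hr.lt hG hblank).trans_le hbr
      rwa [e1] at this
    · have : G * r₁ + code T.read = s r := e1.symm
      simp [this]
  have p2 : pushRel b u G r (code w.1) x (upd s r r₁) (upd s r (G * r₁ + code w.1)) :=
    ⟨by simp [hur, hu], by simpa using hrb, by simp⟩
  have hz : (if decide (T.head = 0) then s l = 0 else 0 < s l ∧ s l < b x.length l) := by
    by_cases h : T.head = 0
    · simp only [h, decide_true, if_true, hl]; rfl
    · simp only [h, decide_false, Bool.false_eq_true, if_false, Nat.pos_iff_ne_zero, Ne]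
      rw [hl, leftCode_eq_zero]
      exact ⟨h, hlb _ _ hm⟩
  obtain ⟨w1, d⟩ := w
  simp only at *
  cases d
  · by_cases h : T.head = 0
    · rw [h] at hz ⊢
      exact ⟨_, hz, _, p1, p2⟩
    · obtain ⟨k, hk⟩ := Nat.exists_eq_succ_of_ne_zero h
      have hd : decide (T.head = 0) = false := by simp [h]
      rw [hd] at hz ⊢
      have e2 : s l = G * leftCode G code T.cells k + (code (T.cells k) + 1) := by
        rw [hl, hk]; rfl
      have h3 : RightCode G code (Function.update T.cells T.head w1) k
          (G * (G * r₁ + code w1) + code (T.cells k)) :=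
        (rightCode_iff hG).2 ⟨G * r₁ + code w1, by simp [hk], by rw [hk] at hr''⊢; exact hr''⟩
      refine ⟨_, hz, _, p1, _, p2, T.cells k,
        upd (upd s r (G * r₁ + code w1)) l (leftCode G code T.cells k), ⟨?_, ?_, ?_⟩,
          ?_, ?_, rfl⟩
      · simp [hur, hul, hu]
      · simp only [upd_self]
        rw [← e2, hl]; exact hlb _ _ hm
      · simp only [upd_self, upd_idem]
        rw [← e2]
        conv_rhs => rw [show s l = upd s r (G * r₁ + code w1) l by simp [hlr]]
        rw [upd_eq_self]
      · simp [hur, hul, hu]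
      · rw [upd_of_ne _ _ hlr.symm, upd_self]
        exact (h3.lt hG hblank').trans_le hbr
  · exact ⟨_, hz, _, p1, by cases decide (T.head = 0) <;> exact p2⟩
  · have p3 : pushRel b u G l (code w1 + 1) x (upd s r r₁)
        (upd (upd s r r₁) l (G * s l + (code w1 + 1))) := by
      refine ⟨by simp [hur, hu], ?_, ?_⟩
      · rw [upd_of_ne _ _ hlr, hl']
        have := hlb (Function.update T.cells T.head w1) (T.head + 1) hm'
        simpa [leftCode] using this
      · rw [upd_of_ne _ _ hlr]
    exact ⟨_, hz, _, p1, by cases decide (T.head = 0) <;> exact p3⟩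

end TapeProgram

end PrivAlt

namespace PrivAlt

section Heads

variable {α V : Type} {b : ℕ → V → ℕ} {H : Set V}

theorem cdef_lt (v : V) (hb : ∀ n, 0 < b n v) : CDef (α := α) b H fun x s s' =>
    s v < b x.length v ∧ s' = s := by
  refine ((cdef_zero v).union (cdef_pos v)).congr fun x s s' => ?_
  have := hb x.length
  rw [← or_and_right]
  refine and_congr_left fun _ => ?_
  omega

/-- Reading an input symbol and moving a head. -/
def headRel (v : V) (a : InSym α) (d : Dir) (x : List α) (s s' : V → ℕ) : Prop :=
  s v < x.length + 2 ∧ inputSym x (s v) = a ∧ s' = upd s v (d.moveInput x.length (s v))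

theorem cdef_headRel {v : V} (hv : v ∈ H) (hb : ∀ n, b n v = n + 2) (a : InSym α) (d : Dir) :
    CDef b H (headRel v a d) := by
  have ht : CDef (α := α) b H fun x s s' =>
      (s v < x.length + 2 ∧ inputSym x (s v) = a) ∧ s' = s := by
    refine ((cdef_lt v fun n => by rw [hb]; omega).comp
      (Definable.prim (Op.test v {a}))).congr fun x s s' => ?_
    rw [hb]
    constructor
    · rintro ⟨⟨h1, h2⟩, rfl⟩
      exact ⟨s', ⟨h1, rfl⟩, Or.inl hv, h2, rfl⟩
    · rintro ⟨_, ⟨h1, rfl⟩, -, h2, rfl⟩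
      exact ⟨⟨h1, h2⟩, rfl⟩
  cases d
  · by_cases ha : a = .leftEnd
    · refine ht.congr fun x s s' => ?_
      simp only [headRel, Dir.moveInput, and_assoc]
      refine and_congr_right fun _ => and_congr_right fun h => ?_
      rw [ha, inputSym_eq_leftEnd] at h
      have : s v - 1 = s v := by omega
      rw [this, upd_eq_self]
    · refine (ht.comp (Definable.prim (Op.dec v))).congr fun x s s' => ?_
      constructor
      · rintro ⟨h1, h2, rfl⟩
        have h3 : s v ≠ 0 := fun h => ha (by rw [← h2, inputSym_eq_leftEnd, h])
        refine ⟨s, ⟨⟨h1, h2⟩, rfl⟩, ?_, ?_⟩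
        · rw [hb]; simp [Dir.moveInput]; omega
        · simp [Dir.moveInput, Nat.sub_add_cancel (Nat.pos_of_ne_zero h3)]
      · rintro ⟨m, ⟨⟨h1, h2⟩, hm⟩, h3, h4⟩
        rw [← hm]
        rw [← hm] at h1 h2
        refine ⟨h1, h2, ?_⟩
        rw [h4]
        simp [Dir.moveInput]
  · refine ht.congr fun x s s' => ?_
    simp [headRel, Dir.moveInput, and_assoc]
  · by_cases ha : a = .rightEnd
    · refine ht.congr fun x s s' => ?_
      simp only [headRel, Dir.moveInput, and_assoc]
      refine and_congr_right fun _ => and_congr_right fun h => ?_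
      rw [ha, inputSym_eq_rightEnd] at h
      have : min (s v + 1) (x.length + 1) = s v := by omega
      rw [this, upd_eq_self]
    · refine (ht.comp (Definable.prim (Op.inc v))).congr fun x s s' => ?_
      constructor
      · rintro ⟨h1, h2, rfl⟩
        have h3 : ¬ x.length + 1 ≤ s v := fun h =>
          ha (by rw [← h2, inputSym_eq_rightEnd]; exact h)
        refine ⟨s, ⟨⟨h1, h2⟩, rfl⟩, ?_, ?_⟩
        · rw [hb]; omega
        · have : min (s v + 1) (x.length + 1) = s v + 1 := by omega
          simp [Dir.moveInput, this]
      · rintro ⟨m, ⟨⟨h1, h2⟩, rfl⟩, h3, rfl⟩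
        refine ⟨h1, h2, ?_⟩
        rw [hb] at h3
        have : min (m v + 1) (x.length + 1) = m v + 1 := by omega
        simp [Dir.moveInput, this]

end Heads

section Sequence

variable {V I : Type} {R : I → (V → ℕ) → (V → ℕ) → Prop} {vars : I → Set V}

/-- A sequence of relations that change disjoint sets of variables. -/
theorem seqRel_local (hfr : ∀ i s s', R i s s' → ∀ v ∉ vars i, s' v = s v)
    (hdisj : ∀ i j, i ≠ j → Disjoint (vars i) (vars j)) {l : List I} (hl : l.Nodup)
    {s s' : V → ℕ} (h : seqRel R l s s') :
    (∀ v, (∀ i ∈ l, v ∉ vars i) → s' v = s v) ∧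
    ∀ i ∈ l, ∃ t t', R i t t' ∧ (∀ v ∈ vars i, t v = s v) ∧ (∀ v ∈ vars i, s' v = t' v) ∧
      ∀ v, (∀ j, v ∉ vars j) → t v = s v := by
  induction l generalizing s with
  | nil => obtain rfl := h; simp
  | cons i l ih =>
    rw [List.nodup_cons] at hl
    obtain ⟨m, h1, h2⟩ := h
    obtain ⟨h3, h4⟩ := ih hl.2 h2
    have hfi := hfr i _ _ h1
    refine ⟨fun v hv => ?_, fun j hj => ?_⟩
    · rw [h3 v fun k hk => hv k (by simp [hk]), hfi v (hv i (by simp))]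
    · rcases List.mem_cons.1 hj with rfl | hj
      · refine ⟨s, m, h1, fun _ _ => rfl, fun v hv => h3 v fun k hk hvk => ?_, fun _ _ => rfl⟩
        have hne : j ≠ k := by rintro rfl; exact hl.1 hk
        exact Set.disjoint_left.1 (hdisj j k hne) hv hvk
      · have hne : j ≠ i := fun h => hl.1 (h ▸ hj)
        obtain ⟨t, t', h5, h6, h7, h8⟩ := h4 j hj
        refine ⟨t, t', h5, fun v hv => ?_, h7, fun v hv => ?_⟩
        · rw [h6 v hv, hfi v (Set.disjoint_left.1 (hdisj j i hne) hv)]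
        · rw [h8 v hv, hfi v (hv i)]

theorem exists_seqRel (hfr : ∀ i s s', R i s s' → ∀ v ∉ vars i, s' v = s v)
    (hdisj : ∀ i j, i ≠ j → Disjoint (vars i) (vars j)) {l : List I} (hl : l.Nodup)
    {s : V → ℕ} (h : ∀ i ∈ l, ∀ t : V → ℕ, (∀ v ∈ vars i, t v = s v) →
      (∀ v, (∀ j, v ∉ vars j) → t v = s v) → ∃ t', R i t t') : ∃ s', seqRel R l s s' := by
  induction l generalizing s with
  | nil => exact ⟨s, rfl⟩
  | cons i l ih =>
    rw [List.nodup_cons] at hl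
    obtain ⟨m, hm⟩ := h i (by simp) s (fun _ _ => rfl) fun _ _ => rfl
    have hfi := hfr i _ _ hm
    obtain ⟨s', hs'⟩ := ih hl.2 (s := m) fun j hj t h1 h2 => by
      have hne : j ≠ i := by rintro rfl; exact hl.1 hj
      refine h j (by simp [hj]) t (fun v hv => ?_) fun v hv => ?_
      · rw [h1 v hv, hfi v (Set.disjoint_left.1 (hdisj j i hne) hv)]
      · rw [h2 v hv, hfi v (hv i)]
    exact ⟨s', m, hm, hs'⟩

end Sequence

/-! ### Multi-head machines as counter programs -/

theorem IsLogBound.exists_pow_le {s : ℕ → ℕ} (hs : IsLogBound s) (G : ℕ) (hG : 1 ≤ G) :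
    ∃ k, ∀ n, G ^ max 1 (s n) ≤ (n + 2) ^ k := by
  obtain ⟨C, hC⟩ := hs.bound
  obtain ⟨N, hN⟩ := Filter.eventually_atTop.1 hC
  obtain ⟨K, hK⟩ := exists_nat_ge (max C 1 * (Real.log G / 1) / 1)
  have hG' : (1 : ℝ) ≤ G := by exact_mod_cast hG
  have hlogG : 0 ≤ Real.log G := Real.log_nonneg hG'
  let K₁ := ∑ n ∈ Finset.range (N + 3), G ^ max 1 (s n)
  refine ⟨K + K₁ + G, fun n => ?_⟩
  by_cases hn : n < N + 3
  · calc G ^ max 1 (s n) ≤ K₁ :=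
        Finset.single_le_sum (f := fun n => G ^ max 1 (s n)) (fun _ _ => Nat.zero_le _)
          (Finset.mem_range.2 hn)
      _ ≤ 2 ^ K₁ := Nat.lt_two_pow_self.le
      _ ≤ (n + 2) ^ K₁ := Nat.pow_le_pow_left (by omega) _
      _ ≤ _ := Nat.pow_le_pow_right (by omega) (by omega)
  · have h1 := hN n (by omega)
    have hlogn : 0 ≤ Real.log n := Real.log_natCast_nonneg n
    simp only [RCLike.norm_natCast, Real.norm_of_nonneg hlogn] at h1
    have h2 : G ^ (s n) ≤ (n + 2) ^ K := by
      have hr : ((G : ℝ)) ^ (s n) ≤ ((n : ℝ)) ^ K := by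
        rw [← Real.log_le_log_iff (by positivity) (by
          have : (0:ℝ) < n := by exact_mod_cast (by omega : 0 < n)
          positivity), Real.log_pow, Real.log_pow]
        calc (s n : ℝ) * Real.log G ≤ (C * Real.log n) * Real.log G := by gcongr
          _ ≤ (max C 1 * Real.log n) * Real.log G := by gcongr; exact le_max_left _ _
          _ = (max C 1 * (Real.log G / 1) / 1) * Real.log n := by ring
          _ ≤ K * Real.log n := by gcongr
      have : G ^ (s n) ≤ n ^ K := by exact_mod_cast hr
      exact this.trans (Nat.pow_le_pow_left (by omega) _)
    have h3 : G ≤ (n + 2) ^ G := by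
      calc G ≤ 2 ^ G := Nat.lt_two_pow_self.le
        _ ≤ _ := Nat.pow_le_pow_left (by omega) _
    rcases le_total 1 (s n) with h | h
    · rw [max_eq_right h]
      exact h2.trans (Nat.pow_le_pow_right (by omega) (by omega))
    · rw [max_eq_left h, pow_one]
      exact h3.trans (Nat.pow_le_pow_right (by omega) (by omega))

theorem exists_code (A : Type) [Finite A] (a₀ : A) : ∃ (G : ℕ) (code : A → ℕ),
    (∀ a, code a + 1 < G) ∧ Function.Injective code ∧ code a₀ = 0 := by
  classical
  obtain ⟨n, ⟨e⟩⟩ := Finite.exists_equiv_fin A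
  refine ⟨n + 2, fun a => if a = a₀ then 0 else e a + 1, fun a => ?_, fun a a' h => ?_, by simp⟩
  · have := (e a).2
    dsimp only
    split_ifs <;> omega
  · dsimp only at h
    split_ifs at h with h1 h2
    · rw [h1, h2]
    · exact e.injective (Fin.ext (by omega))

namespace MTM

variable {α : Type} (M : MTM α)

theorem blank_of_reachable {s : ℕ → ℕ} (hM : M.SpaceBounded s) {x : List α} {c : M.Cfg}
    (hc : M.Reachable x c) (t : M.Tape) (i : ℕ) (hi : max 1 (s x.length) ≤ i) :
    (c.tapes t).cells i = M.blank := by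
  induction hc with
  | refl => rfl
  | tail hr hs ih =>
    obtain ⟨a, -, rfl⟩ := hs
    have := hM x _ hr t
    simp only [WorkTape.Within] at this
    simp only [WorkTape.act]
    rw [Function.update_of_ne (by omega), ih]

/-- Counters used to store the work tapes, and an auxiliary one. -/
abbrev Counter : Type := Option (M.Tape × Bool)

/-- The variables changed by an action on a head or a tape. -/
def unitVars : M.Head ⊕ M.Tape → Set (M.Head ⊕ M.Counter)
  | .inl h => {.inl h}
  | .inr t => {.inr (some (t, false)), .inr (some (t, true))}

/-- What a move reads and does. -/
abbrev Label : Type :=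
  ((M.Head → InSym α) × (M.Tape → M.Sym × Bool)) × (M.Head → Dir) × (M.Tape → M.Sym × Dir)

/-- The effect of a move on one head or tape. -/
def unitRel (G k : ℕ) (code : M.Sym → ℕ) (a : M.Label) :
    M.Head ⊕ M.Tape → List α → (M.Head ⊕ M.Counter → ℕ) → (M.Head ⊕ M.Counter → ℕ) → Prop
  | .inl h => headRel (.inl h) (a.1.1 h) (a.2.1 h)
  | .inr t => tapeRel (polyBound M.Head M.Counter k) (.inr none) (.inr (some (t, false)))
      (.inr (some (t, true))) G code (a.1.2 t).1 (a.1.2 t).2 (a.2.2 t)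

/-- Representation of configurations by counters. -/
def StoreEnc (G : ℕ) (code : M.Sym → ℕ) (x : List α) (c : M.Cfg)
    (s : M.Head ⊕ M.Counter → ℕ) : Prop :=
  s (.inr none) = 0 ∧ (∀ h, s (.inl h) = c.heads h ∧ c.heads h < x.length + 2) ∧
    ∀ t, TapeEnc G code (c.tapes t) (s (.inr (some (t, false)))) (s (.inr (some (t, true))))

theorem unitRel_frame {G k : ℕ} {code : M.Sym → ℕ} {a : M.Label} {x : List α}
    (i : M.Head ⊕ M.Tape) (s s' : M.Head ⊕ M.Counter → ℕ) (h : M.unitRel G k code a i x s s') :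
    ∀ v ∉ M.unitVars i, s' v = s v := by
  intro v hv
  rcases i with i | t
  · obtain ⟨-, -, rfl⟩ := h
    simp only [unitVars, Set.mem_singleton_iff] at hv
    simp [hv]
  · simp only [unitVars, Set.mem_insert_iff, Set.mem_singleton_iff, not_or] at hv
    exact tapeRel_frame h v hv.1 hv.2

theorem disjoint_unitVars (i j : M.Head ⊕ M.Tape) (h : i ≠ j) :
    Disjoint (M.unitVars i) (M.unitVars j) := by
  rcases i with i | i <;> rcases j with j | j <;> simp_all [unitVars, eq_comm]

theorem aux_notMem_unitVars (i : M.Head ⊕ M.Tape) : (.inr none) ∉ M.unitVars i := by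
  rcases i with i | i <;> simp [unitVars]

theorem moveInput_lt {n p : ℕ} (hp : p < n + 2) (d : Dir) : d.moveInput n p < n + 2 := by
  cases d <;> simp only [Dir.moveInput] <;> omega

variable {M} {G k : ℕ} {code : M.Sym → ℕ} {x : List α} {c : M.Cfg}
  {s : M.Head ⊕ M.Counter → ℕ} {l : List (M.Head ⊕ M.Tape)}

theorem StoreEnc.sound (hG : ∀ a, code a + 1 < G) (hcode : Function.Injective code)
    (hl : l.Nodup) (hl' : ∀ i, i ∈ l) (hc : M.StoreEnc G code x c s) {a : M.Label}
    {s' : M.Head ⊕ M.Counter → ℕ} (h : seqRel (fun i => M.unitRel G k code a i x) l s s')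
    (q : M.State) :
    a.1 = (fun h => inputSym x (c.heads h),
      fun t => ((c.tapes t).read, decide ((c.tapes t).head = 0))) ∧
    M.StoreEnc G code x ⟨q, fun h => (a.2.1 h).moveInput x.length (c.heads h),
      fun t => (c.tapes t).act (a.2.2 t)⟩ s' := by
  obtain ⟨h1, h2⟩ := seqRel_local (vars := M.unitVars)
    (fun i => M.unitRel_frame i) M.disjoint_unitVars hl h
  have hh : ∀ h, inputSym x (c.heads h) = a.1.1 h ∧
      s' (.inl h) = (a.2.1 h).moveInput x.length (c.heads h) := by
    intro h
    obtain ⟨t, t', ⟨-, h4, rfl⟩, h5, h6, -⟩ := h2 (.inl h) (hl' _)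
    have e1 : t (.inl h) = c.heads h := by rw [h5 _ rfl, (hc.2.1 h).1]
    refine ⟨by rw [← h4, e1], ?_⟩
    rw [h6 _ rfl, upd_self, e1]
  have ht : ∀ t, (c.tapes t).read = (a.1.2 t).1 ∧ decide ((c.tapes t).head = 0) = (a.1.2 t).2 ∧
      TapeEnc G code ((c.tapes t).act (a.2.2 t)) (s' (.inr (some (t, false))))
        (s' (.inr (some (t, true)))) := by
    intro t
    obtain ⟨u, u', h4, h5, h6, -⟩ := h2 (.inr t) (hl' _)
    rw [h6 (.inr (some (t, false))) (by simp [unitVars]),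
      h6 (.inr (some (t, true))) (by simp [unitVars])]
    refine tapeRel_sound hG hcode (by simp) ?_ h4
    rw [h5 (.inr (some (t, false))) (by simp [unitVars]),
      h5 (.inr (some (t, true))) (by simp [unitVars])]
    exact hc.2.2 t
  refine ⟨Prod.ext (funext fun h => (hh h).1.symm) (funext fun t => Prod.ext (ht t).1.symm
    (ht t).2.1.symm), ?_, fun h => ⟨(hh h).2, moveInput_lt (hc.2.1 h).2 _⟩, fun t => (ht t).2.2⟩
  rw [h1 _ fun i _ => M.aux_notMem_unitVars i, hc.1]

theorem StoreEnc.complete (hG : ∀ a, code a + 1 < G) (hl : l.Nodup)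
    (hc : M.StoreEnc G code x c s) {m : ℕ} (hm : G ^ m ≤ (x.length + 2) ^ k)
    (hblank : ∀ t i, m ≤ i → code ((c.tapes t).cells i) = 0) (a : M.Label)
    (ha : a.1 = (fun h => inputSym x (c.heads h),
      fun t => ((c.tapes t).read, decide ((c.tapes t).head = 0))))
    (h1 : ∀ t, (c.tapes t).head < m) (h2 : ∀ t, ((c.tapes t).act (a.2.2 t)).head < m) :
    ∃ s', seqRel (fun i => M.unitRel G k code a i x) l s s' := by
  refine exists_seqRel (vars := M.unitVars)
    (fun i => M.unitRel_frame i) M.disjoint_unitVars hl ?_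
  rintro (h | t) - u hu hu'
  · have e1 : u (.inl h) = c.heads h := by rw [hu _ rfl, (hc.2.1 h).1]
    refine ⟨_, by rw [e1]; exact (hc.2.1 h).2, ?_, rfl⟩
    rw [ha, e1]
  · simp only [unitRel, ha]
    refine tapeRel_complete hG (by simp) (by simp) (by simp) hm hm ?_ ?_ (hblank t) (h1 t) (h2 t)
    · rw [hu (.inr (some (t, false))) (by simp [unitVars]),
        hu (.inr (some (t, true))) (by simp [unitVars])]
      exact hc.2.2 t
    · rw [hu' _ M.aux_notMem_unitVars, hc.1]

end MTM

theorem mnl_subset_counterNL (α : Type) [Finite α] : MNL α ⊆ CounterNL α := by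
  rintro L ⟨sp, hsp, M, hM, hL⟩
  obtain ⟨G, code, hG, hcode, hblank⟩ := exists_code M.Sym M.blank
  have hG1 : 1 ≤ G := by have := hG M.blank; omega
  obtain ⟨k, hk⟩ := hsp.exists_pow_le G hG1
  have := Fintype.ofFinite (M.Head ⊕ M.Tape)
  let l := (Finset.univ : Finset (M.Head ⊕ M.Tape)).toList
  have hl : l.Nodup := Finset.nodup_toList _
  have hl' : ∀ i, i ∈ l := by simp [l]
  let E : Set (M.State × M.Label × M.State) :=
    {e | (e.2.2, e.2.1.2) ∈ M.next e.1 e.2.1.1.1 e.2.1.1.2}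
  let R : M.Label → List α → (M.Head ⊕ M.Counter → ℕ) → (M.Head ⊕ M.Counter → ℕ) → Prop :=
    fun a x => seqRel (fun i => M.unitRel G k code a i x) l
  have hR : ∀ a, CDef (polyBound M.Head M.Counter k) (Set.range Sum.inl) (R a) := by
    intro a
    refine Definable.seq (R := M.unitRel G k code a) (fun i => ?_) l
    rcases i with h | t
    · exact cdef_headRel (v := Sum.inl h) (Set.mem_range_self h) (fun n => rfl) (a.1.1 h) (a.2.1 h)
    · exact cdef_tapeRel (u := Sum.inr none) (l := Sum.inr (some (t, false)))
        (r := Sum.inr (some (t, true))) (by simp) (by simp) hG1 (fun n => rfl) (fun n => rfl)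
        (fun n => by simp [polyBound]) (a.1.2 t).1 (a.1.2 t).2 (a.2.2 t)
  refine counterNL_of_poly (Definable.graph E R hR M.start M.accept) fun x => (hL x).trans ?_
  constructor
  · rintro ⟨c, hc, hacc⟩
    have key : ∃ s, ReflTransGen (GraphStep E fun i => R i x) (M.start, fun _ => 0)
        (c.state, s) ∧ M.StoreEnc G code x c s := by
      clear hacc
      induction hc with
      | refl =>
        refine ⟨_, .refl, rfl, fun h => ⟨rfl, by simp [MTM.startCfg]⟩, fun t => ⟨rfl, fun i => ?_⟩⟩
        simp [MTM.startCfg, WorkTape.empty, hblank]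
      | @tail c c' hr hs ih =>
        obtain ⟨s, h1, h2⟩ := ih
        have hr' : M.Reachable x c' := hr.tail hs
        obtain ⟨a, ha, rfl⟩ := hs
        let lab : M.Label := ((fun h => inputSym x (c.heads h),
          fun t => ((c.tapes t).read, decide ((c.tapes t).head = 0))), a.2)
        obtain ⟨s', hs'⟩ := h2.complete hG hl (hk x.length) (fun t i hi => by
          rw [M.blank_of_reachable hM hr t i hi, hblank]) lab rfl
          (fun t => hM x _ hr t) (fun t => hM x _ hr' t)
        exact ⟨s', h1.tail ⟨lab, ha, hs'⟩, (h2.sound hG hcode hl hl' hs' a.1).2⟩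
    obtain ⟨s, hs, -⟩ := key
    exact ⟨s, hacc ▸ hs⟩
  · rintro ⟨s, hs⟩
    have key : ∀ d, ReflTransGen (GraphStep E fun i => R i x) (M.start, fun _ => 0) d →
        ∃ c, M.Reachable x c ∧ c.state = d.1 ∧ M.StoreEnc G code x c d.2 := by
      intro d hd
      induction hd with
      | refl =>
        refine ⟨M.startCfg, .refl, rfl, rfl, fun h => ⟨rfl, by simp [MTM.startCfg]⟩,
          fun t => ⟨rfl, fun i => ?_⟩⟩
        simp [MTM.startCfg, WorkTape.empty, hblank]
      | @tail d d' _ hs ih =>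
        obtain ⟨c, h1, h2, h3⟩ := ih
        obtain ⟨a, ha, hs⟩ := hs
        obtain ⟨h4, h5⟩ := h3.sound hG hcode hl hl' hs d'.1
        refine ⟨_, h1.tail ⟨(d'.1, a.2), ?_, rfl⟩, rfl, h5⟩
        have ha : (d'.1, a.2) ∈ M.next d.1 a.1.1 a.1.2 := ha
        rw [h4, ← h2] at ha
        exact ha
    obtain ⟨c, h1, h2, -⟩ := key _ hs
    exact ⟨c, h1, h2⟩

/-- Ordinary machines are multi-head machines. -/
theorem nl_subset_mnl (α : Type) : NL α ⊆ MNL α := by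
  rintro L ⟨s, hs, M, hM, hL⟩
  have := M.finState
  have := M.finSym
  have := M.finTape
  let N : MTM α :=
    { State := M.State, Sym := M.Sym, Head := Unit, Tape := M.Tape, blank := M.blank
      start := M.start, accept := M.accept
      next := fun q a r => {b | (b.1, b.2.1 (), b.2.2) ∈ M.next q (a ()) fun t => (r t).1} }
  let f : N.Cfg → M.Cfg := fun c => ⟨c.state, c.heads (), c.tapes⟩
  have h1 : ∀ x c, N.Reachable x c → M.Reachable x (f c) := fun x c hc =>
    ReflTransGen.lift f (fun c c' ⟨a, ha, h⟩ => ⟨(a.1, a.2.1 (), a.2.2), ha, by rw [h]⟩) _ _ hc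
  let g : M.Cfg → N.Cfg := fun c => ⟨c.state, fun _ => c.inHead, c.tapes⟩
  have h2 : ∀ x c, M.Reachable x c → N.Reachable x (g c) := fun x c hc =>
    ReflTransGen.lift g (fun c c' ⟨a, ha, h⟩ => ⟨(a.1, fun _ => a.2.1, a.2.2), ha, by rw [h]⟩) _ _ hc
  refine ⟨s, hs, N, fun x c hc => hM x _ (h1 x c hc), fun x => (hL x).trans ⟨?_, ?_⟩⟩
  · rintro ⟨c, hc, h⟩; exact ⟨g c, h2 x c hc, h⟩
  · rintro ⟨c, hc, h⟩; exact ⟨f c, h1 x c hc, h⟩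

end PrivAlt

namespace PrivAlt

/-! ### General facts about winning strategies -/

namespace PATM

variable {α : Type} {M : PATM α} {x : List α} {σ σ' : M.Strategy} {h : List M.Event} {c : M.Cfg}

theorem observe_of_eq {c' : M.Cfg} (hv : c'.view = c.view) : observe h c c' = h := if_pos hv

theorem observe_of_ne {c' : M.Cfg} (hv : c'.view ≠ c.view) :
    observe h c c' = h ++ [Sum.inr c'.view] := if_neg hv

theorem length_le_observe (c' : M.Cfg) : h.length ≤ (observe h c c').length := by
  by_cases hv : c'.view = c.view
  · rw [observe_of_eq hv]
  · rw [observe_of_ne hv]; simp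

theorem Wins.existential_inv (hk : c.kind = .existential) (hw : Wins x σ h c) :
    Wins x σ (h ++ [Sum.inl (σ h)]) (c.stepE x (σ h)) := by
  cases hw <;> first | assumption | simp_all

theorem Wins.universal_inv (hk : c.kind = .universal) (hw : Wins x σ h c) (u : M.UChoice) :
    Wins x σ (observe h c (c.stepU x u)) (c.stepU x u) := by
  cases hw with
  | universal _ h => exact h u
  | _ => simp_all

theorem Wins.deterministic_inv (hk : c.kind = .deterministic) (hw : Wins x σ h c) :
    Wins x σ (observe h c (c.stepD x)) (c.stepD x) := by
  cases hw <;> first | assumption | simp_all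

theorem Wins.kind_ne_reject (hw : Wins x σ h c) : c.kind ≠ .reject := by
  cases hw <;> simp_all

/-- Only the choices after extensions of the present history matter. -/
theorem Wins.congr {n : ℕ} (hσ : ∀ h' : List M.Event, n ≤ h'.length → σ h' = σ' h')
    (hw : Wins x σ h c) (hn : n ≤ h.length) : Wins x σ' h c := by
  induction hw with
  | accept hk => exact .accept hk
  | existential hk _ ih =>
    refine .existential hk ?_
    rw [← hσ _ hn]
    exact ih (by simp; omega)
  | universal hk _ ih => exact .universal hk fun u => ih u (hn.trans (length_le_observe _))
  | deterministic hk _ ih => exact .deterministic hk (ih (hn.trans (length_le_observe _)))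

end PATM

/-! ### Blind machines for counter programs -/

namespace Blind

variable {α V Q : Type}

open Classical in
/-- The private check of an operation by the branch that follows the variable `v`: whether it
is admissible, and the resulting movement. -/
noncomputable def check (v : Option V) (a : InSym α) : Option (Op α V) → Bool × Dir
  | none => (true, .stay)
  | some (.inc w) => if v = some w then (decide (a ≠ .rightEnd), .right) else (true, .stay)
  | some (.dec w) => if v = some w then (decide (a ≠ .leftEnd), .left) else (true, .stay)
  | some (.test w A) => if v = some w then (decide (a ∈ A), .stay) else (true, .stay)

open Classical in
/-- The existential player publishes a path in the graph; the universal player privately selects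
a variable, whose value is then followed by the private input head. -/
noncomputable def machine [Finite α] [Finite V] [Finite Q] (st fi : Q)
    (E : Set (Q × Option (Op α V) × Q)) : PATM α where
  Pub := Q × Option (Op α V) × Bool
  Priv := Option (Option V) × Bool × Bool
  Sym := Unit
  PubTape := Empty
  PrivTape := Empty
  EChoice := Q × Option (Op α V) × Q
  UChoice := Option V
  neEChoice := ⟨(st, none, st)⟩
  headPrivate := true
  blank := ()
  startPub := (st, none, false)
  startPriv := (none, false, true)
  kind p r := if r.1 = none then .universal else if r.2.2 = false then .reject
    else if p.2.2 ≠ r.2.1 then .deterministic else if p.1 = fi then .accept else .existential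
  nextE p _ _ e := (if e.1 = p.1 ∧ e ∈ E then (e.2.2, e.2.1, !p.2.2) else (p.1, none, !p.2.2),
    .stay, Empty.elim)
  nextU p _ _ _ _ u := (p, (some u, false, true), .stay, Empty.elim, Empty.elim)
  nextD p r a _ _ := (p, (r.1, p.2.2, (check r.1.join a p.2.1).1), (check r.1.join a p.2.1).2,
    Empty.elim, Empty.elim)

/-- The head position of the branch following `v`. -/
def position (s : V → ℕ) : Option V → ℕ
  | none => 0
  | some v => s v

/-- An operation is carried out correctly if and only if no branch objects. -/
theorem optSem_iff_check {x : List α} {s s' : V → ℕ} (hs : ∀ v, s v < x.length + 2)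
    (p : Option (Op α V)) :
    optSem (Op.sem (fun n (_ : V) => n + 2) Set.univ) p x s s' ↔
      ∀ v, (check v (inputSym x (position s v)) p).1 = true ∧ position s' v =
        (check v (inputSym x (position s v)) p).2.moveInput x.length (position s v) := by
  classical
  rcases p with _ | w | w | ⟨w, A⟩
  · constructor
    · rintro rfl v; exact ⟨rfl, rfl⟩
    · intro h; exact funext fun v => (h (some v)).2
  · constructor
    · rintro ⟨h, rfl⟩ v
      by_cases hv : v = some w
      · subst hv
        simp only [check, if_true, position, upd_self, Dir.moveInput, decide_eq_true_eq, Ne,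
          inputSym_eq_rightEnd]
        simp only at h
        omega
      · simp only [check, if_neg hv, true_and, Dir.moveInput]
        rcases v with _ | v
        · rfl
        · have : v ≠ w := fun h => hv (by rw [h])
          simp [position, this]
    · intro h
      have hw := h (some w)
      simp only [check, if_true, position, Dir.moveInput, decide_eq_true_eq, Ne,
          inputSym_eq_rightEnd] at hw
      refine ⟨by simp only; omega, funext fun v => ?_⟩
      by_cases hv : v = w
      · subst hv; simp only [upd_self]; omega
      · have := (h (some v)).2
        simpa [check, hv, position, Dir.moveInput] using this
  · constructor
    · rintro ⟨h, rfl⟩ v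
      by_cases hv : v = some w
      · subst hv
        simp [check, position, Dir.moveInput, inputSym_eq_leftEnd]
      · simp only [check, if_neg hv, true_and, Dir.moveInput]
        rcases v with _ | v
        · rfl
        · have : v ≠ w := fun h => hv (by rw [h])
          simp [position, this]
    · intro h
      have hw := h (some w)
      simp only [check, if_true, position, Dir.moveInput, decide_eq_true_eq, Ne,
          inputSym_eq_leftEnd] at hw
      have := hs w
      refine ⟨by simp only; omega, funext fun v => ?_⟩
      by_cases hv : v = w
      · subst hv; simp only [upd_self]; omega
      · have := (h (some v)).2
        simpa [check, hv, position, Dir.moveInput] using this.symm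
  · constructor
    · rintro ⟨-, h, rfl⟩ v
      by_cases hv : v = some w
      · subst hv
        simp only [check, if_true]
        exact ⟨decide_eq_true h, rfl⟩
      · simp [check, hv, Dir.moveInput]
    · intro h
      have hw := h (some w)
      simp only [check, if_true, position] at hw
      refine ⟨by simp, of_decide_eq_true hw.1, funext fun v => ?_⟩
      have := (h (some v)).2
      by_cases hv : v = w
      · subst hv; simpa [check, position, Dir.moveInput] using this
      · simpa [check, hv, position, Dir.moveInput] using this

theorem sem_lt {x : List α} {s s' : V → ℕ} (hs : ∀ v, s v < x.length + 2)
    {p : Option (Op α V)} (h : optSem (Op.sem (fun n (_ : V) => n + 2) Set.univ) p x s s') :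
    ∀ v, s' v < x.length + 2 := by
  rw [optSem_iff_check hs] at h
  intro v
  have := (h (some v)).2
  simp only [position] at this
  rw [this]
  exact MTM.moveInput_lt (hs v) _

variable [Finite α] [Finite V] [Finite Q] {st fi : Q} {E : Set (Q × Option (Op α V) × Q)}

theorem machine_isBlind : (machine st fi E).IsBlind := by
  intro x c
  refine ⟨fun _ u => ?_, fun _ => ?_⟩
  · simp only [PATM.Cfg.view, PATM.Cfg.stepU, PATM.Cfg.act, machine, if_true]
    congr 1
    exact funext fun t => t.elim
  · simp only [PATM.Cfg.view, PATM.Cfg.stepD, PATM.Cfg.act, machine, if_true]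
    congr 1
    exact funext fun t => t.elim

theorem machine_spaceBounded (s : ℕ → ℕ) : (machine st fi E).SpaceBounded s :=
  fun _ _ _ _ => ⟨fun t => Empty.elim t, fun t => Empty.elim t⟩

theorem machine_universalMovesAtMost : (machine st fi E).UniversalMovesAtMost 1 := by
  intro x k c hc
  have key : (c.priv.1 = none → k = 0) ∧ k ≤ 1 := by
    induction hc with
    | start => simp
    | existential e _ _ ih => exact ih
    | universal u _ hk ih =>
      rename_i c _
      have : c.priv.1 = none := by
        by_contra h
        simp only [PATM.Cfg.kind, machine, if_neg h] at hk
        split_ifs at hk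
      refine ⟨fun h => ?_, by rw [ih.1 this]⟩
      simp [PATM.Cfg.stepU, PATM.Cfg.act, machine] at h
    | deterministic _ _ ih => exact ih
  exact key.2

/-- A configuration of the machine. -/
noncomputable def cfg (st fi : Q) (E : Set (Q × Option (Op α V) × Q)) (q : Q)
    (p : Option (Op α V)) (b : Bool) (v : Option V) (b' ok : Bool) (m : ℕ) :
    (machine st fi E).Cfg :=
  ⟨(q, p, b), (some v, b', ok), m, fun t => Empty.elim t, fun t => Empty.elim t⟩

theorem cfg_kind (q : Q) (p : Option (Op α V)) (b : Bool) (v : Option V) (b' : Bool) (m : ℕ) :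
    (cfg st fi E q p b v b' true m).kind =
      open Classical in if b ≠ b' then .deterministic else if q = fi then .accept
        else .existential := by
  simp [cfg, PATM.Cfg.kind, machine]

theorem cfg_kind_reject (q : Q) (p : Option (Op α V)) (b : Bool) (v : Option V) (b' : Bool)
    (m : ℕ) : (cfg st fi E q p b v b' false m).kind = .reject := by
  simp [cfg, PATM.Cfg.kind, machine]

theorem machine_cfg_ext {c c' : (machine st fi E).Cfg} (h1 : c.pub = c'.pub)
    (h2 : c.priv = c'.priv) (h3 : c.inHead = c'.inHead) : c = c' := by
  cases c
  cases c'
  simp only at h1 h2 h3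
  subst h1 h2 h3
  congr 1
  · exact funext fun t => Empty.elim t
  · exact funext fun t => Empty.elim t

theorem cfg_stepE (x : List α) (q : Q) (p : Option (Op α V)) (b : Bool) (v : Option V)
    (b' ok : Bool) (m : ℕ) (e : Q × Option (Op α V) × Q) :
    (cfg st fi E q p b v b' ok m).stepE x e = open Classical in
      if e.1 = q ∧ e ∈ E then cfg st fi E e.2.2 e.2.1 (!b) v b' ok m
      else cfg st fi E q none (!b) v b' ok m := by
  by_cases h : e.1 = q ∧ e ∈ E
  · rw [if_pos h]
    exact machine_cfg_ext (if_pos h) rfl rfl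
  · rw [if_neg h]
    exact machine_cfg_ext (if_neg h) rfl rfl

theorem cfg_stepD (x : List α) (q : Q) (p : Option (Op α V)) (b : Bool) (v : Option V)
    (b' ok : Bool) (m : ℕ) :
    (cfg st fi E q p b v b' ok m).stepD x = cfg st fi E q p b v b
      (check v (inputSym x m) p).1 ((check v (inputSym x m) p).2.moveInput x.length m) :=
  machine_cfg_ext rfl rfl rfl

theorem observe_stepD (x : List α) {c : (machine st fi E).Cfg} (h : List (machine st fi E).Event)
    (hc : c.kind = .deterministic) : PATM.observe h c (c.stepD x) = h :=
  PATM.observe_of_eq ((machine_isBlind x c).2 hc)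

/-- A winning strategy yields a path. -/
theorem path_of_wins {x : List α} {σ : (machine st fi E).Strategy}
    {h : List (machine st fi E).Event} {c : (machine st fi E).Cfg} (hw : PATM.Wins x σ h c) :
    ∀ q p b b' s, c = cfg st fi E q p b none b' true 0 → (∀ v, s v < x.length + 2) →
      (∀ v, PATM.Wins x σ h (cfg st fi E q p b v b' true (position s v))) →
      ∃ s' s'', (if b = b' then s' = s else
        optSem (Op.sem (fun n (_ : V) => n + 2) Set.univ) p x s s') ∧
        ReflTransGen (GraphStep E fun p => optSem (Op.sem (fun n (_ : V) => n + 2) Set.univ) p x)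
          (q, s') (fi, s'') := by
  classical
  induction hw with
  | @accept h c hk =>
    rintro q p b b' s rfl hs hall
    rw [cfg_kind] at hk
    split_ifs at hk with h1 h2
    subst h2
    simp only [ne_eq, not_not] at h1
    exact ⟨s, s, by simp [h1], .refl⟩
  | @existential h c hk hw ih =>
    rintro q p b b' s rfl hs hall
    have hk' : ∀ v m, (cfg st fi E q p b v b' true m).kind = .existential := fun v m => by
      rw [cfg_kind] at hk ⊢; exact hk
    have h1 : b = b' := by
      rw [cfg_kind] at hk
      by_contra h1
      simp [h1] at hk
    subst h1
    have hall' := fun v => (hall v).existential_inv (hk' v _)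
    by_cases he : (σ h).1 = q ∧ σ h ∈ E
    · have hst : ∀ v m, (cfg st fi E q p b v b true m).stepE x (σ h) = _ := fun v m =>
        (cfg_stepE x q p b v b true m (σ h)).trans (if_pos he)
      rw [hst] at ih
      replace hall' := fun v => hst v _ ▸ hall' v
      obtain ⟨s', s'', h2, h3⟩ := ih _ _ _ _ s rfl hs hall'
      rw [if_neg (by simp)] at h2
      refine ⟨s, s'', by simp, h3.head ⟨(σ h).2.1, ?_, h2⟩⟩
      rw [← he.1]
      exact he.2
    · have hst : ∀ v m, (cfg st fi E q p b v b true m).stepE x (σ h) = _ := fun v m =>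
        (cfg_stepE x q p b v b true m (σ h)).trans (if_neg he)
      rw [hst] at ih
      replace hall' := fun v => hst v _ ▸ hall' v
      obtain ⟨s', s'', h2, h3⟩ := ih _ _ _ _ s rfl hs hall'
      rw [if_neg (by simp)] at h2
      have h2 : s' = s := h2
      subst h2
      exact ⟨s', s'', by simp, h3⟩
  | @universal h c hk hw ih =>
    rintro q p b b' s rfl hs hall
    rw [cfg_kind] at hk
    split_ifs at hk
  | @deterministic h c hk hw ih =>
    rintro q p b b' s rfl hs hall
    have hk' : ∀ v m, (cfg st fi E q p b v b' true m).kind = .deterministic := fun v m => by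
      rw [cfg_kind] at hk ⊢; exact hk
    have h1 : b ≠ b' := by
      rw [cfg_kind] at hk
      by_contra h1
      subst h1
      simp at hk
      split_ifs at hk
    have hall' : ∀ v, PATM.Wins x σ h (cfg st fi E q p b v b
        (check v (inputSym x (position s v)) p).1
        ((check v (inputSym x (position s v)) p).2.moveInput x.length (position s v))) := by
      intro v
      have := (hall v).deterministic_inv (hk' v _)
      rwa [observe_stepD x _ (hk' _ _), cfg_stepD] at this
    rw [observe_stepD x _ hk, cfg_stepD] at ih
    have hok : ∀ v, (check v (inputSym x (position s v)) p).1 = true := by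
      intro v
      by_contra hc
      rw [Bool.not_eq_true] at hc
      have := hall' v
      rw [hc] at this
      exact this.kind_ne_reject (cfg_kind_reject _ _ _ _ _ _)
    simp only [hok] at hall'
    let s₁ : V → ℕ := fun v => (check (some v) (inputSym x (s v)) p).2.moveInput x.length (s v)
    have hpos : ∀ v, position s₁ v =
        (check v (inputSym x (position s v)) p).2.moveInput x.length (position s v) := by
      rintro (_ | v)
      · rcases p with _ | w | w | ⟨w, A⟩ <;> rfl
      · rfl
    have hsem := (optSem_iff_check (s' := s₁) hs p).2 fun v => ⟨hok v, hpos v⟩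
    obtain ⟨s', s'', h2, h3⟩ := ih q p b b s₁ (by
        have h4 := hok none
        have h5 := hpos none
        simp only [position] at h4 h5
        rw [h4, ← h5]) (sem_lt hs hsem) (fun v => by rw [hpos]; exact hall' v)
    rw [if_pos rfl] at h2
    exact ⟨s₁, s'', by rwa [if_neg h1], h2 ▸ h3⟩

/-- A path yields a winning strategy. -/
theorem wins_of_path {x : List α} {q : Q} {s s' : V → ℕ} (h : ReflTransGen
      (GraphStep E fun p => optSem (Op.sem (fun n (_ : V) => n + 2) Set.univ) p x)
      (q, s) (fi, s')) (hs : ∀ v, s v < x.length + 2) (n : ℕ) :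
    ∃ σ : (machine st fi E).Strategy, ∀ h : List (machine st fi E).Event, h.length = n →
      ∀ p b v, PATM.Wins x σ h (cfg st fi E q p b v b true (position s v)) := by
  classical
  have key : ∀ c : Q × (V → ℕ), ReflTransGen
      (GraphStep E fun p => optSem (Op.sem (fun n (_ : V) => n + 2) Set.univ) p x) c (fi, s') →
      (∀ v, c.2 v < x.length + 2) → ∀ n,
      ∃ σ : (machine st fi E).Strategy, ∀ h : List (machine st fi E).Event, h.length = n →
      ∀ p b v, PATM.Wins x σ h (cfg st fi E c.1 p b v b true (position c.2 v)) := by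
    clear h hs n
    intro c hc
    induction hc using ReflTransGen.head_induction_on with
    | refl =>
      refine fun _ n => ⟨fun _ => (q, none, q), fun h _ p b v => .accept ?_⟩
      rw [cfg_kind]; simp
    | @head c d hs _ ih =>
      intro hb n
      obtain ⟨p', he, hs⟩ := hs
      obtain ⟨σ, hσ⟩ := ih (sem_lt hb hs) (n + 1)
      obtain ⟨e, hee⟩ : ∃ e : (machine st fi E).EChoice, e = (c.1, p', d.1) := ⟨_, rfl⟩
      refine ⟨fun h => if h.length = n then e else σ h, fun h hn p b v => ?_⟩
      by_cases hfi : c.1 = fi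
      · refine .accept ?_
        rw [cfg_kind]; simp [hfi]
      refine .existential (by rw [cfg_kind]; simp [hfi]) ?_
      have hst : (cfg st fi E c.1 p b v b true (position c.2 v)).stepE x e =
          cfg st fi E d.1 p' (!b) v b true (position c.2 v) := by
        rw [hee]
        exact (cfg_stepE x c.1 p b v b true _ (c.1, p', d.1)).trans (if_pos ⟨rfl, he⟩)
      rw [if_pos hn, hst]
      have hk : (cfg st fi E d.1 p' (!b) v b true (position c.2 v)).kind = .deterministic := by
        rw [cfg_kind]; simp
      refine .deterministic hk ?_
      rw [observe_stepD x _ hk, cfg_stepD]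
      obtain ⟨h1, h2⟩ := (optSem_iff_check hb p').1 hs v
      rw [h1, ← h2]
      refine PATM.Wins.congr (n := n + 1) (fun h' hh' => ?_) (hσ _ (by simp [hn]) _ _ _)
        (by simp [hn])
      rw [if_neg (by omega)]
  exact key _ h hs n

theorem machine_accepts_iff (x : List α) : (machine st fi E).Accepts x ↔ ∃ s', ReflTransGen
      (GraphStep E fun p => optSem (Op.sem (fun n (_ : V) => n + 2) Set.univ) p x)
      (st, fun _ => 0) (fi, s') := by
  have hk : (machine st fi E).startCfg.kind = .universal := by
    simp [PATM.startCfg, PATM.Cfg.kind, machine]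
  have ho : ∀ u, PATM.observe [] (machine st fi E).startCfg
      ((machine st fi E).startCfg.stepU x u) = [] := fun u =>
    PATM.observe_of_eq ((machine_isBlind x _).1 hk u)
  have hstep : ∀ u, (machine st fi E).startCfg.stepU x u =
      cfg st fi E st none false u false true (position (fun _ => 0) u) := fun u =>
    machine_cfg_ext rfl rfl (by cases u <;> rfl)
  constructor
  · rintro ⟨σ, hσ⟩
    have hall : ∀ u : (machine st fi E).UChoice, PATM.Wins x σ [] (cfg st fi E st none false u false true
        (position (fun _ => 0) u)) := fun u => by
      have := hσ.universal_inv hk u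
      rwa [ho, hstep] at this
    obtain ⟨s', s'', h1, h2⟩ := path_of_wins (hall none) st none false false (fun _ => 0) rfl
      (by simp) hall
    rw [if_pos rfl] at h1
    subst h1
    exact ⟨s'', h2⟩
  · rintro ⟨s', h⟩
    obtain ⟨σ, hσ⟩ := wins_of_path (st := st) h (by simp) 0
    refine ⟨σ, .universal hk fun u => ?_⟩
    rw [ho, hstep]
    exact hσ [] rfl _ _ _

end Blind

theorem counterNL_subset_baspaceConst (α : Type) [Finite α] (s : ℕ → ℕ) :
    CounterNL α ⊆ BASPACEConst α s := by
  rintro L ⟨V, hV, R, ⟨Q, hQ, st, fi, E, hE⟩, hL⟩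
  refine ⟨Blind.machine st fi E, Blind.machine_isBlind, Blind.machine_spaceBounded s,
    ⟨1, Blind.machine_universalMovesAtMost⟩, fun x => ?_⟩
  rw [hL, Blind.machine_accepts_iff]
  simp only [hE]

end PrivAlt

namespace PrivAlt

/-! ### Counter programs on ordinary machines with logarithmic space -/

namespace Binary

/-- Work tape symbols: blank, a marker for cell `0`, and bits. -/
abbrev Cell : Type := Option (Option Bool)

/-- The value of a cell as a binary digit. -/
def bitVal : Cell → ℕ
  | some (some true) => 1
  | _ => 0

/-- The number written in cells `1, …, W`, least significant digit first. -/
def binVal (W : ℕ) (c : ℕ → Cell) : ℕ := ∑ i ∈ Finset.range W, bitVal (c (i + 1)) * 2 ^ i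

/-- The digits occupy the cells `1, …, len`. -/
def Shape (W : ℕ) (c : ℕ → Cell) (len : ℕ) : Prop :=
  c 0 = some none ∧ (∀ i, c (i + 1) ≠ some none) ∧ len ≤ W ∧ ∀ i, c (i + 1) = none ↔ len ≤ i

def Enc (W : ℕ) (c : ℕ → Cell) (a : ℕ) : Prop := (∃ len, Shape W c len) ∧ binVal W c = a

theorem bitVal_le (y : Cell) : bitVal y ≤ 1 := by
  rcases y with _ | _ | _ | _ <;> simp [bitVal]

theorem binVal_update {W j : ℕ} (hj : j < W) (c : ℕ → Cell) (y : Cell) :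
    binVal W (Function.update c (j + 1) y) + bitVal (c (j + 1)) * 2 ^ j =
      binVal W c + bitVal y * 2 ^ j := by
  have hj' : j ∈ Finset.range W := Finset.mem_range.2 hj
  simp only [binVal]
  rw [← Finset.add_sum_erase _ _ hj', ← Finset.add_sum_erase _ (fun i => bitVal (c (i + 1)) * _) hj']
  have : ∑ i ∈ (Finset.range W).erase j, bitVal (Function.update c (j + 1) y (i + 1)) * 2 ^ i =
      ∑ i ∈ (Finset.range W).erase j, bitVal (c (i + 1)) * 2 ^ i := by
    refine Finset.sum_congr rfl fun i hi => ?_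
    rw [Function.update_of_ne]
    have := Finset.ne_of_mem_erase hi
    omega
  rw [this]
  simp only [Function.update_self]
  ring

theorem binVal_lt {W len : ℕ} {c : ℕ → Cell} (h : ∀ i, len ≤ i → bitVal (c (i + 1)) = 0) :
    binVal W c < 2 ^ len := by
  suffices binVal W c < 2 ^ min W len from
    this.trans_le (Nat.pow_le_pow_right (by norm_num) (min_le_right _ _))
  induction W with
  | zero => simp [binVal]
  | succ W ih =>
    have e : binVal (W + 1) c = binVal W c + bitVal (c (W + 1)) * 2 ^ W :=
      Finset.sum_range_succ _ _
    rw [e]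
    by_cases hW : W < len
    · rw [min_eq_left (by omega)] at ih
      rw [min_eq_left (by omega), pow_succ]
      have := bitVal_le (c (W + 1))
      nlinarith [Nat.pow_pos (n := W) (show 0 < 2 by norm_num)]
    · rw [min_eq_right (by omega)] at ih
      rw [min_eq_right (by omega), h W (by omega)]
      omega

theorem Shape.bitVal_eq_zero {W len : ℕ} {c : ℕ → Cell} (h : Shape W c len) {i : ℕ}
    (hi : len ≤ i) : bitVal (c (i + 1)) = 0 := by
  rw [(h.2.2.2 i).2 hi]; rfl

theorem bit_le_binVal {W j : ℕ} (hj : j < W) (c : ℕ → Cell) :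
    bitVal (c (j + 1)) * 2 ^ j ≤ binVal W c :=
  Finset.single_le_sum (f := fun i => bitVal (c (i + 1)) * 2 ^ i) (fun _ _ => Nat.zero_le _)
    (Finset.mem_range.2 hj)

theorem Shape.update_bit {W len j : ℕ} {c : ℕ → Cell} (h : Shape W c len) (hj : j < len)
    (b : Bool) : Shape W (Function.update c (j + 1) (some (some b))) len := by
  refine ⟨?_, fun i => ?_, h.2.2.1, fun i => ?_⟩
  · rw [Function.update_of_ne (by omega)]; exact h.1
  · by_cases hi : i = j
    · subst hi; simp
    · rw [Function.update_of_ne (by omega)]; exact h.2.1 i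
  · by_cases hi : i = j
    · subst hi; simp; omega
    · rw [Function.update_of_ne (by omega)]; exact h.2.2.2 i

theorem Shape.update_blank {W len : ℕ} {c : ℕ → Cell} (h : Shape W c len) (hj : len < W)
    (b : Bool) : Shape W (Function.update c (len + 1) (some (some b))) (len + 1) := by
  refine ⟨?_, fun i => ?_, hj, fun i => ?_⟩
  · rw [Function.update_of_ne (by omega)]; exact h.1
  · by_cases hi : i = len
    · subst hi; simp
    · rw [Function.update_of_ne (by omega)]; exact h.2.1 i
  · by_cases hi : i = len
    · subst hi; simp
    · rw [Function.update_of_ne (by omega), h.2.2.2 i]; omega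

/-- Sweeps over a binary number. -/
inductive Sweep
  | dec
  | zero
  | inc

/-- The phases of the simulation of one operation: the value of the variable is moved to the
input head (`load`), the operation is carried out by the input head (`exec`), and its position is
stored again (`save`). -/
inductive Phase
  | load
  | exec
  | save
  | go (k : Sweep)
  | ret (k : Sweep)

instance : Finite Sweep :=
  Finite.of_injective (β := Fin 3) (fun | .dec => 0 | .zero => 1 | .inc => 2)
    (by rintro (_ | _ | _) (_ | _ | _) <;> simp)

instance : Finite Phase :=
  Finite.of_injective (β := Fin 3 ⊕ Sweep ⊕ Sweep)
    (fun | .load => .inl 0 | .exec => .inl 1 | .save => .inl 2 | .go k => .inr (.inl k)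
         | .ret k => .inr (.inr k))
    (by rintro (_ | _ | _ | _ | _) (_ | _ | _ | _ | _) <;> simp)

/-- The move of a sweep on a scanned cell: the new symbol, and whether the sweep goes on. -/
def Sweep.act : Sweep → Cell → Option (Cell × Bool)
  | .dec, some (some false) => some (some (some true), true)
  | .dec, some (some true) => some (some (some false), false)
  | .zero, some (some false) => some (some (some false), true)
  | .zero, none => some (none, false)
  | .inc, some (some true) => some (some (some false), true)
  | .inc, some (some false) => some (some (some true), false)
  | .inc, none => some (some (some true), false)
  | _, _ => none

/-- The phase after a sweep, and the movement of the input head. -/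
def Sweep.after : Sweep → Phase × Dir
  | .dec => (.load, .right)
  | .zero => (.exec, .stay)
  | .inc => (.save, .stay)

/-- Moves that concern one work tape and the input head; the phase `none` means that the
operation is finished. -/
inductive LocalMove {α : Type} (ok : InSym α → Bool × Dir) (a : InSym α) (y : Cell) :
    Phase → Option Phase → Dir → Cell × Dir → Prop
  | loadDec : LocalMove ok a y .load (some (.go .dec)) .stay (y, .right)
  | loadZero : LocalMove ok a y .load (some (.go .zero)) .stay (y, .right)
  | exec : (ok a).1 = true → LocalMove ok a y .exec (some .save) (ok a).2 (y, .stay)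
  | saveDone : a = .leftEnd → LocalMove ok a y .save none .stay (y, .stay)
  | saveInc : a ≠ .leftEnd → LocalMove ok a y .save (some (.go .inc)) .left (y, .right)
  | goOn {k : Sweep} {z : Cell} : k.act y = some (z, true) →
      LocalMove ok a y (.go k) (some (.go k)) .stay (z, .right)
  | goStop {k : Sweep} {z : Cell} : k.act y = some (z, false) →
      LocalMove ok a y (.go k) (some (.ret k)) .stay (z, .left)
  | retOn {k : Sweep} : y ≠ some none →
      LocalMove ok a y (.ret k) (some (.ret k)) .stay (y, .left)
  | retStop {k : Sweep} : y = some none →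
      LocalMove ok a y (.ret k) (some k.after.1) k.after.2 (y, .stay)

/-- The invariant of a sweep that started with value `a` and has reached digit `j`. -/
def GoInv (W : ℕ) (c : ℕ → Cell) (a j : ℕ) : Sweep → Prop
  | .dec => binVal W c + 1 = a + 2 ^ j
  | .zero => binVal W c = a ∧ ∀ i < j, bitVal (c (i + 1)) = 0
  | .inc => binVal W c + 2 ^ j = a + 1

/-- The sum of the number on the tape, the head position `u`, and a correction for a sweep in
progress is the value `P` of the variable. -/
def PhaseInv (W : ℕ) (T : WorkTape Cell) (u P : ℕ) : Phase → Prop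
  | .load => T.head = 0 ∧ ∃ a, Enc W T.cells a ∧ a + u = P
  | .exec => T.head = 0 ∧ Enc W T.cells 0 ∧ u = P
  | .save => T.head = 0 ∧ ∃ a, Enc W T.cells a ∧ a + u = P
  | .go k => ∃ j a len, T.head = j + 1 ∧ Shape W T.cells len ∧ j ≤ len ∧ GoInv W T.cells a j k ∧
      (match k with | .inc => a + 1 + u = P | _ => a + u = P)
  | .ret k => T.head ≤ W ∧ ∃ a, Enc W T.cells a ∧
      (match k with | .dec => a + 1 + u = P | .zero => a = 0 ∧ u = P | .inc => a + u = P)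

theorem PhaseInv.within {W : ℕ} {T : WorkTape Cell} {u P : ℕ} {ph : Phase}
    (h : PhaseInv W T u P ph) : T.head < W + 2 := by
  cases ph with
  | load => rw [h.1]; omega
  | exec => rw [h.1]; omega
  | save => rw [h.1]; omega
  | go k =>
    obtain ⟨j, a, len, h1, h2, h3, -⟩ := h
    have := h2.2.2.1
    omega
  | ret k => have := h.1; omega

theorem act_read_stay {A : Type} (T : WorkTape A) : T.act (T.read, .stay) = T := by
  simp [WorkTape.act, WorkTape.read, Dir.moveWork]

theorem act_read {A : Type} (T : WorkTape A) (d : Dir) :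
    T.act (T.read, d) = ⟨T.cells, d.moveWork T.head⟩ := by
  simp [WorkTape.act, WorkTape.read]

section Local

variable {α : Type} {ok : InSym α → Bool × Dir} {x : List α} {W : ℕ}
  {T : WorkTape Cell} {u P : ℕ}

theorem go_start {c : ℕ → Cell} {a : ℕ} (h : Enc W c a) (k : Sweep) :
    ∃ len, Shape W c len ∧ GoInv W c a 0 k := by
  obtain ⟨⟨len, hs⟩, hv⟩ := h
  refine ⟨len, hs, ?_⟩
  cases k <;> simp [GoInv, hv]

/-- Local moves other than `exec` preserve the invariant. -/
theorem PhaseInv.step {ph : Phase} (h : PhaseInv W T u P ph) (hP : P ≤ x.length + 1)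
    (hW : x.length + 1 < 2 ^ W) {ph' : Option Phase} {d : Dir} {w : Cell × Dir}
    (hm : LocalMove ok (inputSym x u) T.read ph ph' d w) (hne : ph ≠ .exec) :
    match ph' with
    | some ph' => PhaseInv W (T.act w) (d.moveInput x.length u) P ph'
    | none => (T.act w).head = 0 ∧ Enc W (T.act w).cells P ∧ d.moveInput x.length u = 0 := by
  cases hm with
  | loadDec =>
    obtain ⟨h1, a, h2, h3⟩ := h
    obtain ⟨len, h4, h5⟩ := go_start h2 .dec
    exact ⟨0, a, len, by simp [act_read, Dir.moveWork, h1], by rwa [act_read], Nat.zero_le _,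
      by rwa [act_read], h3⟩
  | loadZero =>
    obtain ⟨h1, a, h2, h3⟩ := h
    obtain ⟨len, h4, h5⟩ := go_start h2 .zero
    exact ⟨0, a, len, by simp [act_read, Dir.moveWork, h1], by rwa [act_read], Nat.zero_le _,
      by rwa [act_read], h3⟩
  | exec => exact absurd rfl hne
  | saveDone h0 =>
    obtain ⟨h1, a, h2, h3⟩ := h
    rw [inputSym_eq_leftEnd] at h0
    subst h0
    rw [act_read_stay]
    exact ⟨h1, by simpa [← h3] using h2, rfl⟩
  | saveInc h0 =>
    obtain ⟨h1, a, h2, h3⟩ := h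
    rw [Ne, inputSym_eq_leftEnd] at h0
    obtain ⟨len, h4, h5⟩ := go_start h2 .inc
    exact ⟨0, a, len, by simp [act_read, Dir.moveWork, h1], by rwa [act_read], Nat.zero_le _,
      by rwa [act_read], by simp only [Dir.moveInput]; omega⟩
  | @goOn k z hz =>
    obtain ⟨j, a, len, h1, h2, h3, h4, h5⟩ := h
    have hr : T.read = T.cells (j + 1) := by rw [WorkTape.read, h1]
    rw [hr] at hz
    have hj : j < len := by
      by_contra hc
      rw [(h2.2.2.2 j).2 (by omega)] at hz
      cases k <;> simp [Sweep.act] at hz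
    have hjW : j < W := hj.trans_le h2.2.2.1
    have hu := binVal_update hjW T.cells z
    have e : (T.act (z, .right)) = ⟨Function.update T.cells (j + 1) z, j + 2⟩ := by
      simp [WorkTape.act, h1, Dir.moveWork]
    rw [e]
    refine ⟨j + 1, a, len, rfl, ?_, hj, ?_, h5⟩
    · cases k <;> rcases hy : T.cells (j + 1) with _ | _ | _ | _ <;> rw [hy] at hz <;>
        simp [Sweep.act] at hz <;> subst hz <;> exact h2.update_bit hj _
    · cases k <;> rcases hy : T.cells (j + 1) with _ | _ | _ | _ <;> rw [hy] at hz hu <;>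
        simp [Sweep.act] at hz <;> subst hz <;> simp only [GoInv, bitVal] at h4 hu ⊢
      · rw [pow_succ]; omega
      · refine ⟨by omega, fun i hi => ?_⟩
        by_cases hij : i = j
        · subst hij; simp
        · rw [Function.update_of_ne (by omega)]; exact h4.2 i (by omega)
      · rw [pow_succ]; omega
  | @goStop k z hz =>
    obtain ⟨j, a, len, h1, h2, h3, h4, h5⟩ := h
    have hr : T.read = T.cells (j + 1) := by rw [WorkTape.read, h1]
    rw [hr] at hz
    have e : (T.act (z, .left)) = ⟨Function.update T.cells (j + 1) z, j⟩ := by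
      simp [WorkTape.act, h1, Dir.moveWork]
    rw [e]
    refine ⟨h3.trans h2.2.2.1, ?_⟩
    have hbit : ∀ b, T.cells (j + 1) = some (some b) → j < len := fun b hb => by
      by_contra hc
      rw [(h2.2.2.2 j).2 (by omega)] at hb
      simp at hb
    have hjlen : T.cells (j + 1) = none → j = len := fun hb => by
      have := (h2.2.2.2 j).1 hb
      omega
    cases k <;> rcases hy : T.cells (j + 1) with _ | _ | _ | _ <;> rw [hy] at hz <;>
        simp [Sweep.act] at hz <;> subst hz
    · have hj := hbit _ hy
      have hu := binVal_update (hj.trans_le h2.2.2.1) T.cells (some (some false))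
      rw [hy] at hu
      simp only [GoInv, bitVal] at h4 hu h5
      refine ⟨_, ⟨⟨len, h2.update_bit hj _⟩, rfl⟩, ?_⟩
      simp only [Dir.moveInput]
      omega
    · have hj := hjlen hy
      have e2 : Function.update T.cells (j + 1) none = T.cells := by rw [← hy]; simp
      rw [e2]
      simp only [GoInv] at h4
      have h0 : binVal W T.cells < 2 ^ 0 := binVal_lt fun i _ => by
        by_cases hi : i < j
        · exact h4.2 i hi
        · exact h2.bitVal_eq_zero (by omega)
      simp only at h5
      have h6 := h4.1
      have h7 : binVal W T.cells = 0 := by omega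
      exact ⟨0, ⟨⟨len, h2⟩, h7⟩, rfl, by simp only [Dir.moveInput]; omega⟩
    · have hj := hjlen hy
      subst hj
      simp only [GoInv] at h4 h5
      have hlt : j < W := by
        by_contra hc
        have : 2 ^ W ≤ 2 ^ j := Nat.pow_le_pow_right (by norm_num) (by omega)
        omega
      have hu := binVal_update hlt T.cells (some (some true))
      rw [hy] at hu
      simp only [bitVal] at hu
      refine ⟨_, ⟨⟨_, h2.update_blank hlt _⟩, rfl⟩, ?_⟩
      simp only [Dir.moveInput]
      omega
    · have hj := hbit _ hy
      have hu := binVal_update (hj.trans_le h2.2.2.1) T.cells (some (some true))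
      rw [hy] at hu
      simp only [GoInv, bitVal] at h4 hu h5
      refine ⟨_, ⟨⟨len, h2.update_bit hj _⟩, rfl⟩, ?_⟩
      simp only [Dir.moveInput]
      omega
  | @retOn k h0 =>
    obtain ⟨h1, a, h2, h3⟩ := h
    rw [act_read]
    exact ⟨(Nat.sub_le _ _).trans h1, a, h2, h3⟩
  | @retStop k h0 =>
    obtain ⟨h1, a, h2, h3⟩ := h
    rw [act_read_stay]
    have hh : T.head = 0 := by
      by_contra hc
      obtain ⟨i, hi⟩ := Nat.exists_eq_succ_of_ne_zero hc
      obtain ⟨⟨len, hs⟩, -⟩ := h2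
      rw [WorkTape.read, hi] at h0
      exact hs.2.1 i h0
    cases k with
    | dec => exact ⟨hh, a, h2, by simp only [Sweep.after, Dir.moveInput] at h3 ⊢; omega⟩
    | zero =>
      obtain ⟨rfl, h3⟩ := h3
      exact ⟨hh, h2, h3⟩
    | inc => exact ⟨hh, a, h2, h3⟩

/-- A step of the part of the machine that concerns one operation. -/
def LocalStep (ok : InSym α → Bool × Dir) (x : List α) (s s' : Phase × WorkTape Cell × ℕ) : Prop :=
  ∃ d w, LocalMove ok (inputSym x s.2.2) s.2.1.read s.1 (some s'.1) d w ∧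
    s'.2 = (s.2.1.act w, d.moveInput x.length s.2.2)

theorem PhaseInv.localStep {s s' : Phase × WorkTape Cell × ℕ} (h : PhaseInv W s.2.1 s.2.2 P s.1)
    (hP : P ≤ x.length + 1) (hW : x.length + 1 < 2 ^ W) (hs : LocalStep ok x s s')
    (hne : s.1 ≠ .exec) : PhaseInv W s'.2.1 s'.2.2 P s'.1 := by
  obtain ⟨d, w, hm, he⟩ := hs
  have := h.step hP hW hm hne
  simp only at this
  rwa [he]

theorem exists_ret (k : Sweep) (h : PhaseInv W T u P (.ret k)) (hP : P ≤ x.length + 1)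
    (hW : x.length + 1 < 2 ^ W) :
    ∃ s', ReflTransGen (LocalStep ok x) (.ret k, T, u) s' ∧ s'.1 = k.after.1 ∧
      s'.2.2 = k.after.2.moveInput x.length u ∧ PhaseInv W s'.2.1 s'.2.2 P s'.1 := by
  generalize hm : T.head = m
  induction m generalizing T with
  | zero =>
    have hr : T.read = some none := by
      obtain ⟨-, a, ⟨⟨len, hs⟩, -⟩, -⟩ := h
      rw [WorkTape.read, hm, hs.1]
    have hstep : LocalStep ok x (.ret k, T, u)
        (k.after.1, T.act (T.read, .stay), k.after.2.moveInput x.length u) :=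
      ⟨_, _, .retStop hr, rfl⟩
    exact ⟨_, .single hstep, rfl, rfl, PhaseInv.localStep h hP hW hstep (by simp)⟩
  | succ m ih =>
    have hr : T.read ≠ some none := by
      obtain ⟨-, a, ⟨⟨len, hs⟩, -⟩, -⟩ := h
      rw [WorkTape.read, hm]
      exact hs.2.1 m
    have hstep : LocalStep ok x (.ret k, T, u) (.ret k, T.act (T.read, .left), u) :=
      ⟨_, _, .retOn hr, rfl⟩
    have h' := PhaseInv.localStep h hP hW hstep (by simp)
    obtain ⟨s', h1, h2⟩ := ih h' (by simp [act_read, Dir.moveWork, hm])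
    exact ⟨s', h1.head hstep, h2⟩

/-- The condition under which a sweep succeeds. -/
def Sweep.Ready (u P : ℕ) : Sweep → Prop
  | .dec => u < P
  | .zero => u = P
  | .inc => True

theorem exists_go (k : Sweep) (h : PhaseInv W T u P (.go k)) (hP : P ≤ x.length + 1)
    (hW : x.length + 1 < 2 ^ W) (hk : k.Ready u P) :
    ∃ s', ReflTransGen (LocalStep ok x) (.go k, T, u) s' ∧ s'.1 = k.after.1 ∧
      s'.2.2 = k.after.2.moveInput x.length u ∧ PhaseInv W s'.2.1 s'.2.2 P s'.1 := by
  generalize hm : W + 1 - T.head = m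
  induction m generalizing T with
  | zero =>
    have hst : ∃ z, k.act T.read = some (z, false) := by
      obtain ⟨j, a, len, h1, h2, h3, h4, h5⟩ := h
      have hjlen : len ≤ j := by have := h2.2.2.1; omega
      have hr : T.read = none := by rw [WorkTape.read, h1, (h2.2.2.2 j).2 hjlen]
      rw [hr]
      cases k with
      | dec =>
        have := binVal_lt (W := W) fun i hi => h2.bitVal_eq_zero (i := i) hi
        have h6 : 2 ^ len ≤ 2 ^ j := Nat.pow_le_pow_right (by norm_num) hjlen
        simp only [GoInv, Sweep.Ready] at h4 h5 hk
        omega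
      | zero => exact ⟨_, rfl⟩
      | inc => exact ⟨_, rfl⟩
    obtain ⟨z, hz⟩ := hst
    have hstep : LocalStep ok x (.go k, T, u) (.ret k, T.act (z, .left), u) :=
      ⟨_, _, .goStop hz, rfl⟩
    have h' := PhaseInv.localStep h hP hW hstep (by simp)
    obtain ⟨s', h1, h2⟩ := exists_ret (ok := ok) k h' hP hW
    exact ⟨s', h1.head hstep, h2⟩
  | succ m ih =>
    have hst : ∃ z b, k.act T.read = some (z, b) := by
      obtain ⟨j, a, len, h1, h2, h3, h4, h5⟩ := h
      have hr : T.read = T.cells (j + 1) := by rw [WorkTape.read, h1]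
      have hne := h2.2.1 j
      rw [hr]
      rcases hy : T.cells (j + 1) with _ | _ | _ | _
      · have hjlen := (h2.2.2.2 j).1 hy
        cases k with
        | dec =>
          have := binVal_lt (W := W) fun i hi => h2.bitVal_eq_zero (i := i) hi
          have h6 : 2 ^ len ≤ 2 ^ j := Nat.pow_le_pow_right (by norm_num) hjlen
          simp only [GoInv, Sweep.Ready] at h4 h5 hk
          omega
        | zero => exact ⟨_, _, rfl⟩
        | inc => exact ⟨_, _, rfl⟩
      · exact absurd hy hne
      · cases k <;> exact ⟨_, _, rfl⟩
      · cases k with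
        | dec => exact ⟨_, _, rfl⟩
        | zero =>
          have hj : j < W := by
            by_contra hc
            have := (h2.2.2.2 j).2 (by have := h2.2.2.1; omega)
            rw [hy] at this
            simp at this
          have := bit_le_binVal hj T.cells
          rw [hy] at this
          simp only [GoInv, bitVal, Sweep.Ready] at h4 h5 hk this
          have := Nat.pow_pos (n := j) (show 0 < 2 by norm_num)
          omega
        | inc => exact ⟨_, _, rfl⟩
    obtain ⟨z, b, hz⟩ := hst
    cases b
    · have hstep : LocalStep ok x (.go k, T, u) (.ret k, T.act (z, .left), u) :=
        ⟨_, _, .goStop hz, rfl⟩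
      have h' := PhaseInv.localStep h hP hW hstep (by simp)
      obtain ⟨s', h1, h2⟩ := exists_ret (ok := ok) k h' hP hW
      exact ⟨s', h1.head hstep, h2⟩
    · have hstep : LocalStep ok x (.go k, T, u) (.go k, T.act (z, .right), u) :=
        ⟨_, _, .goOn hz, rfl⟩
      have h' := PhaseInv.localStep h hP hW hstep (by simp)
      have hd : W + 1 - (T.act (z, .right)).head = m := by
        simp only [WorkTape.act, Dir.moveWork]; omega
      obtain ⟨s', h1, h2⟩ := ih h' hd
      exact ⟨s', h1.head hstep, h2⟩

theorem exists_load (h : PhaseInv W T u P .load) (hP : P ≤ x.length + 1)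
    (hW : x.length + 1 < 2 ^ W) :
    ∃ s', ReflTransGen (LocalStep ok x) (.load, T, u) s' ∧ s'.1 = .exec ∧
      PhaseInv W s'.2.1 s'.2.2 P .exec := by
  generalize hm : P - u = m
  induction m generalizing T u with
  | zero =>
    have hu : u = P := by obtain ⟨-, a, -, h⟩ := h; omega
    have hstep : LocalStep ok x (.load, T, u) (.go .zero, T.act (T.read, .right), u) :=
      ⟨_, _, .loadZero, rfl⟩
    have h' := PhaseInv.localStep h hP hW hstep (by simp)
    obtain ⟨s', h1, h2, h3, h4⟩ := exists_go (ok := ok) .zero h' hP hW hu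
    exact ⟨s', h1.head hstep, h2, by rw [h2] at h4; exact h4⟩
  | succ m ih =>
    have hstep : LocalStep ok x (.load, T, u) (.go .dec, T.act (T.read, .right), u) :=
      ⟨_, _, .loadDec, rfl⟩
    have h' := PhaseInv.localStep h hP hW hstep (by simp)
    obtain ⟨⟨ph, T', u'⟩, h1, h2, h3, h4⟩ := exists_go (ok := ok) .dec h' hP hW
      (show u < P by omega)
    simp only [Sweep.after, Dir.moveInput] at h2 h3 h4
    subst h2 h3
    obtain ⟨s', h5, h6⟩ := ih h4 (by omega)
    exact ⟨s', (h1.head hstep).trans h5, h6⟩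

theorem exists_save (h : PhaseInv W T u P .save) (hP : P ≤ x.length + 1)
    (hW : x.length + 1 < 2 ^ W) :
    ∃ s', ReflTransGen (LocalStep ok x) (.save, T, u) s' ∧ s'.1 = .save ∧ s'.2.2 = 0 ∧
      PhaseInv W s'.2.1 s'.2.2 P .save := by
  induction u generalizing T with
  | zero => exact ⟨_, .refl, rfl, rfl, h⟩
  | succ u ih =>
    have hstep : LocalStep ok x (.save, T, u + 1) (.go .inc, T.act (T.read, .right), u) :=
      ⟨_, _, .saveInc (by simp [inputSym_eq_leftEnd]), rfl⟩
    have h' := PhaseInv.localStep h hP hW hstep (by simp)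
    obtain ⟨⟨ph, T', u'⟩, h1, h2, h3, h4⟩ := exists_go (ok := ok) .inc h' hP hW trivial
    simp only [Sweep.after, Dir.moveInput] at h2 h3 h4
    subst h2 h3
    obtain ⟨s', h5, h6⟩ := ih h4
    exact ⟨s', (h1.head hstep).trans h5, h6⟩

end Local

end Binary

end PrivAlt

namespace PrivAlt

/-- The variable of an operation. -/
def Op.var {α V : Type} : Op α V → V
  | .inc v => v
  | .dec v => v
  | .test v _ => v

namespace Binary

variable {α V Q : Type}

/-- The check of an operation at the position of its variable. -/
noncomputable def opCheck (o : Op α V) (a : InSym α) : Bool × Dir :=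
  Blind.check (some o.var) a (some o)

theorem sem_iff_opCheck {x : List α} {s s' : V → ℕ} (hs : ∀ v, s v < x.length + 2)
    (o : Op α V) : Op.sem (fun n (_ : V) => n + 2) Set.univ o x s s' ↔
      (opCheck o (inputSym x (s o.var))).1 = true ∧ s' = upd s o.var
        ((opCheck o (inputSym x (s o.var))).2.moveInput x.length (s o.var)) := by
  have := Blind.optSem_iff_check (s' := s') hs (some o)
  simp only [optSem] at this
  rw [this]
  have hne : ∀ (v : Option V) a, v ≠ some o.var → Blind.check v a (some o) = (true, .stay) := by
    intro v a hv
    cases o <;> exact if_neg hv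
  constructor
  · intro h
    refine ⟨(h (some o.var)).1, funext fun v => ?_⟩
    by_cases hv : v = o.var
    · subst hv; rw [upd_self]; exact (h (some _)).2
    · rw [upd_of_ne _ _ hv]
      have := (h (some v)).2
      rw [hne _ _ (by simpa using hv)] at this
      exact this
  · rintro ⟨h1, rfl⟩ v
    by_cases hv : v = some o.var
    · subst hv
      exact ⟨h1, by simp only [Blind.position, upd_self]; rfl⟩
    · rw [hne _ _ hv]
      refine ⟨rfl, ?_⟩
      rcases v with _ | v
      · rfl
      · simp only [Blind.position, Dir.moveInput]
        rw [upd_of_ne]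
        rintro rfl
        exact hv rfl

/-- Control states: the initial one, the nodes of the graph, and the phases of an operation. -/
abbrev Control (α V Q : Type) : Type := Option (Q ⊕ Phase × Op α V × Q)

/-- The control state at the beginning of an operation leading to node `q`. -/
def enter (q : Q) : Option (Op α V) → Control α V Q
  | none => some (.inl q)
  | some o => some (.inr (.load, o, q))

/-- The control state during an operation leading to node `q`. -/
def during (o : Op α V) (q : Q) : Option Phase → Control α V Q
  | none => some (.inl q)
  | some ph => some (.inr (ph, o, q))

open Classical in
/-- The moves of the simulating machine. -/
def moves (st : Q) (E : Set (Q × Option (Op α V) × Q)) :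
    Control α V Q → InSym α → (V → Cell) → Set (Control α V Q × Dir × (V → Cell × Dir))
  | none, _, _ => {(some (.inl st), .stay, fun _ => (some none, .stay))}
  | some (.inl q), _, r => {b | ∃ p q', (q, p, q') ∈ E ∧
      b = (enter q' p, .stay, fun v => (r v, .stay))}
  | some (.inr (ph, o, q)), a, r => {b | ∃ ph' d w, LocalMove (opCheck o) a (r o.var) ph ph' d w ∧
      b = (during o q ph', d, fun v => if v = o.var then w else (r v, .stay))}

/-- Has the operation of the current edge been carried out? -/
def Phase.Post : Phase → Prop
  | .save => True
  | .go .inc => True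
  | .ret .inc => True
  | _ => False

/-- The tape holds the number `a` and its head is in cell `0`. -/
def Holds (W : ℕ) (T : WorkTape Cell) (a : ℕ) : Prop := T.head = 0 ∧ Enc W T.cells a

/-- The part of the graph configurations reachable on input `x`. -/
def Reach (st : Q) (E : Set (Q × Option (Op α V) × Q)) (x : List α) (q : Q) (s : V → ℕ) : Prop :=
  ReflTransGen (GraphStep E fun p => optSem (Op.sem (fun n (_ : V) => n + 2) Set.univ) p x)
    (st, fun _ => 0) (q, s)

theorem Reach.lt {st : Q} {E : Set (Q × Option (Op α V) × Q)} {x : List α} {q : Q} {s : V → ℕ}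
    (h : Reach st E x q s) (v : V) : s v < x.length + 2 := by
  have key : ∀ c, ReflTransGen (GraphStep E fun p =>
      optSem (Op.sem (fun n (_ : V) => n + 2) Set.univ) p x) (st, fun _ => 0) c →
      ∀ v, c.2 v < x.length + 2 := by
    intro c hc
    induction hc with
    | refl => simp
    | tail _ hs ih =>
      obtain ⟨p, -, hs⟩ := hs
      exact Blind.sem_lt ih hs
  exact key _ h v

/-- Number of digits needed on inputs of length `n`. -/
def width (n : ℕ) : ℕ := Nat.log 2 (n + 1) + 1

theorem lt_two_pow_width (n : ℕ) : n + 1 < 2 ^ width n :=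
  Nat.lt_pow_succ_log_self (by norm_num) _

variable {st fi : Q} {E : Set (Q × Option (Op α V) × Q)} {x : List α}

/-- Configurations: control state, position of the input head, and work tapes. -/
abbrev Conf (α V Q : Type) : Type := Control α V Q × ℕ × (V → WorkTape Cell)

/-- The steps of the simulating machine. -/
def ConfStep (st : Q) (E : Set (Q × Option (Op α V) × Q)) (x : List α) (c c' : Conf α V Q) : Prop :=
  ∃ a ∈ moves st E c.1 (inputSym x c.2.1) (fun t => (c.2.2 t).read),
    c' = (a.1, a.2.1.moveInput x.length c.2.1, fun t => (c.2.2 t).act (a.2.2 t))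

/-- The initial configuration. -/
def conf₀ (α V Q : Type) : Conf α V Q := (none, 0, fun _ => WorkTape.empty none)

/-- The part of the invariant that depends on the control state. -/
def ControlInv (st : Q) (E : Set (Q × Option (Op α V) × Q)) (x : List α) (u : ℕ)
    (tp : V → WorkTape Cell) : Control α V Q → Prop
  | none => u = 0 ∧ tp = fun _ => WorkTape.empty none
  | some (.inl q) => u = 0 ∧ ∃ s, Reach st E x q s ∧ ∀ v, Holds (width x.length) (tp v) (s v)
  | some (.inr (ph, o, q)) => ∃ s,
      ((ph.Post ∧ Reach st E x q s) ∨ (¬ ph.Post ∧ ∃ q₀, Reach st E x q₀ s ∧ (q₀, some o, q) ∈ E)) ∧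
      (∀ v, v ≠ o.var → Holds (width x.length) (tp v) (s v)) ∧
      PhaseInv (width x.length) (tp o.var) u (s o.var) ph

theorem holds_zero_start (W : ℕ) :
    Holds W ((WorkTape.empty none).act (some none, .stay)) 0 := by
  refine ⟨rfl, ⟨0, ?_, ?_, Nat.zero_le _, ?_⟩, ?_⟩
  · simp [WorkTape.act, WorkTape.empty]
  · simp [WorkTape.act, WorkTape.empty]
  · simp [WorkTape.act, WorkTape.empty]
  · simp [binVal, WorkTape.act, WorkTape.empty, bitVal]

theorem controlInv_step {c c' : Conf α V Q}
    (h : ControlInv st E x c.2.1 c.2.2 c.1) (hs : ConfStep st E x c c') :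
    ControlInv st E x c'.2.1 c'.2.2 c'.1 := by
  classical
  obtain ⟨q, u, tp⟩ := c
  obtain ⟨a, ha, rfl⟩ := hs
  dsimp only at h ha ⊢
  rcases q with _ | q | ⟨ph, o, q⟩
  · obtain rfl : a = _ := ha
    obtain ⟨rfl, rfl⟩ := h
    exact ⟨rfl, fun _ => 0, .refl, fun v => holds_zero_start _⟩
  · obtain ⟨p, q', hE, rfl⟩ := ha
    obtain ⟨rfl, s, hr, hh⟩ := h
    have htp : (fun t => (tp t).act ((tp t).read, .stay)) = tp :=
      funext fun t => act_read_stay _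
    dsimp only
    rw [htp]
    cases p with
    | none => exact ⟨rfl, s, hr.tail ⟨none, hE, rfl⟩, hh⟩
    | some o =>
      exact ⟨s, Or.inr ⟨id, q, hr, hE⟩, fun v _ => hh v, (hh o.var).1, s o.var, (hh o.var).2, rfl⟩
  · obtain ⟨ph', d, w, hm, rfl⟩ := ha
    obtain ⟨s, hb, hh, hp⟩ := h
    have hfr : ∀ s' : V → ℕ, (∀ v, v ≠ o.var → s' v = s v) → ∀ v, v ≠ o.var →
        Holds (width x.length) ((tp v).act
          (if v = o.var then w else ((tp v).read, .stay))) (s' v) := by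
      intro s' hs' v hv
      rw [if_neg hv, act_read_stay, hs' v hv]
      exact hh v hv
    dsimp only
    by_cases hne : ph = .exec
    · subst hne
      cases hm with
      | exec hok =>
        obtain ⟨q₀, hr, hE⟩ := (hb.resolve_left fun h => h.1).2
        obtain ⟨h1, h2, h3⟩ := hp
        have hsem : Op.sem (fun n (_ : V) => n + 2) Set.univ o x s (upd s o.var
            ((opCheck o (inputSym x (s o.var))).2.moveInput x.length (s o.var))) :=
          (sem_iff_opCheck hr.lt o).2 ⟨by rw [← h3]; exact hok, rfl⟩
        refine ⟨upd s o.var ((opCheck o (inputSym x (s o.var))).2.moveInput x.length (s o.var)),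
          Or.inl ⟨trivial, hr.tail ⟨some o, hE, hsem⟩⟩,
          hfr _ fun v hv => upd_of_ne _ _ hv, ?_⟩
        beta_reduce
        rw [if_pos rfl, upd_self, act_read_stay, h3]
        exact ⟨h1, 0, h2, by simp⟩
    · have hP : s o.var ≤ x.length + 1 := by
        rcases hb with ⟨-, hr⟩ | ⟨-, q₀, hr, -⟩ <;> have := hr.lt o.var <;> omega
      have hst := hp.step hP (lt_two_pow_width _) hm hne
      cases ph' with
      | none =>
        obtain ⟨h1, h2, h3⟩ := hst
        have hr : Reach st E x q s := by
          cases hm with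
          | saveDone _ => exact (hb.resolve_right fun h => h.1 trivial).2
        refine ⟨h3, s, hr, fun v => ?_⟩
        by_cases hv : v = o.var
        · subst hv; beta_reduce; rw [if_pos rfl]; exact ⟨h1, h2⟩
        · exact hfr s (fun _ _ => rfl) v hv
      | some ph' =>
        refine ⟨s, ?_, hfr s fun _ _ => rfl, by beta_reduce; rw [if_pos rfl]; exact hst⟩
        have : ph'.Post ↔ ph.Post := by
          cases hm with
          | exec _ => exact absurd rfl hne
          | @retStop k _ => cases k <;> rfl
          | @goStop k _ _ => cases k <;> rfl
          | _ => rfl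
        rw [this]
        exact hb

theorem controlInv_of_reachable {c : Conf α V Q}
    (h : ReflTransGen (ConfStep st E x) (conf₀ α V Q) c) :
    ControlInv st E x c.2.1 c.2.2 c.1 := by
  induction h with
  | refl => exact ⟨rfl, rfl⟩
  | tail _ hs ih => exact controlInv_step ih hs

/-- The configuration during an operation. -/
noncomputable def opConf (o : Op α V) (q : Q) (tp : V → WorkTape Cell)
    (s : Phase × WorkTape Cell × ℕ) : Conf α V Q :=
  (some (.inr (s.1, o, q)), s.2.2, open Classical in Function.update tp o.var s.2.1)

theorem step_opConf {o : Op α V} {q : Q} {tp : V → WorkTape Cell}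
    {s s' : Phase × WorkTape Cell × ℕ} (h : LocalStep (opCheck o) x s s') :
    ConfStep st E x (opConf o q tp s) (opConf o q tp s') := by
  classical
  obtain ⟨d, w, hm, he⟩ := h
  refine ⟨(during o q (some s'.1), d, fun v => if v = o.var then w else
    ((Function.update tp o.var s.2.1 v).read, .stay)), ⟨some s'.1, d, w, ?_, ?_⟩, ?_⟩
  · simpa [opConf] using hm
  · rfl
  · simp only [opConf, during, he]
    congr 2
    funext v
    by_cases hv : v = o.var
    · subst hv; simp
    · simp [hv, act_read_stay]

theorem exists_conf_of_reach {q : Q} {s : V → ℕ} (h : Reach st E x q s) :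
    ∃ tp : V → WorkTape Cell, ReflTransGen (ConfStep st E x) (conf₀ α V Q) (some (.inl q), 0, tp) ∧
      ∀ v, Holds (width x.length) (tp v) (s v) := by
  classical
  have key : ∀ c, ReflTransGen (GraphStep E fun p =>
      optSem (Op.sem (fun n (_ : V) => n + 2) Set.univ) p x) (st, fun _ => 0) c →
      ∃ tp : V → WorkTape Cell, ReflTransGen (ConfStep st E x) (conf₀ α V Q) (some (.inl c.1), 0, tp) ∧
      ∀ v, Holds (width x.length) (tp v) (c.2 v) := by
    intro c hc
    induction hc with
    | refl =>
      exact ⟨_, .single ⟨_, rfl, rfl⟩, fun v => holds_zero_start _⟩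
    | @tail c c' hr hs ih =>
      obtain ⟨tp, h1, h2⟩ := ih
      obtain ⟨p, hE, hs⟩ := hs
      have hr : Reach st E x c.1 c.2 := hr
      have hr' : Reach st E x c'.1 c'.2 := hr.tail ⟨p, hE, hs⟩
      have hW := lt_two_pow_width x.length
      have htp : (fun t => (tp t).act ((tp t).read, .stay)) = tp :=
        funext fun t => act_read_stay _
      have h3 : ConfStep st E x (some (.inl c.1), 0, tp) (enter c'.1 p, 0, tp) :=
        ⟨_, ⟨p, c'.1, hE, rfl⟩, by dsimp only; rw [htp]; rfl⟩
      cases p with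
      | none =>
        have hs : c'.2 = c.2 := hs
        exact ⟨tp, h1.tail h3, by rw [hs]; exact h2⟩
      | some o =>
        have hsem := (sem_iff_opCheck hr.lt o).1 hs
        have e0 : ((enter c'.1 (some o), 0, tp) : Conf α V Q) =
            opConf o c'.1 tp (.load, tp o.var, 0) := by
          simp [opConf, enter]
        rw [e0] at h3
        obtain ⟨⟨ph, T, u⟩, h4, h5, h6⟩ := exists_load (ok := opCheck o) (x := x) (T := tp o.var)
          (u := 0) (P := c.2 o.var)
          ⟨(h2 o.var).1, _, (h2 o.var).2, rfl⟩ (by have := hr.lt o.var; omega) hW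
        dsimp only at h5 h6
        subst h5
        obtain ⟨h7, h8, rfl⟩ := h6
        have h9 : LocalStep (opCheck o) x (.exec, T, c.2 o.var) (.save, T, c'.2 o.var) :=
          ⟨_, _, .exec hsem.1, by rw [act_read_stay, hsem.2, upd_self]⟩
        obtain ⟨⟨ph, T', u'⟩, h10, h11, h12, h13, a, h14, h15⟩ := exists_save (ok := opCheck o)
          (x := x) (T := T) (u := c'.2 o.var) (P := c'.2 o.var) ⟨h7, 0, h8, by simp⟩
          (by have := hr'.lt o.var; omega) hW
        dsimp only at h11 h12 h13 h14 h15
        subst h11 h12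
        have hpath := (h4.tail h9).trans h10
        have hpath' := ReflTransGen.lift (p := ConfStep st E x) (opConf o c'.1 tp)
          (fun s s' => step_opConf) _ _ hpath
        refine ⟨Function.update tp o.var T', ((h1.tail h3).trans hpath').tail
          ⟨(during o c'.1 none, .stay, fun v => if v = o.var then (T'.read, .stay) else
            ((Function.update tp o.var T' v).read, .stay)),
            ⟨none, .stay, (T'.read, .stay), ?_, rfl⟩, ?_⟩, fun v => ?_⟩
        · simpa [opConf] using LocalMove.saveDone (ok := opCheck o) (y := T'.read)
            (inputSym_eq_leftEnd (x := x).2 rfl)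
        · simp only [opConf, during, Dir.moveInput]
          congr 2
          funext v
          by_cases hv : v = o.var
          · subst hv; simp [act_read_stay]
          · simp [hv, act_read_stay]
        · by_cases hv : v = o.var
          · subst hv
            simp only [Function.update_self]
            exact ⟨h13, by simpa [← h15] using h14⟩
          · rw [Function.update_of_ne hv, hsem.2, upd_of_ne _ _ hv]
            exact h2 v
  exact key _ h

variable [Finite α] [Finite V] [Finite Q]

/-- A machine that stores the variables in binary on its work tapes. -/
def machine (st fi : Q) (E : Set (Q × Option (Op α V) × Q)) :
    NTM α where
  State := Control α V Q
  Sym := Cell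
  Tape := V
  blank := none
  start := none
  accept := some (.inl fi)
  next := moves st E

theorem conf_of_reachable {c : (machine st fi E).Cfg} (h : (machine st fi E).Reachable x c) :
    ReflTransGen (ConfStep st E x) (conf₀ α V Q) (c.state, c.inHead, c.tapes) := by
  refine ReflTransGen.lift (fun c : (machine st fi E).Cfg => (c.state, c.inHead, c.tapes)) ?_ _ _ h
  rintro c c' ⟨a, ha, rfl⟩
  exact ⟨a, ha, rfl⟩

theorem reachable_of_conf {c : Conf α V Q} (h : ReflTransGen (ConfStep st E x) (conf₀ α V Q) c) :
    (machine st fi E).Reachable x ⟨c.1, c.2.1, c.2.2⟩ := by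
  refine ReflTransGen.lift (fun c : Conf α V Q => (⟨c.1, c.2.1, c.2.2⟩ : (machine st fi E).Cfg))
    ?_ _ _ h
  rintro c c' ⟨a, ha, rfl⟩
  exact ⟨a, ha, rfl⟩

theorem machine_spaceBounded :
    (machine st fi E).SpaceBounded fun n => width n + 2 := by
  intro x c hc t
  have h := controlInv_of_reachable (conf_of_reachable hc)
  obtain ⟨q, u, tp⟩ := c
  dsimp only at h ⊢
  suffices (tp t).head < width x.length + 2 from lt_of_lt_of_le this (le_max_right _ _)
  rcases q with _ | q | ⟨ph, o, q⟩
  · obtain ⟨rfl, rfl⟩ := h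
    simp [WorkTape.empty]
  · obtain ⟨rfl, s, hr, hh⟩ := h
    rw [(hh t).1]; omega
  · obtain ⟨s, -, hh, hp⟩ := h
    by_cases ht : t = o.var
    · subst ht; exact hp.within
    · rw [(hh t ht).1]; omega

theorem machine_accepts_iff : (machine st fi E).Accepts x ↔ ∃ s, Reach st E x fi s := by
  constructor
  · rintro ⟨⟨q, u, tp⟩, hc, rfl⟩
    obtain ⟨-, s, hs, -⟩ := controlInv_of_reachable (conf_of_reachable hc)
    exact ⟨s, hs⟩
  · rintro ⟨s, hs⟩
    obtain ⟨tp, h, -⟩ := exists_conf_of_reach hs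
    exact ⟨_, reachable_of_conf h, rfl⟩

end Binary

theorem isLogBound_width : IsLogBound fun n => Binary.width n + 2 := by
  refine Asymptotics.IsBigO.of_bound (2 / Real.log 2 + 3) ?_
  filter_upwards [Filter.eventually_ge_atTop 3] with n hn
  have hn' : (3 : ℝ) ≤ n := by exact_mod_cast hn
  have h2 : 0 < Real.log 2 := Real.log_pos (by norm_num)
  have h3 : 1 ≤ Real.log n := by
    rw [Real.le_log_iff_exp_le (by linarith)]
    exact (Real.exp_one_lt_d9.le.trans (by norm_num)).trans hn'
  have h4 : (Nat.log 2 (n + 1) : ℝ) * Real.log 2 ≤ Real.log (n + 1) := by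
    rw [← Real.log_pow]
    apply Real.log_le_log (by positivity)
    exact_mod_cast Nat.pow_log_le_self 2 (by omega)
  have h5 : Real.log (n + 1) ≤ 2 * Real.log n := by
    rw [← Nat.cast_ofNat, ← Real.log_pow]
    apply Real.log_le_log (by positivity)
    nlinarith
  have h6 : (Nat.log 2 (n + 1) : ℝ) ≤ 2 / Real.log 2 * Real.log n := by
    rw [div_mul_eq_mul_div, le_div_iff₀ h2]
    linarith
  rw [Real.norm_of_nonneg (by positivity), Real.norm_of_nonneg (by linarith)]
  simp only [Binary.width]
  push_cast
  linarith

theorem counterNL_subset_nl (α : Type) [Finite α] : CounterNL α ⊆ NL α := by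
  rintro L ⟨V, hV, R, ⟨Q, hQ, st, fi, E, hE⟩, hL⟩
  refine ⟨_, isLogBound_width, Binary.machine st fi E, Binary.machine_spaceBounded, fun x => ?_⟩
  rw [hL, Binary.machine_accepts_iff]
  simp only [hE, Binary.Reach]

end PrivAlt

namespace PrivAlt

/-! ### Plays with fixed universal choices -/

namespace PATM

attribute [instance] finPub finPriv finSym finPubTape finPrivTape finEChoice finUChoice
  neEChoice neUChoice

variable {α : Type} {M : PATM α} {x : List α} {r : ℕ}

/-- The play in which the existential player follows `σ` and the `k`-th universal choice is `w k`
is accepting: it reaches an accepting state after `n` moves. -/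
inductive Along (x : List α) (σ : M.Strategy) (w : Fin (r + 1) → M.UChoice) :
    ℕ → Fin (r + 1) → List M.Event → M.Cfg → Prop
  | accept {k : Fin (r + 1)} {h : List M.Event} {c : M.Cfg} : c.kind = .accept → Along x σ w 0 k h c
  | existential {n : ℕ} {k : Fin (r + 1)} {h : List M.Event} {c : M.Cfg} : c.kind = .existential →
      Along x σ w n k (h ++ [Sum.inl (σ h)]) (c.stepE x (σ h)) → Along x σ w (n + 1) k h c
  | universal {n : ℕ} {k k' : Fin (r + 1)} {h : List M.Event} {c : M.Cfg} : c.kind = .universal →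
      k'.val = k.val + 1 → Along x σ w n k' (observe h c (c.stepU x (w k))) (c.stepU x (w k)) →
      Along x σ w (n + 1) k h c
  | deterministic {n : ℕ} {k : Fin (r + 1)} {h : List M.Event} {c : M.Cfg} :
      c.kind = .deterministic → Along x σ w n k (observe h c (c.stepD x)) (c.stepD x) →
      Along x σ w (n + 1) k h c

variable {σ σ' : M.Strategy} {w : Fin (r + 1) → M.UChoice} {n : ℕ} {k : Fin (r + 1)}
  {h : List M.Event} {c : M.Cfg}

theorem Along.congr {m : ℕ} (hσ : ∀ h' : List M.Event, m ≤ h'.length → σ h' = σ' h')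
    (ha : Along x σ w n k h c) (hm : m ≤ h.length) : Along x σ' w n k h c := by
  induction ha with
  | accept hk => exact .accept hk
  | existential hk _ ih =>
    refine .existential hk ?_
    rw [← hσ _ hm]
    exact ih (by simp; omega)
  | universal hk hk' _ ih => exact .universal hk hk' (ih (hm.trans (length_le_observe _)))
  | deterministic hk _ ih => exact .deterministic hk (ih (hm.trans (length_le_observe _)))

theorem Along.kind_ne_reject (ha : Along x σ w n k h c) : c.kind ≠ .reject := by
  cases ha <;> simp_all

theorem Along.existential_inv (hk : c.kind = .existential) (ha : Along x σ w n k h c) :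
    ∃ m, n = m + 1 ∧ Along x σ w m k (h ++ [Sum.inl (σ h)]) (c.stepE x (σ h)) := by
  cases ha with
  | existential _ ha => exact ⟨_, rfl, ha⟩
  | _ => simp_all

theorem Along.universal_inv (hk : c.kind = .universal) (ha : Along x σ w n k h c) :
    ∃ m k', n = m + 1 ∧ k'.val = k.val + 1 ∧
      Along x σ w m k' (observe h c (c.stepU x (w k))) (c.stepU x (w k)) := by
  cases ha with
  | universal _ hk' ha => exact ⟨_, _, rfl, hk', ha⟩
  | _ => simp_all

theorem Along.deterministic_inv (hk : c.kind = .deterministic) (ha : Along x σ w n k h c) :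
    ∃ m, n = m + 1 ∧ Along x σ w m k (observe h c (c.stepD x)) (c.stepD x) := by
  cases ha with
  | deterministic _ ha => exact ⟨_, rfl, ha⟩
  | _ => simp_all

theorem Wins.exists_along (hr : M.UniversalMovesAtMost r) (hw : Wins x σ h c)
    (w : Fin (r + 1) → M.UChoice) (hc : M.ReachesWith x k c) : ∃ n, Along x σ w n k h c := by
  induction hw generalizing k with
  | accept hk => exact ⟨0, .accept hk⟩
  | existential hk _ ih =>
    obtain ⟨n, hn⟩ := ih (.existential _ hc hk)
    exact ⟨_, .existential hk hn⟩
  | universal hk _ ih =>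
    have hc' := ReachesWith.universal (w k) hc hk
    have := hr _ _ _ hc'
    obtain ⟨n, hn⟩ := ih (w k) (k := ⟨k + 1, by omega⟩) hc'
    exact ⟨_, .universal hk rfl hn⟩
  | deterministic hk _ ih =>
    obtain ⟨n, hn⟩ := ih (.deterministic hc hk)
    exact ⟨_, .deterministic hk hn⟩

/-- If all plays with fixed universal choices are accepting, then the strategy is winning. -/
theorem wins_of_along {N : ℕ} (w₀ : Fin (r + 1) → M.UChoice)
    (H : ∀ w : Fin (r + 1) → M.UChoice, (∀ i < k, w i = w₀ i) → ∃ n ≤ N, Along x σ w n k h c) :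
    Wins x σ h c := by
  induction N generalizing k h c w₀ with
  | zero =>
    obtain ⟨n, hn, ha⟩ := H w₀ fun _ _ => rfl
    cases ha with
    | accept hk => exact .accept hk
    | _ => omega
  | succ N ih =>
    rcases hk : c.kind
    · refine .existential hk (ih (k := k) w₀ fun w hw => ?_)
      obtain ⟨n, hn, ha⟩ := H w hw
      obtain ⟨m, rfl, ha'⟩ := ha.existential_inv hk
      exact ⟨m, by omega, ha'⟩
    · refine .universal hk fun u => ?_
      obtain ⟨n, hn, ha⟩ := H w₀ fun _ _ => rfl
      obtain ⟨-, k', -, hk', -⟩ := ha.universal_inv hk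
      refine ih (k := k') (Function.update w₀ k u) fun w hw => ?_
      obtain ⟨n, hn, ha⟩ := H w fun i hi => by
        rw [hw i (by rw [Fin.lt_def] at hi ⊢; omega), Function.update_of_ne hi.ne]
      obtain ⟨m, k'', rfl, hk'', ha⟩ := ha.universal_inv hk
      obtain rfl : k'' = k' := Fin.ext (by omega)
      rw [hw k (by rw [Fin.lt_def]; omega), Function.update_self] at ha
      exact ⟨m, by omega, ha⟩
    · refine .deterministic hk (ih (k := k) w₀ fun w hw => ?_)
      obtain ⟨n, hn, ha⟩ := H w hw
      obtain ⟨m, rfl, ha'⟩ := ha.deterministic_inv hk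
      exact ⟨m, by omega, ha'⟩
    · exact .accept hk
    · obtain ⟨n, hn, ha⟩ := H w₀ fun _ _ => rfl
      exact absurd hk ha.kind_ne_reject

/-! ### Comparing changes of the public part -/

/-- The effective movement of the input head. -/
def effIn : InSym α → Dir → Dir
  | .leftEnd, .left => .stay
  | .rightEnd, .right => .stay
  | _, d => d

/-- The effective movement of a work head, given whether it is in cell `0`. -/
def effWork : Bool → Dir → Dir
  | true, .left => .stay
  | _, d => d

theorem moveInput_eq_iff {p : ℕ} (hp : p < x.length + 2) (d d' : Dir) :
    d.moveInput x.length p = d'.moveInput x.length p ↔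
      effIn (inputSym x p) d = effIn (inputSym x p) d' := by
  have h1 := inputSym_eq_leftEnd (x := x) (p := p)
  have h2 := inputSym_eq_rightEnd (x := x) (p := p)
  generalize inputSym x p = i at h1 h2 ⊢
  rcases i with _ | _ | _ <;>
    simp only [reduceCtorEq, true_iff, false_iff] at h1 h2 <;> cases d <;> cases d' <;>
    simp only [effIn, Dir.moveInput, reduceCtorEq, iff_true, iff_false] <;> omega

theorem moveWork_eq_iff (p : ℕ) (d d' : Dir) :
    d.moveWork p = d'.moveWork p ↔ effWork (decide (p = 0)) d = effWork (decide (p = 0)) d' := by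
  rcases p with _ | p <;> cases d <;> cases d' <;> simp [effWork, Dir.moveWork] <;> omega

theorem _root_.PrivAlt.WorkTape.act_eq_iff {A : Type} (T : WorkTape A) (a a' : A × Dir) :
    T.act a = T.act a' ↔ (a.1, effWork (decide (T.head = 0)) a.2) =
      (a'.1, effWork (decide (T.head = 0)) a'.2) := by
  rw [Prod.mk.injEq, ← moveWork_eq_iff]
  simp only [WorkTape.act, WorkTape.mk.injEq]
  rw [(Function.update_injective T.cells T.head).eq_iff]

variable (M) in
/-- Actions on the whole memory. -/
abbrev Action : Type :=
  M.Pub × M.Priv × Dir × (M.PubTape → M.Sym × Dir) × (M.PrivTape → M.Sym × Dir)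

variable (M) in
/-- Descriptions of changes of the public part. -/
abbrev Sig : Type := M.Pub × Dir × (M.PubTape → M.Sym × Dir)

/-- The change of the public part made by an action. -/
def sig (i : InSym α) (z : M.PubTape → Bool) (a : M.Action) : M.Sig :=
  (a.1, if M.headPrivate then .stay else effIn i a.2.2.1,
    fun t => ((a.2.2.2.1 t).1, effWork (z t) (a.2.2.2.1 t).2))

def Cfg.sig (x : List α) (c : M.Cfg) (a : M.Action) : M.Sig :=
  PATM.sig (inputSym x c.inHead) (fun t => decide ((c.pubTapes t).head = 0)) a

/-- The action without effect. -/
def Cfg.idle (c : M.Cfg) : M.Action :=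
  (c.pub, c.priv, .stay, fun t => ((c.pubTapes t).read, .stay),
    fun t => ((c.privTapes t).read, .stay))

theorem Cfg.act_idle (c : M.Cfg) : c.act x c.idle = c := by
  simp only [Cfg.act, Cfg.idle, Binary.act_read_stay, Dir.moveInput]

theorem Cfg.view_act_eq_iff {c c' : M.Cfg} (hv : c.view = c'.view) (hc : c.inHead < x.length + 2)
    (a a' : M.Action) : (c.act x a).view = (c'.act x a').view ↔ c.sig x a = c'.sig x a' := by
  simp only [Cfg.view, View.mk.injEq] at hv
  obtain ⟨-, h1, h2⟩ := hv
  simp only [Cfg.view, View.mk.injEq, Cfg.act, Cfg.sig, PATM.sig, Prod.mk.injEq, h2]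
  have h3 : ((fun t => (c'.pubTapes t).act (a.2.2.2.1 t)) =
      fun t => (c'.pubTapes t).act (a'.2.2.2.1 t)) ↔
      ((fun t => ((a.2.2.2.1 t).1, effWork (decide ((c'.pubTapes t).head = 0)) (a.2.2.2.1 t).2)) =
      fun t => ((a'.2.2.2.1 t).1, effWork (decide ((c'.pubTapes t).head = 0)) (a'.2.2.2.1 t).2)) := by
    simp only [funext_iff, WorkTape.act_eq_iff]
  rw [h3]
  cases hp : M.headPrivate
  · simp only [hp, Bool.false_eq_true, if_false, Option.some.injEq] at h1 ⊢
    rw [← h1, moveInput_eq_iff hc]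
  · simp

theorem Cfg.view_act_eq_self_iff {c : M.Cfg} (hc : c.inHead < x.length + 2) (a : M.Action) :
    (c.act x a).view = c.view ↔ c.sig x a = c.sig x c.idle := by
  rw [← view_act_eq_iff rfl hc, act_idle]

theorem ReachesWith.inHead_lt {j : ℕ} (hc : M.ReachesWith x j c) : c.inHead < x.length + 2 := by
  induction hc with
  | start => simp [startCfg]
  | existential e _ _ ih =>
    simp only [Cfg.stepE]
    split
    · exact ih
    · exact MTM.moveInput_lt ih _
  | universal u _ _ ih => exact MTM.moveInput_lt ih _
  | deterministic _ _ ih => exact MTM.moveInput_lt ih _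

/-- The effect of an existential choice on the visible part. -/
def View.stepE (x : List α) (v : M.View) (e : M.EChoice) : M.View :=
  let a := M.nextE v.pub (v.inHead.map (inputSym x)) (fun t => (v.pubTapes t).read) e
  ⟨a.1, v.inHead.map (a.2.1.moveInput x.length), fun t => (v.pubTapes t).act (a.2.2 t)⟩

theorem Cfg.view_stepE (c : M.Cfg) (e : M.EChoice) :
    (c.stepE x e).view = c.view.stepE x e := by
  simp only [Cfg.view, Cfg.stepE, View.stepE]
  cases hp : M.headPrivate <;> simp

end PATM

end PrivAlt

namespace PrivAlt

/-! ### Simulation of all branches of a private alternating machine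

All plays with fixed universal choices are followed in parallel. A branch whose visible part has
changed waits until every other branch has changed, too, or is about to make an existential move.
Branches with equal histories have to make equal existential choices. -/

namespace PATM

variable {α : Type} (M : PATM α) (r : ℕ)

/-- The universal choices that determine a branch. -/
abbrev Choices : Type := Fin (r + 1) → M.UChoice

/-- The control state of a branch: the number of universal moves made so far, and a change of the
public part for which it is waiting. -/
abbrev BranchState : Type := M.Pub × M.Priv × Fin (r + 1) × Option M.Sig

/-- What a branch reads. -/
abbrev BranchRead : Type :=
  InSym α × (M.PubTape → M.Sym × Bool) × (M.PrivTape → M.Sym × Bool)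

abbrev BranchAction : Type :=
  M.BranchState r × Dir × (M.PubTape → M.Sym × Dir) × (M.PrivTape → M.Sym × Dir)

/-- A configuration of a branch. -/
structure Branch where
  cfg : M.Cfg
  cnt : Fin (r + 1)
  pend : Option M.Sig

variable {M r}

def Branch.state (b : M.Branch r) : M.BranchState r := (b.cfg.pub, b.cfg.priv, b.cnt, b.pend)

def Branch.read (x : List α) (b : M.Branch r) : M.BranchRead :=
  (inputSym x b.cfg.inHead,
    fun t => ((b.cfg.pubTapes t).read, decide ((b.cfg.pubTapes t).head = 0)),
    fun t => ((b.cfg.privTapes t).read, decide ((b.cfg.privTapes t).head = 0)))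

def Branch.apply (x : List α) (b : M.Branch r) (a : M.BranchAction r) : M.Branch r :=
  ⟨b.cfg.act x (a.1.1, a.1.2.1, a.2), a.1.2.2.1, a.1.2.2.2⟩

/-- The action of a branch that does nothing. -/
def idleAction (s : M.BranchState r) (i : M.BranchRead) : M.BranchAction r :=
  (s, .stay, fun t => ((i.2.1 t).1, .stay), fun t => ((i.2.2 t).1, .stay))

open Classical in
/-- The action of a branch that makes the move `a` and then has made `k` universal moves. -/
noncomputable def moveAction (s : M.BranchState r) (i : M.BranchRead) (a : M.Action)
    (k : Fin (r + 1)) : M.BranchAction r :=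
  ((a.1, a.2.1, k, if sig i.1 (fun t => (i.2.1 t).2) a = sig i.1 (fun t => (i.2.1 t).2)
      (s.1, s.2.1, (idleAction s i).2) then none
    else some (sig i.1 (fun t => (i.2.1 t).2) a)), a.2.2)

/-- The moves of a single branch. -/
inductive BranchMove (w : M.Choices r) (s : M.BranchState r) (i : M.BranchRead) :
    M.BranchAction r → Prop
  | deterministic : s.2.2.2 = none → M.kind s.1 s.2.1 = .deterministic →
      BranchMove w s i (moveAction s i (M.nextD s.1 s.2.1 i.1 (fun t => (i.2.1 t).1)
        (fun t => (i.2.2 t).1)) s.2.2.1)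
  | universal {k : Fin (r + 1)} : s.2.2.2 = none → M.kind s.1 s.2.1 = .universal →
      k.val = s.2.2.1.val + 1 →
      BranchMove w s i (moveAction s i (M.nextU s.1 s.2.1 i.1 (fun t => (i.2.1 t).1)
        (fun t => (i.2.2 t).1) (w s.2.2.1)) k)

/-- The branch is ready for a joint move. -/
def Ready (s : M.BranchState r) : Prop :=
  s.2.2.2 ≠ none ∨ M.kind s.1 s.2.1 = .existential ∨ M.kind s.1 s.2.1 = .accept

open Classical in
/-- The part of a branch in a joint move. -/
noncomputable def jointAction (s : M.BranchState r) (i : M.BranchRead) (e : M.EChoice) :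
    M.BranchAction r :=
  if s.2.2.2 = none ∧ M.kind s.1 s.2.1 = .existential then
    let a := M.nextE s.1 (if M.headPrivate then none else some i.1) (fun t => (i.2.1 t).1) e
    ((a.1, s.2.1, s.2.2.1, none), if M.headPrivate then .stay else a.2.1, a.2.2,
      fun t => ((i.2.2 t).1, .stay))
  else idleAction (s.1, s.2.1, s.2.2.1, none) i

open Classical in
/-- The moves of all branches together. -/
inductive TeamMove (S : M.Choices r → M.BranchState r) (R : M.Choices r → M.Choices r → Prop)
    (i : M.Choices r → M.BranchRead) :
    (M.Choices r → M.BranchAction r) → (M.Choices r → M.Choices r → Prop) → Prop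
  | single {w : M.Choices r} {a : M.BranchAction r} : BranchMove w (S w) (i w) a →
      TeamMove S R i (Function.update (fun w => idleAction (S w) (i w)) w a) R
  | joint {e : M.Choices r → M.EChoice} : (∀ w, Ready (S w)) → (∀ w w', R w w' → e w = e w') →
      TeamMove S R i (fun w => jointAction (S w) (i w) (e w))
        fun w w' => R w w' ∧ (S w).2.2.2 = (S w').2.2.2

variable (M r) in
/-- The configurations of all branches, and the relation between branches with the same history. -/
abbrev Team : Type := (M.Choices r → M.Branch r) × (M.Choices r → M.Choices r → Prop)

variable (M r) in
def startTeam : M.Team r := (fun _ => ⟨M.startCfg, 0, none⟩, fun _ _ => True)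

def TeamStep (x : List α) (T T' : M.Team r) : Prop :=
  ∃ A, TeamMove (fun w => (T.1 w).state) T.2 (fun w => (T.1 w).read x) A T'.2 ∧
    T'.1 = fun w => (T.1 w).apply x (A w)

variable {x : List α}

theorem Branch.apply_idleAction (b : M.Branch r) :
    b.apply x (idleAction b.state (b.read x)) = b := by
  obtain ⟨c, k, p⟩ := b
  simp only [Branch.apply, idleAction, Branch.state, Branch.read, Branch.mk.injEq, and_true]
  exact c.act_idle

open Classical in
/-- The branch after the move `a`. -/
noncomputable def Branch.move (x : List α) (b : M.Branch r) (a : M.Action) (k : Fin (r + 1)) :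
    M.Branch r :=
  ⟨b.cfg.act x a, k, if (b.cfg.act x a).view = b.cfg.view then none else some (b.cfg.sig x a)⟩

theorem Branch.apply_moveAction (b : M.Branch r) (hb : b.cfg.inHead < x.length + 2)
    (a : M.Action) (k : Fin (r + 1)) :
    b.apply x (moveAction b.state (b.read x) a k) = b.move x a k := by
  have hv := Cfg.view_act_eq_self_iff hb a
  have hp : (moveAction b.state (b.read x) a k).1.2.2.2 = (b.move x a k).pend := by
    by_cases h : (b.cfg.act x a).view = b.cfg.view
    · exact (if_pos (hv.1 h)).trans (if_pos h).symm
    · exact (if_neg fun h' => h (hv.2 h')).trans (if_neg h).symm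
  rw [Branch.apply, hp]
  rfl

/-- The moves of a single branch on configurations. -/
inductive BranchStep (x : List α) (w : M.Choices r) (b : M.Branch r) : M.Branch r → Prop
  | deterministic : b.pend = none → b.cfg.kind = .deterministic →
      BranchStep x w b (b.move x (M.nextD b.cfg.pub b.cfg.priv (inputSym x b.cfg.inHead)
        (fun t => (b.cfg.pubTapes t).read) (fun t => (b.cfg.privTapes t).read)) b.cnt)
  | universal {k : Fin (r + 1)} : b.pend = none → b.cfg.kind = .universal →
      k.val = b.cnt.val + 1 →
      BranchStep x w b (b.move x (M.nextU b.cfg.pub b.cfg.priv (inputSym x b.cfg.inHead)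
        (fun t => (b.cfg.pubTapes t).read) (fun t => (b.cfg.privTapes t).read) (w b.cnt)) k)

open Classical in
/-- The effect of a joint move on a branch. -/
noncomputable def Branch.joint (x : List α) (b : M.Branch r) (e : M.EChoice) : M.Branch r :=
  ⟨if b.pend = none ∧ b.cfg.kind = .existential then b.cfg.stepE x e else b.cfg, b.cnt, none⟩

theorem Branch.apply_jointAction (b : M.Branch r) (e : M.EChoice) :
    b.apply x (jointAction b.state (b.read x) e) = b.joint x e := by
  obtain ⟨c, k, p⟩ := b
  by_cases h : p = none ∧ c.kind = .existential
  · have h' : (Branch.state ⟨c, k, p⟩).2.2.2 = none ∧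
      M.kind (Branch.state ⟨c, k, p⟩).1 (Branch.state ⟨c, k, p⟩).2.1 = .existential := h
    rw [jointAction, if_pos h', Branch.joint, if_pos h]
    simp only [Branch.apply, Cfg.stepE, Cfg.act, Branch.state, Branch.read,
      Binary.act_read_stay, Branch.mk.injEq, Cfg.mk.injEq, and_true, true_and]
    cases M.headPrivate <;> rfl
  · have h' : ¬ ((Branch.state ⟨c, k, p⟩).2.2.2 = none ∧
      M.kind (Branch.state ⟨c, k, p⟩).1 (Branch.state ⟨c, k, p⟩).2.1 = .existential) := h
    rw [jointAction, if_neg h', Branch.joint, if_neg h]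
    exact Branch.apply_idleAction ⟨c, k, none⟩

/-- Readiness for a joint move. -/
def Branch.Ready (b : M.Branch r) : Prop :=
  b.pend ≠ none ∨ b.cfg.kind = .existential ∨ b.cfg.kind = .accept

open Classical in
theorem teamStep_iff {T T' : M.Team r} (hT : ∀ w, (T.1 w).cfg.inHead < x.length + 2) :
    TeamStep x T T' ↔
      (∃ w b, BranchStep x w (T.1 w) b ∧ T' = (Function.update T.1 w b, T.2)) ∨
      ((∀ w, (T.1 w).Ready) ∧ ∃ e : M.Choices r → M.EChoice, (∀ w w', T.2 w w' → e w = e w') ∧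
        T' = (fun w => (T.1 w).joint x (e w),
          fun w w' => T.2 w w' ∧ (T.1 w).pend = (T.1 w').pend)) := by
  obtain ⟨B, R⟩ := T
  obtain ⟨B', R'⟩ := T'
  have hup : ∀ w a, (fun v => (B v).apply x (Function.update
      (fun w => idleAction (B w).state ((B w).read x)) w a v)) =
      Function.update B w ((B w).apply x a) := by
    intro w a
    funext v
    by_cases hv : v = w
    · subst hv; simp
    · simp [hv, Branch.apply_idleAction]
  constructor
  · rintro ⟨A, hA, hB⟩
    dsimp only at hA hB
    generalize hS : (fun w => (B w).state) = S at hA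
    generalize hi : (fun w => (B w).read x) = i at hA
    cases hA with
    | @single w a hm =>
      left
      subst hS hi
      refine ⟨w, (B w).apply x a, ?_, by rw [hB, hup]⟩
      cases hm with
      | deterministic h1 h2 =>
        rw [Branch.apply_moveAction _ (hT w)]
        exact .deterministic h1 h2
      | universal h1 h2 h3 =>
        rw [Branch.apply_moveAction _ (hT w)]
        exact .universal h1 h2 h3
    | @joint e h1 h2 =>
      right
      subst hS hi
      refine ⟨h1, e, h2, ?_⟩
      rw [hB]
      simp only [Branch.apply_jointAction]
      rfl
  · rintro (⟨w, b, hb, he⟩ | ⟨h1, e, h2, he⟩)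
    · obtain ⟨rfl, rfl⟩ := Prod.mk.inj he
      cases hb with
      | deterministic h1 h2 =>
        refine ⟨_, .single (.deterministic h1 h2), ?_⟩
        dsimp only
        rw [hup, Branch.apply_moveAction _ (hT w)]
        rfl
      | universal h1 h2 h3 =>
        refine ⟨_, .single (.universal h1 h2 h3), ?_⟩
        dsimp only
        rw [hup, Branch.apply_moveAction _ (hT w)]
        rfl
    · obtain ⟨rfl, rfl⟩ := Prod.mk.inj he
      refine ⟨_, .joint h1 h2, ?_⟩
      simp only [Branch.apply_jointAction]

/-! #### Histories of the branches -/

/-- The branch is reachable and has view `v`, apart from a pending change. -/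
def Branch.Inv (x : List α) (b : M.Branch r) (v : M.View) : Prop :=
  M.ReachesWith x b.cnt b.cfg ∧
    match b.pend with
    | none => b.cfg.kind ≠ .accept → b.cfg.view = v
    | some g => ∃ (c : M.Cfg) (a : M.Action), c.view = v ∧ c.inHead < x.length + 2 ∧
        b.cfg = c.act x a ∧ g = c.sig x a ∧ b.cfg.view ≠ v

/-- The history including a pending change. -/
def Branch.history (b : M.Branch r) (h : List M.Event) : List M.Event :=
  match b.pend with
  | none => h
  | some _ => h ++ [Sum.inr b.cfg.view]

/-- The invariant of the simulation with histories `h` and views `v` before pending changes. -/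
structure Team.Inv (x : List α) (m : ℕ) (T : M.Team r) (h : M.Choices r → List M.Event)
    (v : M.Choices r → M.View) : Prop where
  branch : ∀ w, (T.1 w).Inv x (v w)
  rel_iff : ∀ w w', T.2 w w' ↔ h w = h w'
  view_eq : ∀ w w', h w = h w' → v w = v w'
  length_eq : ∀ w, (h w).length = m

theorem startTeam_inv : (startTeam M r).Inv x 0 (fun _ => []) (fun _ => M.startCfg.view) :=
  ⟨fun _ => ⟨.start, fun _ => rfl⟩, by simp [startTeam], fun _ _ _ => rfl, fun _ => rfl⟩

theorem Branch.Inv.step {b b' : M.Branch r} {w : M.Choices r} {v : M.View} (hb : b.Inv x v)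
    (hs : BranchStep x w b b') : b'.Inv x v := by
  obtain ⟨c, k, p⟩ := b
  obtain ⟨h1, h2⟩ := hb
  have hlt := h1.inHead_lt
  have key : ∀ (a : M.Action) (k' : Fin (r + 1)), p = none → c.kind ≠ .accept →
      M.ReachesWith x k' (c.act x a) → (Branch.move x ⟨c, k, p⟩ a k').Inv x v := by
    rintro a k' rfl hk hr
    refine ⟨hr, ?_⟩
    have hv : c.view = v := h2 hk
    by_cases he : (c.act x a).view = c.view
    · simp only [Branch.move, if_pos he]
      exact fun _ => he.trans hv
    · simp only [Branch.move, if_neg he]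
      exact ⟨c, a, hv, hlt, rfl, rfl, fun h => he (h.trans hv.symm)⟩
  cases hs with
  | deterministic hp hk =>
    exact key _ _ hp (by rw [hk]; simp) (.deterministic h1 hk)
  | @universal k' hp hk hk' =>
    refine key _ _ hp (by rw [hk]; simp) ?_
    rw [hk']
    exact .universal _ h1 hk

theorem Branch.history_move {c : M.Cfg} {k k' : Fin (r + 1)} {p : Option M.Sig} (a : M.Action)
    (h : List M.Event) :
    (Branch.move x ⟨c, k, p⟩ a k').history h = observe h c (c.act x a) := by
  by_cases he : (c.act x a).view = c.view
  · rw [observe_of_eq he]; simp [Branch.history, Branch.move, he]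
  · rw [observe_of_ne he]; simp [Branch.history, Branch.move, he]

/-- The event that a joint move adds to the history of a branch. -/
def Branch.event (b : M.Branch r) (e : M.EChoice) : M.Event :=
  match b.pend with
  | none => Sum.inl e
  | some _ => Sum.inr b.cfg.view

/-- The view of a branch after a joint move. -/
def Branch.nextView (x : List α) (b : M.Branch r) (v : M.View) (e : M.EChoice) : M.View :=
  match b.pend with
  | none => v.stepE x e
  | some _ => b.cfg.view

theorem Branch.Inv.joint {b : M.Branch r} {v : M.View} (hb : b.Inv x v) (hr : b.Ready)
    (e : M.EChoice) : (b.joint x e).Inv x (b.nextView x v e) := by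
  obtain ⟨c, k, p⟩ := b
  obtain ⟨h1, h2⟩ := hb
  rcases p with _ | g
  · by_cases hk : c.kind = .existential
    · have hv : c.view = v := h2 (by rw [hk]; simp)
      simp only [Branch.joint, hk, and_self, if_true]
      exact ⟨.existential e h1 hk, fun _ => by
        rw [Cfg.view_stepE, hv]; rfl⟩
    · have hk' : c.kind = .accept := (hr.resolve_left (by simp)).resolve_left hk
      simp only [Branch.joint, hk, and_false, if_false]
      exact ⟨h1, fun h => absurd hk' h⟩
  · simp only [Branch.joint, reduceCtorEq, false_and, if_false]
    exact ⟨h1, fun _ => rfl⟩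

theorem Branch.event_eq_iff {b b' : M.Branch r} {v : M.View} (hb : b.Inv x v) (hb' : b'.Inv x v)
    (e : M.EChoice) : b.event e = b'.event e ↔ b.pend = b'.pend := by
  obtain ⟨c, k, p⟩ := b
  obtain ⟨c', k', p'⟩ := b'
  rcases p with _ | g <;> rcases p' with _ | g'
  · simp [Branch.event]
  · simp [Branch.event]
  · simp [Branch.event]
  · obtain ⟨-, c₀, a, h1, h2, h3, rfl, -⟩ := hb
    obtain ⟨-, c₀', a', h1', h2', h3', rfl, -⟩ := hb'
    dsimp only at h3 h3'
    subst h3 h3'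
    simp only [Branch.event, Sum.inr.injEq, Option.some.injEq]
    exact Cfg.view_act_eq_iff (h1.trans h1'.symm) h2 a a'

theorem Team.Inv.joint {m : ℕ} {T : M.Team r} {h : M.Choices r → List M.Event}
    {v : M.Choices r → M.View} (hT : T.Inv x m h v) (hr : ∀ w, (T.1 w).Ready)
    {e : M.Choices r → M.EChoice} (he : ∀ w w', T.2 w w' → e w = e w') :
    Team.Inv x (m + 1) (fun w => (T.1 w).joint x (e w),
          fun w w' => T.2 w w' ∧ (T.1 w).pend = (T.1 w').pend)
      (fun w => h w ++ [(T.1 w).event (e w)]) fun w => (T.1 w).nextView x (v w) (e w) := by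
  have hiff : ∀ w w', h w ++ [(T.1 w).event (e w)] = h w' ++ [(T.1 w').event (e w')] ↔
      h w = h w' ∧ (T.1 w).pend = (T.1 w').pend := by
    intro w w'
    rw [List.append_singleton_inj]
    refine and_congr_right fun hh => ?_
    rw [← he w w' ((hT.rel_iff w w').2 hh)]
    refine Branch.event_eq_iff (hT.branch w) ?_ _
    rw [hT.view_eq w w' hh]
    exact hT.branch w'
  refine ⟨fun w => (hT.branch w).joint (hr w) _, fun w w' => ?_, fun w w' hh => ?_, fun w => ?_⟩
  · dsimp only
    rw [hiff, hT.rel_iff]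
  · have h1 := List.append_singleton_inj.1 hh
    have h2 := ((hiff w w').1 hh).2
    have h3 := he w w' ((hT.rel_iff w w').2 h1.1)
    have h4 := hT.view_eq w w' h1.1
    have h5 := h1.2
    simp only [Branch.event, Branch.nextView] at h5 ⊢
    rw [h2] at h5 ⊢
    cases hp : (T.1 w').pend <;> rw [hp] at h5
    · simp only [h3, h4]
    · exact Sum.inr_injective h5
  · simp [hT.length_eq w]

theorem Team.Inv.single {m : ℕ} {T : M.Team r} {h : M.Choices r → List M.Event}
    {v : M.Choices r → M.View} (hT : T.Inv x m h v) {w : M.Choices r} {b : M.Branch r}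
    [DecidableEq (M.Choices r)] (hs : BranchStep x w (T.1 w) b) :
    Team.Inv x m (Function.update T.1 w b, T.2) h v := by
  refine ⟨fun w' => ?_, hT.rel_iff, hT.view_eq, hT.length_eq⟩
  by_cases hw : w' = w
  · subst hw
    simp only [Function.update_self]
    exact (hT.branch _).step hs
  · simp only [Function.update_of_ne hw]
    exact hT.branch w'

theorem Team.Inv.inHead_lt {m : ℕ} {T : M.Team r} {h : M.Choices r → List M.Event}
    {v : M.Choices r → M.View} (hT : T.Inv x m h v) (w : M.Choices r) :
    (T.1 w).cfg.inHead < x.length + 2 :=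
  (hT.branch w).1.inHead_lt

theorem Team.Inv.step {m : ℕ} {T T' : M.Team r} {h : M.Choices r → List M.Event}
    {v : M.Choices r → M.View} (hT : T.Inv x m h v) (hs : TeamStep x T T') :
    ∃ m' h' v', T'.Inv x m' h' v' := by
  classical
  rcases (teamStep_iff hT.inHead_lt).1 hs with ⟨w, b, hb, rfl⟩ | ⟨hr, e, he, rfl⟩
  · exact ⟨m, h, v, hT.single hb⟩
  · exact ⟨_, _, _, hT.joint hr he⟩

/-- Every branch has reached an accepting state. -/
def Team.AllAccept (T : M.Team r) : Prop := ∀ w, (T.1 w).cfg.kind = .accept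

end PATM

end PrivAlt

namespace PrivAlt

namespace PATM

variable {α : Type} {M : PATM α} {r : ℕ} {x : List α}

theorem Branch.history_of_none {b : M.Branch r} (hb : b.pend = none) (h : List M.Event) :
    b.history h = h := by
  simp [Branch.history, hb]

/-- A winning strategy guides all branches to accepting states. -/
theorem exists_allAccept {σ : M.Strategy} {m N : ℕ} {T : M.Team r}
    {h : M.Choices r → List M.Event} {v : M.Choices r → M.View} (hT : T.Inv x m h v)
    {n : M.Choices r → ℕ}
    (hn : ∀ w, Along x σ w (n w) (T.1 w).cnt ((T.1 w).history (h w)) (T.1 w).cfg)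
    (hN : ∑ᶠ w, (2 * n w + if (T.1 w).pend = none then 0 else 1) = N) :
    ∃ T', ReflTransGen (TeamStep x) T T' ∧ T'.AllAccept := by
  classical
  have := Fintype.ofFinite (M.Choices r)
  rw [finsum_eq_sum_of_fintype] at hN
  induction N using Nat.strong_induction_on generalizing m T h v n with
  | _ N ih =>
  by_cases hacc : T.AllAccept
  · exact ⟨T, .refl, hacc⟩
  by_cases hready : ∀ w, (T.1 w).Ready
  · have he : ∀ w w', T.2 w w' → σ (h w) = σ (h w') := fun w w' hR => by
      rw [(hT.rel_iff w w').1 hR]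
    have hstep := (teamStep_iff hT.inHead_lt).2 (Or.inr ⟨hready, _, he, rfl⟩)
    have key : ∀ w, ∃ n', Along x σ w n' (T.1 w).cnt (h w ++ [(T.1 w).event (σ (h w))])
        ((T.1 w).joint x (σ (h w))).cfg ∧ 2 * n' ≤ 2 * n w + (if (T.1 w).pend = none then 0 else 1) ∧
        ((T.1 w).cfg.kind ≠ .accept →
          2 * n' < 2 * n w + (if (T.1 w).pend = none then 0 else 1)) := by
      intro w
      have hw := hn w
      have hr := hready w
      generalize T.1 w = b at hw hr
      obtain ⟨c, k, p⟩ := b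
      rcases p with _ | g
      · by_cases hk : c.kind = .existential
        · obtain ⟨n', hn', ha⟩ := hw.existential_inv hk
          refine ⟨n', ?_, by omega, fun _ => by omega⟩
          simp only [Branch.joint, hk, and_self, if_true]
          exact ha
        · have hk' : c.kind = .accept := (hr.resolve_left (by simp)).resolve_left hk
          simp only [Branch.joint, hk, and_false, if_false]
          exact ⟨0, .accept hk', by omega, fun h => absurd hk' h⟩
      · simp only [Branch.joint, reduceCtorEq, false_and, if_false]
        exact ⟨n w, hw, by omega, fun _ => by omega⟩
    choose n' h1 h2 h3 using key
    obtain ⟨w₀, hw₀⟩ := not_forall.1 hacc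
    obtain ⟨T', hp, hT'⟩ := ih _ (by
      rw [← hN]
      exact Finset.sum_lt_sum (fun w _ => h2 w) ⟨w₀, Finset.mem_univ _, h3 w₀ hw₀⟩)
      (hT.joint hready he) (n := n') h1 (Finset.sum_congr rfl fun w _ => by simp [Branch.joint])
    exact ⟨T', hp.head hstep, hT'⟩
  · obtain ⟨w, hw⟩ := not_forall.1 hready
    simp only [Branch.Ready, not_or, not_not] at hw
    have hsingle : ∃ b n', BranchStep x w (T.1 w) b ∧ n w = n' + 1 ∧
        Along x σ w n' b.cnt (b.history (h w)) b.cfg := by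
      have ha := hn w
      rw [Branch.history_of_none hw.1] at ha
      rcases hk : (T.1 w).cfg.kind
      · exact absurd hk hw.2.1
      · obtain ⟨n', k', hn', hk', ha⟩ := ha.universal_inv hk
        refine ⟨_, n', .universal hw.1 hk hk', hn', ?_⟩
        rw [Branch.history_move]
        exact ha
      · obtain ⟨n', hn', ha⟩ := ha.deterministic_inv hk
        refine ⟨_, n', .deterministic hw.1 hk, hn', ?_⟩
        rw [Branch.history_move]
        exact ha
      · exact absurd hk hw.2.2
      · exact absurd hk ha.kind_ne_reject
    obtain ⟨b, n', hb, hn', ha⟩ := hsingle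
    have hstep := (teamStep_iff hT.inHead_lt).2 (Or.inl ⟨w, b, hb, rfl⟩)
    obtain ⟨T', hp, hT'⟩ := ih _ (by
      rw [← hN]
      refine Finset.sum_lt_sum (f := fun w' => 2 * Function.update n w n' w' +
        if (Function.update T.1 w b w').pend = none then 0 else 1) (fun w' _ => ?_)
        ⟨w, Finset.mem_univ _, ?_⟩
      · by_cases hw' : w' = w
        · subst hw'
          simp only [Function.update_self]
          split <;> split <;> omega
        · simp [hw']
      · simp only [Function.update_self]
        split <;> split <;> omega)
      (hT.single hb) (n := Function.update n w n') (fun w' => by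
        by_cases hw' : w' = w
        · subst hw'
          simpa using ha
        · simpa [hw'] using hn w') rfl
    exact ⟨T', hp.head hstep, hT'⟩

/-- A strategy can be read off from an accepting run of the team. -/
theorem exists_strategy {T T' : M.Team r} (hp : ReflTransGen (TeamStep x) T T')
    (hT' : T'.AllAccept) {m : ℕ} {h : M.Choices r → List M.Event} {v : M.Choices r → M.View}
    (hT : T.Inv x m h v) :
    ∃ σ : M.Strategy, ∀ w, ∃ n, Along x σ w n (T.1 w).cnt ((T.1 w).history (h w)) (T.1 w).cfg := by
  classical
  induction hp using ReflTransGen.head_induction_on generalizing m h v with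
  | refl => exact ⟨fun _ => Classical.arbitrary _, fun w => ⟨0, .accept (hT' w)⟩⟩
  | @head T T₁ hs _ ih =>
    rcases (teamStep_iff hT.inHead_lt).1 hs with ⟨w, b, hb, rfl⟩ | ⟨hr, e, he, rfl⟩
    · obtain ⟨σ, hσ⟩ := ih (hT.single hb)
      refine ⟨σ, fun w' => ?_⟩
      obtain ⟨n, hn⟩ := hσ w'
      by_cases hw : w' = w
      · subst hw
        simp only [Function.update_self] at hn
        cases hb with
        | deterministic h1 h2 =>
          rw [Branch.history_move] at hn
          rw [Branch.history_of_none h1]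
          exact ⟨_, .deterministic h2 hn⟩
        | universal h1 h2 h3 =>
          rw [Branch.history_move] at hn
          rw [Branch.history_of_none h1]
          exact ⟨_, .universal h2 h3 hn⟩
      · simp only [Function.update_of_ne hw] at hn
        exact ⟨n, hn⟩
    · obtain ⟨σ', hσ'⟩ := ih (hT.joint hr he)
      let σ : M.Strategy := fun g =>
        if hg : g.length = m ∧ ∃ w, h w = g then e hg.2.choose else σ' g
      have h1 : ∀ w, σ (h w) = e w := fun w => by
        have hg : (h w).length = m ∧ ∃ w', h w' = h w := ⟨hT.length_eq w, w, rfl⟩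
        simp only [σ, dif_pos hg]
        exact he _ _ ((hT.rel_iff _ _).2 hg.2.choose_spec)
      have h2 : ∀ g : List M.Event, m + 1 ≤ g.length → σ' g = σ g := fun g hg => by
        simp only [σ]
        rw [dif_neg fun h => by omega]
      refine ⟨σ, fun w => ?_⟩
      obtain ⟨n, hn⟩ := hσ' w
      have hn : Along x σ w n (T.1 w).cnt (h w ++ [(T.1 w).event (e w)])
          ((T.1 w).joint x (e w)).cfg :=
        hn.congr h2 (by simp [hT.length_eq w])
      have hrw := hr w
      generalize T.1 w = b at hn hrw
      obtain ⟨c, k, p⟩ := b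
      rcases p with _ | g
      · by_cases hk : c.kind = .existential
        · simp only [Branch.joint, hk, and_self, if_true] at hn
          refine ⟨n + 1, .existential hk ?_⟩
          have e1 : (Branch.history ⟨c, k, none⟩ (h w)) = h w := rfl
          rw [e1, h1]
          exact hn
        · exact ⟨0, .accept ((hrw.resolve_left (by simp)).resolve_left hk)⟩
      · simp only [Branch.joint, reduceCtorEq, false_and, if_false] at hn
        exact ⟨n, hn⟩

theorem accepts_iff_exists_team (hr : M.UniversalMovesAtMost r) : M.Accepts x ↔
    ∃ T, ReflTransGen (TeamStep x) (startTeam M r) T ∧ T.AllAccept := by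
  constructor
  · rintro ⟨σ, hσ⟩
    have hw : ∀ w : M.Choices r, ∃ n, Along x σ w n 0 [] M.startCfg := fun w =>
      hσ.exists_along hr w .start
    choose n hn using hw
    exact exists_allAccept (σ := σ) startTeam_inv (n := n) hn rfl
  · rintro ⟨T, hp, hT⟩
    obtain ⟨σ, hσ⟩ := exists_strategy hp hT startTeam_inv
    choose n hn using hσ
    have := Fintype.ofFinite (M.Choices r)
    exact ⟨σ, wins_of_along (N := ∑ w, n w) (k := (0 : Fin (r + 1)))
      (fun _ => Classical.arbitrary _) fun w _ =>
        ⟨n w, Finset.single_le_sum (fun _ _ => Nat.zero_le _) (Finset.mem_univ w), hn w⟩⟩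

/-! #### The simulating machine -/

variable (M r) in
/-- The machine that follows all branches; the state `none` is accepting. -/
def teamMachine : MTM α where
  State := Option ((M.Choices r → M.BranchState r) × (M.Choices r → M.Choices r → Prop))
  Sym := M.Sym
  Head := M.Choices r
  Tape := M.Choices r × (M.PubTape ⊕ M.PrivTape)
  blank := M.blank
  start := some (fun _ => (M.startPub, M.startPriv, 0, none), fun _ _ => True)
  accept := none
  next q i t := {a | ∃ S R, q = some (S, R) ∧
    (((∀ w, M.kind (S w).1 (S w).2.1 = .accept) ∧
      a = (none, fun _ => .stay, fun p => ((t p).1, .stay))) ∨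
    ∃ A R', TeamMove S R
      (fun w => (i w, fun p => t (w, .inl p), fun p => t (w, .inr p))) A R' ∧
      a = (some (fun w => (A w).1, R'), fun w => (A w).2.1,
        fun p => Sum.elim (A p.1).2.2.1 (A p.1).2.2.2 p.2))}

/-- The configuration of the simulating machine that corresponds to a team. -/
def teamCfg (T : M.Team r) : (teamMachine M r).Cfg where
  state := some (fun w => (T.1 w).state, T.2)
  heads := fun w => (T.1 w).cfg.inHead
  tapes := fun p => Sum.elim (T.1 p.1).cfg.pubTapes (T.1 p.1).cfg.privTapes p.2

/-- The accepting configuration that is reached from a team. -/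
def acceptCfg (T : M.Team r) : (teamMachine M r).Cfg where
  state := none
  heads := (teamCfg T).heads
  tapes := (teamCfg T).tapes

theorem teamCfg_startTeam : (teamMachine M r).startCfg = teamCfg (startTeam M r) := by
  simp only [MTM.startCfg, teamCfg]
  congr 1
  funext ⟨w, t⟩
  rcases t with t | t <;> rfl

theorem result_eq_teamCfg {T : M.Team r} {A : M.Choices r → M.BranchAction r}
    {R' : M.Choices r → M.Choices r → Prop} :
    (⟨some (fun w => (A w).1, R'), fun w => (A w).2.1.moveInput x.length ((teamCfg T).heads w),
      fun p => ((teamCfg T).tapes p).act (Sum.elim (A p.1).2.2.1 (A p.1).2.2.2 p.2)⟩ :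
      (teamMachine M r).Cfg) = teamCfg (fun w => (T.1 w).apply x (A w), R') := by
  simp only [teamCfg]
  congr 1
  funext ⟨w, t⟩
  rcases t with t | t <;> rfl

theorem step_teamCfg_iff {T : M.Team r} {c : (teamMachine M r).Cfg} :
    (teamMachine M r).Step x (teamCfg T) c ↔
      (∃ T', TeamStep x T T' ∧ c = teamCfg T') ∨ (T.AllAccept ∧ c = acceptCfg T) := by
  have hacc : (⟨none, fun w => Dir.stay.moveInput x.length ((teamCfg T).heads w),
      fun p => ((teamCfg T).tapes p).act (((teamCfg T).tapes p).read, .stay)⟩ :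
      (teamMachine M r).Cfg) = acceptCfg T := by
    simp only [acceptCfg, Binary.act_read_stay]
    rfl
  constructor
  · rintro ⟨a, ⟨S, R, hq, ha⟩, rfl⟩
    obtain ⟨rfl, rfl⟩ := Prod.mk.inj (Option.some.inj hq)
    rcases ha with ⟨h1, rfl⟩ | ⟨A, R', hA, rfl⟩
    · exact Or.inr ⟨h1, hacc⟩
    · exact Or.inl ⟨(_, R'), ⟨A, hA, rfl⟩, result_eq_teamCfg⟩
  · rintro (⟨⟨B, R'⟩, ⟨A, hA, hB⟩, rfl⟩ | ⟨h, rfl⟩)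
    · obtain rfl : B = _ := hB
      exact ⟨_, ⟨_, _, rfl, Or.inr ⟨A, R', hA, rfl⟩⟩, result_eq_teamCfg.symm⟩
    · exact ⟨_, ⟨_, _, rfl, Or.inl ⟨h, rfl⟩⟩, hacc.symm⟩

theorem reachable_teamMachine {c : (teamMachine M r).Cfg} (h : (teamMachine M r).Reachable x c) :
    ∃ T, ReflTransGen (TeamStep x) (startTeam M r) T ∧
      (c = teamCfg T ∨ (T.AllAccept ∧ c = acceptCfg T)) := by
  induction h with
  | refl => exact ⟨_, .refl, Or.inl teamCfg_startTeam⟩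
  | tail _ hs ih =>
    obtain ⟨T, hT, rfl | ⟨-, rfl⟩⟩ := ih
    · rcases step_teamCfg_iff.1 hs with ⟨T', hT', rfl⟩ | ⟨hacc, rfl⟩
      · exact ⟨T', hT.tail hT', Or.inl rfl⟩
      · exact ⟨T, hT, Or.inr ⟨hacc, rfl⟩⟩
    · obtain ⟨a, ⟨S, R, hq, -⟩, -⟩ := hs
      cases hq

theorem teamMachine_accepts_iff : (teamMachine M r).Accepts x ↔
    ∃ T, ReflTransGen (TeamStep x) (startTeam M r) T ∧ T.AllAccept := by
  constructor
  · rintro ⟨c, hc, ha⟩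
    obtain ⟨T, hT, rfl | ⟨h, -⟩⟩ := reachable_teamMachine hc
    · cases ha
    · exact ⟨T, hT, h⟩
  · rintro ⟨T, hT, h⟩
    have hp : ReflTransGen ((teamMachine M r).Step x) (teamCfg (startTeam M r)) (teamCfg T) :=
      ReflTransGen.lift teamCfg (fun T T' hs => step_teamCfg_iff.2 (Or.inl ⟨T', hs, rfl⟩)) _ _ hT
    rw [← teamCfg_startTeam] at hp
    exact ⟨acceptCfg T, hp.tail (step_teamCfg_iff.2 (Or.inr ⟨h, rfl⟩)), rfl⟩

theorem teamMachine_spaceBounded {s : ℕ → ℕ} (hM : M.SpaceBounded s) :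
    (teamMachine M r).SpaceBounded s := by
  rintro x c hc ⟨w, t⟩
  obtain ⟨T, hT, h⟩ := reachable_teamMachine hc
  have hinv : ∃ m h v, T.Inv x m h v := by
    clear h
    induction hT with
    | refl => exact ⟨_, _, _, startTeam_inv⟩
    | tail _ hs ih =>
      obtain ⟨m, h, v, hT⟩ := ih
      exact hT.step hs
  obtain ⟨m, g, v, hinv⟩ := hinv
  have hb := hM x _ _ (hinv.branch w).1
  rcases h with rfl | ⟨-, rfl⟩ <;> rcases t with t | t
  · exact hb.1 t
  · exact hb.2 t
  · exact hb.1 t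
  · exact hb.2 t

end PATM

theorem paspaceConst_subset_mnl {α : Type} {s : ℕ → ℕ} (hs : IsLogBound s) :
    PASPACEConst α s ⊆ MNL α := by
  rintro L ⟨M, hM, ⟨r, hr⟩, hL⟩
  refine ⟨s, hs, M.teamMachine r, PATM.teamMachine_spaceBounded hM, fun x => ?_⟩
  rw [hL x, PATM.teamMachine_accepts_iff, PATM.accepts_iff_exists_team hr]

theorem baspaceConst_subset_paspaceConst (α : Type) (s : ℕ → ℕ) :
    BASPACEConst α s ⊆ PASPACEConst α s :=
  fun _ ⟨M, _, h⟩ => ⟨M, h⟩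

end PrivAlt

theorem mainTheorem2 (α : Type) [Finite α] (s : ℕ → ℕ) (hs : PrivAlt.IsLogBound s) :
    PrivAlt.PASPACEConst α s = PrivAlt.NL α ∧ PrivAlt.BASPACEConst α s = PrivAlt.NL α := by
  have h1 : PrivAlt.NL α ⊆ PrivAlt.BASPACEConst α s :=
    (PrivAlt.nl_subset_mnl α).trans
      ((PrivAlt.mnl_subset_counterNL α).trans (PrivAlt.counterNL_subset_baspaceConst α s))
  have h2 : PrivAlt.BASPACEConst α s ⊆ PrivAlt.PASPACEConst α s :=
    PrivAlt.baspaceConst_subset_paspaceConst α s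
  have h3 : PrivAlt.PASPACEConst α s ⊆ PrivAlt.NL α :=
    (PrivAlt.paspaceConst_subset_mnl hs).trans
      ((PrivAlt.mnl_subset_counterNL α).trans (PrivAlt.counterNL_subset_nl α))
  exact ⟨h3.antisymm (h1.trans h2), (h2.trans h3).antisymm h1⟩
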